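/- **Conventions.** Let $\mathbf P_m$ be a convex $m$-gon and $\mathbf P_m^\bullet$ a convex $m$-gon with one puncture $p$ in its interior (for $m=2$, a once-punctured digon); the vertices are labelled clockwise by $\mathbb Z/m$. Marked points are the vertices and, if present, $p$. An *arc* is a non-self-intersecting curve, up to isotopy, between two distinct marked points, whose relative interior avoids the boundary and $p$ and which does not cut out an unpunctured digon; an arc ending at $p$ is a *radius*. A *tagged arc* is an arc between vertices, or a radius labelled plain or notched. Two tagged arcs are *compatible* if their untagged versions have non-crossing representatives, except that a plain and a notched radius are compatible only if their untagged versions coincide. A *triangulation* $T$ is a maximal set of pairwise compatible tagged arcs. Two different elements of $T\cup\{\text{boundary segments}\}$ are *adjacent* in $T$ if they are sides of a common triangle of $T$, or if they are among the two sides of a once-punctured digon and the plain and notched version of one radius inside it, both versions belonging to $T$; however, two radii inside a once-punctured digon of $T$ are not adjacent. (The sides of a digon or triangle may be boundary segments.) The *quadrilateral* $q_T(\gamma)$ of $\gamma\in T$ is the set of arcs of $T$ and boundary segments adjacent to $\gamma$; if $\gamma$ is a radius inside a once-punctured digon of $T$, the two other tagged radii inside this digon that are compatible with $\gamma$ are added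 to this set. Let $\mathbf P_{2n+2}^{G}$ be $\mathbf P_{2n+2}$ with $G=\mathbb Z/2\mathbb Z$ acting by $i\mapsto i'=i+n+1$, and $\mathbf P_m^{\bullet G}$ be $\mathbf P_m^\bullet$ with $G$ acting by switching the tags of radii. The triangulations of these are the $G$-invariant triangulations $T$, and for $\gamma \in T$ the quadrilateral $q_T([\gamma])$ of the orbit $[\gamma]$ is the set of arcs of $T$ and boundary segments adjacent to an arc of $[\gamma]$. Let $\mathfrak q(\mathbf P)$ be the number of distinct sets that occur as quadrilaterals in triangulations of $\mathbf P$. Let $\delta_i$ be the diameter of $\mathbf P_{2n+2}$ joining $i$ and $i'$; it cuts $\mathbf P_{2n+2}$ into two half-disks. Let $Q$ be the set of quadrilaterals of $\mathbf P_{2n+2}$, let $Q_1\subseteq Q$ be the set of those contained in a closed $\delta_i$-half-disk for some $i$, and let $Q_2\subseteq Q\setminus Q_1$ be the set of those whose vertex set is not of the form $\{i,j,i',j'\}$. **Proposition.** 1. For $n\ge 0$: $\mathfrak q(\mathbf P_{n+3})=\binom{n+3}{4}$. 2. For $n\ge 2$: $\mathfrak q(\mathbf P_n^\bullet)=4\binom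 n4+9\binom n3+2\binom n2=\frac16 n(n-1)(n^2+4n-6)$. 3. For $n\ge 1$: $\mathfrak q(\mathbf P_{n+1}^{\bullet G})=4\binom{n+1}4+3\binom{n+1}3+\binom{n+1}2=\frac16 n(n+1)(n^2+2)$. 4. For $n\ge 1$ there is a bijection $\alpha:Q_1\to Q_2$ that flips one vertex: if the vertices of $q\in Q_1$, listed clockwise starting from a point of an open half-disk containing no vertex of $q$, are $a,b,c,d$, then $\alpha(q)$ is the quadrilateral with vertex set $\{a,c,d,b'\}$. 5. For $n\ge 1$: $\mathfrak q(\mathbf P_{2n+2}^{G})=\frac12|Q_1|+\binom{n+1}2=\frac16 n(n+1)(n^2+2)$. -/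

import Mathlib

noncomputable section

/-- The `k`-th vertex of the regular `m`-gon inscribed in the unit circle of `ℂ`,
the vertices being labelled clockwise by `ZMod m`. -/
def polyVertex (m : ℕ) (k : ZMod m) : ℂ :=
  Complex.exp (-(2 * Real.pi * Complex.I * (k.val : ℂ) / (m : ℂ)))

/-! ### Convex polygons

Every isotopy class of curves in a convex polygon joining two distinct vertices contains exactly one
straight segment, and two classes have non-crossing representatives exactly when the two segments do
not cross. So the segment joining the vertices `i` and `j` is recorded as `s(i, j)`. -/

namespace ConvexPolygon

variable {m : ℕ}

/-- The sides of the polygon. -/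
def IsBoundary (e : Sym2 (ZMod m)) : Prop := ∃ i : ZMod m, e = s(i, i + 1)

/-- Arcs join distinct vertices and do not cut out a digon. -/
def IsArc (e : Sym2 (ZMod m)) : Prop := ¬ e.IsDiag ∧ ¬ IsBoundary e

/-- Two different segments cross if their relative interiors meet. -/
def Crosses (e f : Sym2 (ZMod m)) : Prop :=
  e ≠ f ∧ ∃ a b c d : ZMod m, e = s(a, b) ∧ f = s(c, d) ∧
    (openSegment ℝ (polyVertex m a) (polyVertex m b) ∩
      openSegment ℝ (polyVertex m c) (polyVertex m d)).Nonempty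

/-- A triangulation is a maximal collection of pairwise non-crossing arcs. -/
def IsTriangulation (T : Set (Sym2 (ZMod m))) : Prop :=
  Maximal (fun S : Set (Sym2 (ZMod m)) =>
    (∀ e ∈ S, IsArc e) ∧ ∀ e ∈ S, ∀ f ∈ S, ¬ Crosses e f) T

/-- The edges of a triangulation: its arcs and the boundary segments. -/
def edges (T : Set (Sym2 (ZMod m))) : Set (Sym2 (ZMod m)) := {e | e ∈ T ∨ IsBoundary e}

/-- Two different edges are adjacent if they are sides of a common triangle. -/
def Adjacent (T : Set (Sym2 (ZMod m))) (e f : Sym2 (ZMod m)) : Prop :=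
  e ≠ f ∧ ∃ a b c : ZMod m, e = s(a, b) ∧ f = s(b, c) ∧
    s(a, b) ∈ edges T ∧ s(b, c) ∈ edges T ∧ s(c, a) ∈ edges T

/-- The quadrilateral of an arc `γ` of a triangulation `T`. -/
def quadrilateral (T : Set (Sym2 (ZMod m))) (γ : Sym2 (ZMod m)) : Set (Sym2 (ZMod m)) :=
  {e | e ∈ edges T ∧ Adjacent T γ e}

/-- The set of all quadrilaterals of the convex `m`-gon. -/
def quadrilaterals (m : ℕ) : Set (Set (Sym2 (ZMod m))) :=
  {q | ∃ T γ, IsTriangulation T ∧ γ ∈ T ∧ q = quadrilateral T γ}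

/-- The vertices of a quadrilateral. -/
def vertices (q : Set (Sym2 (ZMod m))) : Set (ZMod m) := {v | ∃ e ∈ q, v ∈ e}

end ConvexPolygon

/-! ### The `(2n+2)`-gon with its central symmetry -/

namespace SymmetricPolygon

open ConvexPolygon

variable {n : ℕ}

/-- The vertex `i' = i + n + 1`. -/
def opp (i : ZMod (2 * n + 2)) : ZMod (2 * n + 2) := i + ((n + 1 : ℕ) : ZMod (2 * n + 2))

/-- The action of the nontrivial element of `ℤ/2ℤ` on segments. -/
def act (e : Sym2 (ZMod (2 * n + 2))) : Sym2 (ZMod (2 * n + 2)) := e.map opp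

/-- The orbit of a segment. -/
def orbit (e : Sym2 (ZMod (2 * n + 2))) : Set (Sym2 (ZMod (2 * n + 2))) := {e, act e}

/-- Centrally symmetric triangulations. -/
def IsSymmTriangulation (T : Set (Sym2 (ZMod (2 * n + 2)))) : Prop :=
  IsTriangulation T ∧ act '' T = T

/-- The quadrilateral of the orbit of `γ`: all arcs and boundary segments that are adjacent to an
arc of the orbit. -/
def orbitQuadrilateral (T : Set (Sym2 (ZMod (2 * n + 2)))) (γ : Sym2 (ZMod (2 * n + 2))) :
    Set (Sym2 (ZMod (2 * n + 2))) :=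
  {e | e ∈ edges T ∧ ∃ δ ∈ orbit γ, Adjacent T δ e}

/-- The set of all quadrilaterals of the `(2n+2)`-gon with its central symmetry. -/
def orbitQuadrilaterals (n : ℕ) : Set (Set (Sym2 (ZMod (2 * n + 2)))) :=
  {q | ∃ T γ, IsSymmTriangulation T ∧ γ ∈ T ∧ q = orbitQuadrilateral T γ}

/-- The vertices of the closed half-disk cut off by the diameter from `i` to `i'` that are met going
clockwise from `i` to `i'`. The other closed half-disk of this diameter is `halfDisk (opp i)`. -/
def halfDisk (i : ZMod (2 * n + 2)) : Set (ZMod (2 * n + 2)) := {v | (v - i).val ≤ n + 1}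

/-- `Q₁`: the quadrilaterals of the `(2n+2)`-gon that lie in some closed half-disk. -/
def Q₁ (n : ℕ) : Set (Set (Sym2 (ZMod (2 * n + 2)))) :=
  {q | q ∈ quadrilaterals (2 * n + 2) ∧
    ∃ i, vertices q ⊆ halfDisk i ∨ vertices q ⊆ halfDisk (opp i)}

/-- `Q₂`: the remaining quadrilaterals whose vertex set is not of the form `{i, j, i', j'}`. -/
def Q₂ (n : ℕ) : Set (Set (Sym2 (ZMod (2 * n + 2)))) :=
  {q | q ∈ quadrilaterals (2 * n + 2) ∧ q ∉ Q₁ n ∧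
    ¬ ∃ i j, vertices q = {i, j, opp i, opp j}}

/-- `(a, b, c, d)` lists the vertices of `q` clockwise, starting from a point of an open half-disk
that contains no vertex of `q`. -/
def IsHalfDiskList (q : Set (Sym2 (ZMod (2 * n + 2)))) (a b c d : ZMod (2 * n + 2)) : Prop :=
  vertices q = {a, b, c, d} ∧
    0 < (b - a).val ∧ (b - a).val < (c - a).val ∧ (c - a).val < (d - a).val ∧
    vertices q ⊆ halfDisk a

end SymmetricPolygon

/-! ### Once-punctured polygons

The once-punctured `n`-gon is the closed unit disk with puncture `0` and with the vertices of the
regular `n`-gon as marked points on its boundary. The map `z ↦ exp (-2πiz/n)` from the lower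
half-plane onto the punctured open disk is its universal cover; it sends the boundary points
`0, 1, 2, …` to the vertices in clockwise order. -/

/-- Tagged curves up to isotopy. The curve `chord i j`, for `i ≠ j`, joins the vertices `i` and `j`
and leaves the puncture on the side away from the clockwise boundary path from `i` to `j`; so the two
classes of curves between `i` and `j` are `chord i j` and `chord j i`, and `chord i (i + 1)` is a
boundary segment. The curve `radius i t` joins the vertex `i` to the puncture; it is notched
if `t = true` and plain if `t = false`. -/
inductive TaggedCurve (n : ℕ) : Type
  | chord (i j : ZMod n)
  | radius (i : ZMod n) (t : Bool)

namespace PuncturedPolygon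

open TaggedCurve

variable {n : ℕ}

/-- The hyperbolic geodesic of the lower half-plane with real endpoints `a < b`. -/
def geodesic (a b : ℝ) : Set ℂ := {z | z.im < 0 ∧ ‖z - (((a + b) / 2 : ℝ) : ℂ)‖ = (b - a) / 2}

/-- The geodesic representative (relative interior) of the untagged version of a curve. Any two such
representatives meet as few times as their isotopy classes permit. -/
def curve : TaggedCurve n → Set ℂ
  | chord i j => {w | ∃ a b : ℤ, (a : ZMod n) = i ∧ (b : ZMod n) = j ∧ a < b ∧ b < a + n ∧
      ∃ z ∈ geodesic a b, w = Complex.exp (-(2 * Real.pi * Complex.I * z / (n : ℂ)))}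
  | radius i _ => openSegment ℝ 0 (polyVertex n i)

/-- The boundary segments. -/
def IsBoundary (x : TaggedCurve n) : Prop := ∃ i : ZMod n, x = chord i (i + 1)

/-- Tagged arcs. -/
def IsArc : TaggedCurve n → Prop
  | chord i j => i ≠ j ∧ ¬ IsBoundary (chord i j)
  | radius _ _ => True

/-- Two tagged arcs are compatible if their untagged versions coincide or do not cross; two radii
with different tags are compatible only if their untagged versions coincide. -/
def Compatible : TaggedCurve n → TaggedCurve n → Prop
  | radius i s, radius j t => i = j ∨ s = t
  | x, y => x = y ∨ Disjoint (curve x) (curve y)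

/-- A tagged triangulation is a maximal collection of pairwise compatible tagged arcs. -/
def IsTriangulation (T : Set (TaggedCurve n)) : Prop :=
  Maximal (fun S : Set (TaggedCurve n) =>
    (∀ x ∈ S, IsArc x) ∧ ∀ x ∈ S, ∀ y ∈ S, Compatible x y) T

/-- The edges of a triangulation: its arcs and the boundary segments. -/
def edges (T : Set (TaggedCurve n)) : Set (TaggedCurve n) := {x | x ∈ T ∨ IsBoundary x}

/-- The triangles of `T`, as sets of three sides. Either all three corners are vertices, and then the
triangle lifts to the triangle of the universal cover with corners `a < b < c`, or one corner is the
puncture. -/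
def triangles (T : Set (TaggedCurve n)) : Set (Set (TaggedCurve n)) :=
  {Δ | Δ ⊆ edges T ∧
    ((∃ a b c : ℤ, a < b ∧ b < c ∧ c < a + n ∧
        Δ = {chord (a : ZMod n) b, chord (b : ZMod n) c, chord (a : ZMod n) c}) ∨
      ∃ (i j : ZMod n) (t : Bool), i ≠ j ∧ Δ = {chord i j, radius i t, radius j t})}

/-- `T` contains (up to boundary segments) the sides of the once-punctured digon with vertices
`i` and `j`. -/
def HasDigon (T : Set (TaggedCurve n)) (i j : ZMod n) : Prop :=
  i ≠ j ∧ chord i j ∈ edges T ∧ chord j i ∈ edges T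

/-- The four tagged radii inside the once-punctured digon with vertices `i` and `j`. -/
def digonRadii (i j : ZMod n) : Set (TaggedCurve n) := {x | ∃ t, x = radius i t ∨ x = radius j t}

/-- Adjacency of edges of `T`. Two different edges are adjacent if they are sides of a common triangle,
or if they are among the two sides of a once-punctured digon and the plain and notched version of the
same radius, which both lie in `T` and subdivide the digon. However, two radii inside a
once-punctured digon are never adjacent. -/
def Adjacent (T : Set (TaggedCurve n)) (x y : TaggedCurve n) : Prop :=
  x ≠ y ∧
    ((∃ Δ ∈ triangles T, x ∈ Δ ∧ y ∈ Δ) ∨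
      ∃ i j : ZMod n, HasDigon T i j ∧ (∀ t, radius i t ∈ T) ∧
        x ∈ ({chord i j, chord j i, radius i false, radius i true} : Set (TaggedCurve n)) ∧
        y ∈ ({chord i j, chord j i, radius i false, radius i true} : Set (TaggedCurve n))) ∧
    ¬ ∃ i j : ZMod n, HasDigon T i j ∧ x ∈ digonRadii i j ∧ y ∈ digonRadii i j

/-- The quadrilateral of an arc `γ` of `T`: the edges of `T` adjacent to `γ` and, if `γ` is a radius
inside a once-punctured digon, also the two other radii inside this digon that are compatible
with `γ`. -/
def quadrilateral (T : Set (TaggedCurve n)) (γ : TaggedCurve n) : Set (TaggedCurve n) :=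
  {x | x ∈ edges T ∧ Adjacent T γ x} ∪
    {x | ∃ i j : ZMod n, HasDigon T i j ∧ γ ∈ digonRadii i j ∧
      x ∈ digonRadii i j ∧ x ≠ γ ∧ Compatible γ x}

/-- The set of all quadrilaterals of the once-punctured `n`-gon. -/
def quadrilaterals (n : ℕ) : Set (Set (TaggedCurve n)) :=
  {q | ∃ T γ, IsTriangulation T ∧ γ ∈ T ∧ q = quadrilateral T γ}

/-- The action of the nontrivial element of `ℤ/2ℤ`: it switches the tags of radii. -/
def act : TaggedCurve n → TaggedCurve n
  | chord i j => chord i j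
  | radius i t => radius i (!t)

/-- The orbit of a tagged curve. -/
def orbit (x : TaggedCurve n) : Set (TaggedCurve n) := {x, act x}

/-- Triangulations fixed by the action. -/
def IsSymmTriangulation (T : Set (TaggedCurve n)) : Prop := IsTriangulation T ∧ act '' T = T

/-- The quadrilateral of the orbit of `γ`: all arcs and boundary segments that are adjacent to an
arc of the orbit. -/
def orbitQuadrilateral (T : Set (TaggedCurve n)) (γ : TaggedCurve n) : Set (TaggedCurve n) :=
  {x | x ∈ edges T ∧ ∃ δ ∈ orbit γ, Adjacent T δ x}

/-- The set of all quadrilaterals of the once-punctured `n`-gon with the tag-switching action. -/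
def orbitQuadrilaterals (n : ℕ) : Set (Set (TaggedCurve n)) :=
  {q | ∃ T γ, IsSymmTriangulation T ∧ γ ∈ T ∧ q = orbitQuadrilateral T γ}

end PuncturedPolygon

end

/-!
The polygons are studied through integer lifts of their vertices. In the convex `m`-gon, two
segments cross exactly if they have lifts `a < c < b < d < a + m` that are interlaced
(`ConvexPolygon.crosses_of_interlaced`, `ConvexPolygon.Crosses.exists_interlaced`). In the
once-punctured polygon, a chord is the image of a geodesic with integer endpoints under the
universal cover of the punctured disk, and again two chords cross exactly if two lifts are
interlaced, while a chord meets a radius exactly if it covers a lift of the endpoint of the radius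
(`PuncturedPolygon.compatible_chord_chord_iff`, `PuncturedPolygon.disjoint_chord_radius_iff`). After
this translation everything is a matter of inequalities between integers.

In a triangulation of the convex polygon each side of an arc bounds a triangle, so the quadrilateral
of an arc consists of the four sides of a polygon with four vertices. Conversely, four vertices with
one diagonal form a laminar family, which extends to a triangulation. Hence quadrilaterals
correspond to four-element sets of vertices (`ConvexPolygon.mem_quadrilaterals_iff`).

A centrally symmetric triangulation contains exactly one diameter. Its quadrilateral is a rectangle
`{i, j, i', j'}`, of which there are `(n + 1).choose 2`. Any other arc has its quadrilateral in a
closed half-disk of the diameter, so the quadrilateral of its orbit is the union of an element of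
`Q₁` and its image under the symmetry (`SymmetricPolygon.mem_orbitQuadrilaterals_iff`). An element
of `Q₁` is given by its first vertex `a` and three later vertices within a half-turn of `a`, and the
symmetry permutes `Q₁` freely. The vertex flip is a bijection because the elements of `Q₂` are
exactly the quadrilaterals with vertices `a`, `c`, `d`, `b'` (`SymmetricPolygon.mem_Q₂_iff`), and
the vertices of a quadrilateral determine their clockwise listing up to rotation.

In the once-punctured polygon the quadrilaterals have four shapes, according to how they meet the
puncture (`PuncturedPolygon.quadrilaterals_eq`): polygons with four vertices and the puncture
outside; polygons with three vertices and the puncture as a fourth corner, with either tag;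
once-punctured triangles with both versions of one radius; and once-punctured digons with two radii
of different tags. In a tag-symmetric triangulation all radii end at one vertex and occur with both
tags, so only the first and the third shape survive, and the orbit of a radius contributes the bare
digons (`PuncturedPolygon.orbitQuadrilaterals_eq`). Each shape is given by a first vertex and an
increasing sequence of offsets less than `n`, except for the bare digons, which are given by
unordered pairs of vertices.
-/

/-! ### Integer representatives of residues -/

theorem intCast_zmod_eq_iff {m : ℕ} (a b : ℤ) :
    (a : ZMod m) = (b : ZMod m) ↔ ∃ k : ℤ, b = a + k * m := by
  rw [ZMod.intCast_eq_intCast_iff_dvd_sub]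
  constructor
  · rintro ⟨k, hk⟩
    exact ⟨k, by rw [mul_comm]; omega⟩
  · rintro ⟨k, hk⟩
    exact ⟨k, by rw [mul_comm]; omega⟩

theorem exists_int_lift {m : ℕ} (hm : 0 < m) (i : ZMod m) (a : ℤ) :
    ∃ c : ℤ, (c : ZMod m) = i ∧ a ≤ c ∧ c < a + m := by
  have : NeZero m := ⟨hm.ne'⟩
  refine ⟨a + (i - (a : ZMod m)).val, ?_, by omega, ?_⟩
  · push_cast
    rw [ZMod.natCast_zmod_val]
    ring
  · have := ZMod.val_lt (i - (a : ZMod m))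
    omega

/-- The case split through which `omega` handles multiples of the symbolic modulus. -/
theorem mul_modulus_cases {m : ℕ} (k : ℤ) :
    k * m ≤ -2 * m ∨ k * m = -m ∨ k * m = 0 ∨ k * m = m ∨ 2 * (m : ℤ) ≤ k * m := by
  rcases lt_trichotomy k 0 with h | h | h
  · rcases (show k ≤ -2 ∨ k = -1 by omega) with h | h
    · left; nlinarith
    · right; left; rw [h]; ring
  · right; right; left; rw [h]; ring
  · rcases (show 2 ≤ k ∨ k = 1 by omega) with h | h
    · right; right; right; right; nlinarith
    · right; right; right; left; rw [h]; ring

theorem intCast_add_modulus {m : ℕ} (a : ℤ) : ((a + m : ℤ) : ZMod m) = a := by simp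

theorem intCast_add_mul_modulus {m : ℕ} (a k : ℤ) : ((a + k * m : ℤ) : ZMod m) = a := by simp

/-! ### Crossing segments in the convex polygon -/

namespace ConvexPolygon

theorem polyVertex_intCast {m : ℕ} (hm : 0 < m) (a : ℤ) :
    polyVertex m (a : ZMod m) = Complex.exp (-(2 * Real.pi * Complex.I * (a : ℂ) / (m : ℂ))) := by
  have : NeZero m := ⟨hm.ne'⟩
  have hm' : (m : ℂ) ≠ 0 := by exact_mod_cast hm.ne'
  unfold polyVertex
  rw [Complex.exp_eq_exp_iff_exists_int]
  refine ⟨a / m, ?_⟩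
  have h1 : (((a : ZMod m).val : ℤ) : ℂ) = ((a % m : ℤ) : ℂ) := by rw [ZMod.val_intCast]
  have h2 : ((a % m : ℤ) : ℂ) + (m : ℂ) * ((a / m : ℤ) : ℂ) = (a : ℂ) := by
    exact_mod_cast Int.emod_add_mul_ediv a m
  rw [Int.cast_natCast] at h1
  rw [h1, ← h2]
  field_simp
  ring

theorem norm_polyVertex {m : ℕ} (i : ZMod m) : ‖polyVertex m i‖ = 1 := by
  unfold polyVertex
  rw [show -(2 * Real.pi * Complex.I * (i.val : ℂ) / (m : ℂ))
    = ((-(2 * Real.pi * i.val / m) : ℝ) : ℂ) * Complex.I by push_cast; ring]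
  exact Complex.norm_exp_ofReal_mul_I _

/-- An affine function whose zero set is the line through the vertices `a` and `b`. -/
noncomputable def side (m : ℕ) (a b : ℤ) (z : ℂ) : ℝ :=
  (z * Complex.exp (((Real.pi * (a + b) / m : ℝ) : ℂ) * Complex.I)).re
    - Real.cos (Real.pi * (b - a) / m)

theorem side_polyVertex {m : ℕ} (hm : 0 < m) (a b c : ℤ) :
    side m a b (polyVertex m (c : ZMod m))
      = 2 * Real.sin (Real.pi * (c - a) / m) * Real.sin (Real.pi * (b - c) / m) := by
  unfold side
  rw [polyVertex_intCast hm, ← Complex.exp_add,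
    show -(2 * Real.pi * Complex.I * (c : ℂ) / (m : ℂ))
      + ((Real.pi * (a + b) / m : ℝ) : ℂ) * Complex.I
      = ((Real.pi * (a + b - 2 * c) / m : ℝ) : ℂ) * Complex.I by push_cast; ring,
    Complex.exp_ofReal_mul_I_re, Real.cos_sub_cos,
    show (Real.pi * (a + b - 2 * c) / m + Real.pi * (b - a) / m) / 2 = Real.pi * (b - c) / m by ring,
    show (Real.pi * (a + b - 2 * c) / m - Real.pi * (b - a) / m) / 2
      = -(Real.pi * (c - a) / m) by ring, Real.sin_neg]
  ring

theorem sin_pi_div_pos {m : ℕ} (hm : 0 < m) {x : ℤ} (h0 : 0 < x) (h1 : x < m) :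
    0 < Real.sin (Real.pi * x / m) := by
  have hm' : (0 : ℝ) < m := by exact_mod_cast hm
  have hx : (0 : ℝ) < x := by exact_mod_cast h0
  have hx1 : (x : ℝ) < m := by exact_mod_cast h1
  apply Real.sin_pos_of_pos_of_lt_pi
  · positivity
  · rw [div_lt_iff₀ hm']
    exact mul_lt_mul_of_pos_left hx1 Real.pi_pos

theorem side_pos {m : ℕ} (hm : 0 < m) {a b c : ℤ} (hac : a < c) (hcb : c < b) (hb : b < a + m) :
    0 < side m a b (polyVertex m (c : ZMod m)) := by
  rw [side_polyVertex hm]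
  have h1 := sin_pi_div_pos hm (x := c - a) (by omega) (by omega)
  have h2 := sin_pi_div_pos hm (x := b - c) (by omega) (by omega)
  push_cast at h1 h2
  positivity

theorem side_neg {m : ℕ} (hm : 0 < m) {a b c : ℤ} (hab : a < b) (hbc : b < c) (hc : c < a + m) :
    side m a b (polyVertex m (c : ZMod m)) < 0 := by
  rw [side_polyVertex hm]
  have h1 := sin_pi_div_pos hm (x := c - a) (by omega) (by omega)
  have h2 := sin_pi_div_pos hm (x := c - b) (by omega) (by omega)
  push_cast at h1 h2
  rw [show Real.pi * (b - c : ℝ) / m = -(Real.pi * (c - b) / m) by ring, Real.sin_neg]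
  nlinarith [mul_pos h1 h2]

theorem side_left {m : ℕ} (hm : 0 < m) (a b : ℤ) :
    side m a b (polyVertex m (a : ZMod m)) = 0 := by
  rw [side_polyVertex hm]; simp

theorem side_right {m : ℕ} (hm : 0 < m) (a b : ℤ) :
    side m a b (polyVertex m (b : ZMod m)) = 0 := by
  rw [side_polyVertex hm]; simp

theorem side_combo (m : ℕ) (a b : ℤ) (z w : ℂ) {x y : ℝ} (hxy : x + y = 1) :
    side m a b (x • z + y • w) = x * side m a b z + y * side m a b w := by
  unfold side
  rw [add_mul, smul_mul_assoc, smul_mul_assoc, Complex.add_re, Complex.smul_re, Complex.smul_re,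
    smul_eq_mul, smul_eq_mul]
  linear_combination Real.cos (Real.pi * (b - a) / m) * hxy

/-- Inside the unit disk, the line through two vertices is the segment between them. -/
theorem mem_openSegment_of_side_eq_zero {m : ℕ} (hm : 0 < m) {a b : ℤ} (hab : a < b)
    (hb : b < a + m) {z : ℂ} (hz : ‖z‖ < 1) (hs : side m a b z = 0) :
    z ∈ openSegment ℝ (polyVertex m (a : ZMod m)) (polyVertex m (b : ZMod m)) := by
  set u : ℂ := Complex.exp (((Real.pi * (a + b) / m : ℝ) : ℂ) * Complex.I) with hu
  set ψ : ℝ := Real.pi * (b - a) / m with hψ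
  have hsin : 0 < Real.sin ψ := by
    have := sin_pi_div_pos hm (x := b - a) (by omega) (by omega)
    push_cast at this
    exact this
  have hun : ‖u‖ = 1 := Complex.norm_exp_ofReal_mul_I _
  have hu0 : u ≠ 0 := Complex.exp_ne_zero _
  have hre : (z * u).re = Real.cos ψ := by
    unfold side at hs
    linarith
  have hnorm : (z * u).re ^ 2 + (z * u).im ^ 2 < 1 := by
    have h1 : ‖z * u‖ < 1 := by rw [norm_mul, hun, mul_one]; exact hz
    have h2 := Complex.sq_norm (z * u)
    rw [Complex.normSq_apply] at h2
    nlinarith [norm_nonneg (z * u)]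
  set t := (z * u).im with ht
  have hcs := Real.sin_sq_add_cos_sq ψ
  have ht2 : t ^ 2 < Real.sin ψ ^ 2 := by rw [hre] at hnorm; linarith
  have habs := abs_lt_of_sq_lt_sq' ht2 hsin.le
  have hA : polyVertex m (a : ZMod m) * u = Real.cos ψ + Real.sin ψ * Complex.I := by
    rw [polyVertex_intCast hm, hu, ← Complex.exp_add,
      show -(2 * Real.pi * Complex.I * (a : ℂ) / (m : ℂ))
        + ((Real.pi * (a + b) / m : ℝ) : ℂ) * Complex.I = (ψ : ℂ) * Complex.I by
        rw [hψ]; push_cast; ring, Complex.exp_mul_I, Complex.ofReal_cos, Complex.ofReal_sin]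
  have hB : polyVertex m (b : ZMod m) * u = Real.cos ψ - Real.sin ψ * Complex.I := by
    rw [polyVertex_intCast hm, hu, ← Complex.exp_add,
      show -(2 * Real.pi * Complex.I * (b : ℂ) / (m : ℂ))
        + ((Real.pi * (a + b) / m : ℝ) : ℂ) * Complex.I = ((-ψ : ℝ) : ℂ) * Complex.I by
        rw [hψ]; push_cast; ring, Complex.exp_mul_I, ← Complex.ofReal_cos, ← Complex.ofReal_sin,
      Real.cos_neg, Real.sin_neg]
    push_cast; ring
  refine ⟨(t / Real.sin ψ + 1) / 2, (1 - t / Real.sin ψ) / 2, ?_, ?_, by ring, ?_⟩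
  · have : -1 < t / Real.sin ψ := by rw [lt_div_iff₀ hsin]; linarith [habs.1]
    linarith
  · have : t / Real.sin ψ < 1 := by rw [div_lt_one hsin]; exact habs.2
    linarith
  · apply mul_right_cancel₀ hu0
    have hz' : z * u = Real.cos ψ + t * Complex.I := by
      rw [← Complex.re_add_im (z * u), hre]
    have hts : t = t / Real.sin ψ * Real.sin ψ := by field_simp
    rw [add_mul, smul_mul_assoc, smul_mul_assoc, hA, hB, hz', Complex.real_smul, Complex.real_smul]
    generalize t / Real.sin ψ = r at hts ⊢
    rw [hts]
    push_cast
    ring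

theorem norm_lt_one_of_mem_openSegment {m : ℕ} {i j : ZMod m}
    (hij : polyVertex m i ≠ polyVertex m j) {z : ℂ}
    (hz : z ∈ openSegment ℝ (polyVertex m i) (polyVertex m j)) : ‖z‖ < 1 := by
  have := openSegment_subset_ball_of_ne (z := (0 : ℂ)) (r := 1) (x := polyVertex m i)
    (y := polyVertex m j) (by simp [norm_polyVertex]) (by simp [norm_polyVertex]) hij hz
  simpa using this

theorem side_eq_zero_of_mem {m : ℕ} (hm : 0 < m) {a b : ℤ} {z : ℂ}
    (hz : z ∈ openSegment ℝ (polyVertex m (a : ZMod m)) (polyVertex m (b : ZMod m))) :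
    side m a b z = 0 := by
  obtain ⟨x, y, hx, hy, hxy, rfl⟩ := hz
  rw [side_combo m a b _ _ hxy, side_left hm, side_right hm]
  simp

theorem crosses_symm {m : ℕ} {e f : Sym2 (ZMod m)} (h : Crosses e f) : Crosses f e := by
  obtain ⟨hne, a, b, c, d, h1, h2, h3⟩ := h
  exact ⟨hne.symm, c, d, a, b, h2, h1, by rwa [Set.inter_comm]⟩

theorem mk_eq_mk_iff {m : ℕ} {a b c d : ℤ} :
    (s((a : ZMod m), (b : ZMod m)) : Sym2 (ZMod m)) = s((c : ZMod m), (d : ZMod m)) ↔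
      (∃ k l : ℤ, c = a + k * m ∧ d = b + l * m) ∨ ∃ k l : ℤ, d = a + k * m ∧ c = b + l * m := by
  rw [Sym2.eq_iff]
  simp only [intCast_zmod_eq_iff]
  constructor
  · rintro (⟨⟨k, hk⟩, l, hl⟩ | ⟨⟨k, hk⟩, l, hl⟩)
    · exact Or.inl ⟨k, l, hk, hl⟩
    · exact Or.inr ⟨k, l, hk, hl⟩
  · rintro (⟨k, l, hk, hl⟩ | ⟨k, l, hk, hl⟩)
    · exact Or.inl ⟨⟨k, hk⟩, l, hl⟩
    · exact Or.inr ⟨⟨k, hk⟩, l, hl⟩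

/-- The function `side` has opposite signs at `c` and `d`, so the second segment meets the line
through `a` and `b`, and it does so inside the unit disk, hence on the first segment. -/
theorem crosses_of_interlaced {m : ℕ} {a b c d : ℤ} (hac : a < c) (hcb : c < b) (hbd : b < d)
    (hd : d < a + m) :
    Crosses (s((a : ZMod m), (b : ZMod m))) (s((c : ZMod m), (d : ZMod m))) := by
  have hm : 0 < m := by omega
  refine ⟨?_, a, b, c, d, rfl, rfl, ?_⟩
  · rw [Ne, mk_eq_mk_iff]
    rintro (⟨k, l, h1, h2⟩ | ⟨k, l, h1, h2⟩)
    · rcases mul_modulus_cases (m := m) k with h | h | h | h | h <;> omega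
    · rcases mul_modulus_cases (m := m) l with h | h | h | h | h <;> omega
  · have hc := side_pos hm hac hcb (by omega)
    have hd' := side_neg hm (hac.trans hcb) hbd hd
    set p := side m a b (polyVertex m (c : ZMod m))
    set q := side m a b (polyVertex m (d : ZMod m))
    have hne : polyVertex m (c : ZMod m) ≠ polyVertex m (d : ZMod m) := by
      intro h
      have : p = q := by simp only [p, q, h]
      linarith
    have hpq : 0 < p - q := by linarith
    have hmem : (-q / (p - q)) • polyVertex m (c : ZMod m) + (p / (p - q)) • polyVertex m (d : ZMod m)
        ∈ openSegment ℝ (polyVertex m (c : ZMod m)) (polyVertex m (d : ZMod m)) :=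
      ⟨-q / (p - q), p / (p - q), div_pos (by linarith) hpq, div_pos hc hpq, by
        field_simp; ring, rfl⟩
    refine ⟨_, mem_openSegment_of_side_eq_zero hm (hac.trans hcb) (by omega)
      (norm_lt_one_of_mem_openSegment hne hmem) ?_, hmem⟩
    rw [side_combo _ _ _ _ _ (by field_simp; ring)]
    change -q / (p - q) * p + p / (p - q) * q = 0
    field_simp
    ring

/-- The converse of `crosses_of_interlaced`: if no lifts of the endpoints are interlaced, the
function `side` of one segment does not change its sign on the other one. -/
theorem Crosses.exists_interlaced {m : ℕ} (hm : 0 < m) {e f : Sym2 (ZMod m)} (he : ¬ e.IsDiag)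
    (hf : ¬ f.IsDiag) (h : Crosses e f) :
    ∃ a b c d : ℤ, a < c ∧ c < b ∧ b < d ∧ d < a + m ∧
      e = s((a : ZMod m), (b : ZMod m)) ∧ f = s((c : ZMod m), (d : ZMod m)) := by
  obtain ⟨hne, i, j, k, l, rfl, rfl, z, hz1, hz2⟩ := h
  obtain ⟨a, rfl, -, -⟩ := exists_int_lift hm i 0
  obtain ⟨b, rfl, hb1, hb2⟩ := exists_int_lift hm j a
  obtain ⟨c, rfl, hc1, hc2⟩ := exists_int_lift hm k a
  obtain ⟨d, rfl, hd1, hd2⟩ := exists_int_lift hm l a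
  have hab : a ≠ b := by rintro rfl; exact he rfl
  have hcd : c ≠ d := by rintro rfl; exact hf rfl
  have hs := side_eq_zero_of_mem hm hz1
  obtain ⟨x, y, hx, hy, hxy, rfl⟩ := hz2
  rw [side_combo m a b _ _ hxy] at hs
  -- the sign of `side` at a vertex is read off from the position of the vertex
  have key : ∀ v : ℤ, a ≤ v → v < a + m →
      (v = a ∨ v = b) ∧ side m a b (polyVertex m (v : ZMod m)) = 0 ∨
      (a < v ∧ v < b) ∧ 0 < side m a b (polyVertex m (v : ZMod m)) ∨
      b < v ∧ side m a b (polyVertex m (v : ZMod m)) < 0 := by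
    intro v hv1 hv2
    rcases lt_trichotomy v b with h | h | h
    · rcases hv1.eq_or_lt with h' | h'
      · left; exact ⟨Or.inl h'.symm, by rw [← h', side_left hm]⟩
      · right; left; exact ⟨⟨h', h⟩, side_pos hm h' h hb2⟩
    · left; exact ⟨Or.inr h, by rw [h, side_right hm]⟩
    · right; right; exact ⟨h, side_neg hm (by omega) h hv2⟩
  rcases key c hc1 hc2 with ⟨h1, h2⟩ | ⟨h1, h2⟩ | ⟨h1, h2⟩ <;>
  rcases key d hd1 hd2 with ⟨h3, h4⟩ | ⟨h3, h4⟩ | ⟨h3, h4⟩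
  · exfalso
    apply hne
    rcases h1 with rfl | rfl <;> rcases h3 with rfl | rfl
    · exact absurd rfl hcd
    · rfl
    · exact Sym2.eq_swap
    · exact absurd rfl hcd
  · rw [h2] at hs; nlinarith
  · rw [h2] at hs; nlinarith
  · rw [h4] at hs; nlinarith
  · nlinarith [mul_pos hx h2, mul_pos hy h4]
  · exact ⟨a, b, c, d, h1.1, h1.2, h3, hd2, rfl, rfl⟩
  · rw [h4] at hs; nlinarith
  · exact ⟨a, b, d, c, h3.1, h3.2, h1, hc2, rfl, Sym2.eq_swap⟩
  · nlinarith [mul_pos hx (neg_pos.2 h2), mul_pos hy (neg_pos.2 h4)]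

end ConvexPolygon

namespace ConvexPolygon

variable {m : ℕ}

/-! ### Lifting segments of the convex polygon to the integers -/

theorem mk_eq_mk_iff_of_lt {a b c d : ℤ} (hab : a < b) (hb : b < a + m) (hcd : c < d)
    (hd : d < c + m) :
    (s((a : ZMod m), (b : ZMod m)) : Sym2 (ZMod m)) = s((c : ZMod m), (d : ZMod m)) ↔
      ∃ k : ℤ, (c = a + k * m ∧ d = b + k * m) ∨ (c = b + k * m ∧ d = a + m + k * m) := by
  rw [mk_eq_mk_iff]
  constructor
  · rintro (⟨k, l, h1, h2⟩ | ⟨k, l, h1, h2⟩)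
    · refine ⟨k, Or.inl ⟨h1, ?_⟩⟩
      have h3 : (l - k) * m = l * m - k * m := by ring
      rcases mul_modulus_cases (m := m) (l - k) with h | h | h | h | h <;> omega
    · refine ⟨l, Or.inr ⟨h2, ?_⟩⟩
      have h3 : (k - l) * m = k * m - l * m := by ring
      rcases mul_modulus_cases (m := m) (k - l) with h | h | h | h | h <;> omega
  · rintro ⟨k, ⟨h1, h2⟩ | ⟨h1, h2⟩⟩
    · exact Or.inl ⟨k, k, h1, h2⟩
    · exact Or.inr ⟨k + 1, k, by rw [h2]; ring, h1⟩

theorem not_isDiag_of_lt {a b : ℤ} (hab : a < b) (hb : b < a + m) :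
    ¬ (s((a : ZMod m), (b : ZMod m)) : Sym2 (ZMod m)).IsDiag := by
  rw [Sym2.mk_isDiag_iff, intCast_zmod_eq_iff]
  rintro ⟨k, hk⟩
  rcases mul_modulus_cases (m := m) k with h | h | h | h | h <;> omega

theorem exists_lift_of_not_isDiag (hm : 0 < m) {e : Sym2 (ZMod m)} (he : ¬ e.IsDiag) (i : ℤ) :
    ∃ a b : ℤ, i ≤ a ∧ a < b ∧ b < i + m ∧ e = s((a : ZMod m), (b : ZMod m)) := by
  induction e with
  | _ x y =>
    obtain ⟨a, rfl, ha1, ha2⟩ := exists_int_lift hm x i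
    obtain ⟨b, rfl, hb1, hb2⟩ := exists_int_lift hm y i
    rcases lt_trichotomy a b with h | h | h
    · exact ⟨a, b, ha1, h, hb2, rfl⟩
    · subst h; exact absurd rfl he
    · exact ⟨b, a, hb1, h, ha2, Sym2.eq_swap⟩

theorem isBoundary_iff_of_lt (hm : 2 ≤ m) {a b : ℤ} (hab : a < b) (hb : b < a + m) :
    IsBoundary (s((a : ZMod m), (b : ZMod m))) ↔ b = a + 1 ∨ b + 1 = a + m := by
  constructor
  · rintro ⟨i, hi⟩
    obtain ⟨c, rfl, -, -⟩ := exists_int_lift (by omega : 0 < m) i 0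
    have hc : ((c : ZMod m) + 1) = ((c + 1 : ℤ) : ZMod m) := by push_cast; rfl
    rw [hc, mk_eq_mk_iff_of_lt hab hb (by omega) (by omega)] at hi
    obtain ⟨k, h | h⟩ := hi <;> omega
  · rintro (rfl | h)
    · exact ⟨a, by push_cast; rfl⟩
    · refine ⟨b, ?_⟩
      have : ((b : ZMod m) + 1) = a := by
        rw [← intCast_add_modulus a, ← h]; push_cast; rfl
      rw [this]
      exact Sym2.eq_swap

theorem isArc_iff_of_lt (hm : 2 ≤ m) {a b : ℤ} (hab : a < b) (hb : b < a + m) :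
    IsArc (s((a : ZMod m), (b : ZMod m))) ↔ b ≠ a + 1 ∧ b + 1 ≠ a + m := by
  unfold IsArc
  rw [isBoundary_iff_of_lt hm hab hb]
  have := not_isDiag_of_lt hab hb
  tauto

theorem Crosses.exists_interlaced_of_lt {a b : ℤ} (hab : a < b) (hb : b < a + m)
    {f : Sym2 (ZMod m)} (hf : ¬ f.IsDiag) (h : Crosses (s((a : ZMod m), (b : ZMod m))) f) :
    ∃ c d : ℤ, a < c ∧ c < b ∧ b < d ∧ d < a + m ∧ f = s((c : ZMod m), (d : ZMod m)) := by
  obtain ⟨a', b', c', d', h1, h2, h3, h4, h5, rfl⟩ :=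
    h.exists_interlaced (by omega) (not_isDiag_of_lt hab hb) hf
  rw [mk_eq_mk_iff_of_lt hab hb (by omega) (by omega)] at h5
  obtain ⟨k, h5 | h5⟩ := h5
  · refine ⟨c' - k * m, d' - k * m, by omega, by omega, by omega, by omega, ?_⟩
    push_cast; simp
  · refine ⟨d' - m - k * m, c' - k * m, by omega, by omega, by omega, by omega, ?_⟩
    rw [Sym2.eq_swap]
    push_cast; simp

/-- Crossing segments with endpoints in a common fundamental interval are interlaced there. -/
theorem Crosses.interlaced_of_window {i p q r s : ℤ} (hp : i ≤ p) (hpq : p < q) (hq : q ≤ i + m)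
    (hqp : q < p + m) (hr : i ≤ r) (hrs : r < s) (hs : s ≤ i + m) (hsr : s < r + m)
    (h : Crosses (s((p : ZMod m), (q : ZMod m))) (s((r : ZMod m), (s : ZMod m)))) :
    (p < r ∧ r < q ∧ q < s) ∨ (r < p ∧ p < s ∧ s < q) := by
  obtain ⟨c, d, h1, h2, h3, h4, h5⟩ := h.exists_interlaced_of_lt hpq hqp (not_isDiag_of_lt hrs hsr)
  rw [mk_eq_mk_iff_of_lt hrs hsr (by omega) (by omega)] at h5
  obtain ⟨k, h5 | h5⟩ := h5 <;>
  rcases mul_modulus_cases (m := m) k with h | h | h | h | h <;> omega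

/-! ### Triangulations of the convex polygon -/

/-- `Edge T a b`: the integers `a < b` lie in a common fundamental interval, and the segment between
the vertices that they represent is an edge of `T`. -/
def Edge (T : Set (Sym2 (ZMod m))) (a b : ℤ) : Prop :=
  a < b ∧ b < a + m ∧ s((a : ZMod m), (b : ZMod m)) ∈ edges T

variable {T : Set (Sym2 (ZMod m))}

theorem edge_succ (hm : 2 ≤ m) (a : ℤ) : Edge T a (a + 1) :=
  ⟨by omega, by omega, Or.inr ⟨a, by push_cast; rfl⟩⟩

theorem Edge.flip {a b : ℤ} (h : Edge T a b) : Edge T b (a + m) := by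
  refine ⟨h.2.1, by have := h.1; omega, ?_⟩
  rw [intCast_add_modulus, Sym2.eq_swap]
  exact h.2.2

theorem Edge.shift {a b : ℤ} (h : Edge T a b) (k : ℤ) : Edge T (a + k * m) (b + k * m) := by
  refine ⟨by have := h.1; omega, by have := h.2.1; omega, ?_⟩
  rw [intCast_add_mul_modulus, intCast_add_mul_modulus]
  exact h.2.2

theorem Edge.flip' {a b : ℤ} (h : Edge T a b) : Edge T (b - m) a := by
  have := h.flip.shift (-1)
  convert this using 1 <;> ring

theorem Edge.add_modulus {a b : ℤ} (h : Edge T a b) : Edge T (a + m) (b + m) := h.flip.flip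

theorem Edge.mem_of_ne (hm : 2 ≤ m) {a b : ℤ} (h : Edge T a b) (h1 : b ≠ a + 1)
    (h2 : b + 1 ≠ a + m) : s((a : ZMod m), (b : ZMod m)) ∈ T := by
  rcases h.2.2 with h3 | h3
  · exact h3
  · rw [isBoundary_iff_of_lt hm h.1 h.2.1] at h3
    tauto

theorem IsTriangulation.isArc (hT : IsTriangulation T) {e : Sym2 (ZMod m)} (he : e ∈ T) :
    IsArc e := hT.1.1 e he

theorem IsTriangulation.mem_of_not_crosses (hT : IsTriangulation T) {e : Sym2 (ZMod m)}
    (he : IsArc e) (h : ∀ f ∈ T, ¬ Crosses e f) : e ∈ T := by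
  refine hT.2 (y := insert e T) ⟨?_, ?_⟩ (Set.subset_insert _ _) (Set.mem_insert _ _)
  · rintro f (rfl | hf)
    · exact he
    · exact hT.1.1 f hf
  · rintro f (rfl | hf) g (rfl | hg)
    · exact fun h => h.1 rfl
    · exact h g hg
    · exact fun h' => h f hf (crosses_symm h')
    · exact hT.1.2 f hf g hg

theorem IsTriangulation.not_interlaced (hm : 2 ≤ m) (hT : IsTriangulation T) {a b c d : ℤ}
    (h1 : Edge T a b) (h2 : Edge T c d) (hac : a < c) (hcb : c < b) (hbd : b < d)
    (hd : d < a + m) : False :=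
  hT.1.2 _ (h1.mem_of_ne hm (by omega) (by omega)) _ (h2.mem_of_ne hm (by omega) (by omega))
    (crosses_of_interlaced hac hcb hbd hd)

theorem IsTriangulation.edge_of_not_interlaced (hT : IsTriangulation T) {a b : ℤ}
    (hab : a < b) (hb : b < a + m)
    (h : ∀ c d, Edge T c d → a < c → c < b → b < d → d < a + m → False) : Edge T a b := by
  refine ⟨hab, hb, ?_⟩
  by_cases hB : IsBoundary (s((a : ZMod m), (b : ZMod m)))
  · exact Or.inr hB
  left
  refine hT.mem_of_not_crosses ⟨not_isDiag_of_lt hab hb, hB⟩ fun f hf hc => ?_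
  obtain ⟨c, d, h1, h2, h3, h4, rfl⟩ := hc.exists_interlaced_of_lt hab hb (hT.isArc hf).1
  exact h c d ⟨by omega, by omega, Or.inl hf⟩ h1 h2 h3 h4

theorem IsTriangulation.not_isDiag (hm : 2 ≤ m) (hT : IsTriangulation T) {e : Sym2 (ZMod m)}
    (he : e ∈ edges T) : ¬ e.IsDiag := by
  rcases he with he | ⟨i, rfl⟩
  · exact (hT.isArc he).1
  · obtain ⟨c, rfl, -, -⟩ := exists_int_lift (by omega : 0 < m) i 0
    have := not_isDiag_of_lt (m := m) (a := c) (b := c + 1) (by omega) (by omega)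
    push_cast at this
    exact this

/-- On its clockwise side, an edge that is not a boundary segment there bounds a triangle: the third
corner is the farthest vertex that is joined to `a` by an edge. -/
theorem IsTriangulation.exists_triangle (hm : 2 ≤ m) (hT : IsTriangulation T) {a b : ℤ}
    (h : Edge T a b) (hab : a + 1 < b) : ∃ c, a < c ∧ c < b ∧ Edge T a c ∧ Edge T c b := by
  obtain ⟨c, ⟨h1, h2, h3⟩, hmax⟩ :=
    Int.exists_greatest_of_bdd (P := fun c => a < c ∧ c < b ∧ Edge T a c) ⟨b, fun z hz => by omega⟩
      ⟨a + 1, by omega, hab, edge_succ hm a⟩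
  refine ⟨c, h1, h2, h3, hT.edge_of_not_interlaced h2 (by have := h.2.1; omega) ?_⟩
  intro x y hxy hcx hxb hby hy
  rcases lt_trichotomy y (a + m) with h4 | h4 | h4
  · exact hT.not_interlaced hm h hxy (by omega) hxb hby h4
  · subst h4
    have := hmax x ⟨by omega, hxb, by simpa using hxy.flip'⟩
    omega
  · exact hT.not_interlaced hm hxy h3.add_modulus (by have := h.2.1; omega) h4 hy (by omega)

theorem IsTriangulation.triangle_unique (hm : 2 ≤ m) (hT : IsTriangulation T) {a b c c' : ℤ}
    (hac : Edge T a c) (hcb : Edge T c b) (hac' : Edge T a c') (hcb' : Edge T c' b)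
    (hb : b < a + m) : c = c' := by
  have := hac.1
  have := hcb.1
  have := hac'.1
  have := hcb'.1
  rcases lt_trichotomy c c' with h | h | h
  · exact (hT.not_interlaced hm hac' hcb (by omega) h (by omega) hb).elim
  · exact h
  · exact (hT.not_interlaced hm hac hcb' (by omega) h (by omega) hb).elim

/-! ### Quadrilaterals of the convex polygon -/

/-- The four sides of the quadrilateral with the vertices represented by `a`, `b`, `c`, `d`. -/
def quad (m : ℕ) (a b c d : ℤ) : Set (Sym2 (ZMod m)) :=
  {s((a : ZMod m), (b : ZMod m)), s((b : ZMod m), (c : ZMod m)), s((c : ZMod m), (d : ZMod m)),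
    s((a : ZMod m), (d : ZMod m))}

theorem IsTriangulation.adjacent_corner (hm : 2 ≤ m) (hT : IsTriangulation T) {a b c d : ℤ}
    (hab : Edge T a b) (hbc : Edge T b c) (hcd : Edge T c d) (had : Edge T a d) {z : ZMod m}
    (haz : s((a : ZMod m), z) ∈ edges T) (hcz : s((c : ZMod m), z) ∈ edges T) :
    z = (b : ZMod m) ∨ z = (d : ZMod m) := by
  have h1 := hab.1
  have h2 := hbc.1
  have h3 := hcd.1
  have h4 := had.2.1
  obtain ⟨w, rfl, hw1, hw2⟩ := exists_int_lift (by omega : 0 < m) z a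
  have hwa : w ≠ a := by
    rintro rfl
    exact hT.not_isDiag hm haz rfl
  have hwc : w ≠ c := by
    rintro rfl
    exact hT.not_isDiag hm hcz rfl
  have haw : Edge T a w := ⟨by omega, hw2, haz⟩
  rcases lt_or_gt_of_ne hwc with h | h
  · left
    have hwc' : Edge T w c := ⟨h, by omega, by rwa [Sym2.eq_swap]⟩
    rw [hT.triangle_unique hm haw hwc' hab hbc (by omega)]
  · right
    have hcw : Edge T c w := ⟨h, by omega, hcz⟩
    rw [hT.triangle_unique hm hcw haw.flip hcd had.flip (by omega)]

theorem IsTriangulation.quadrilateral_eq (hm : 2 ≤ m) (hT : IsTriangulation T) {a b c d : ℤ}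
    (hab : Edge T a b) (hbc : Edge T b c) (hcd : Edge T c d) (had : Edge T a d)
    (hac : s((a : ZMod m), (c : ZMod m)) ∈ T) :
    quadrilateral T (s((a : ZMod m), (c : ZMod m))) = quad m a b c d := by
  have h1 := hab.1
  have h2 := hbc.1
  have h3 := hcd.1
  have h4 := had.2.1
  ext e
  constructor
  · rintro ⟨-, hne, x, y, z, hxy, rfl, -, hyz, hzx⟩
    rw [Sym2.eq_iff] at hxy
    rcases hxy with ⟨rfl, rfl⟩ | ⟨rfl, rfl⟩
    · rw [Sym2.eq_swap] at hzx
      rcases hT.adjacent_corner hm hab hbc hcd had hzx hyz with rfl | rfl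
      · exact Or.inr (Or.inl Sym2.eq_swap)
      · exact Or.inr (Or.inr (Or.inl rfl))
    · rw [Sym2.eq_swap] at hzx
      rcases hT.adjacent_corner hm hab hbc hcd had hyz hzx with rfl | rfl
      · exact Or.inl rfl
      · exact Or.inr (Or.inr (Or.inr rfl))
  · have hne : ∀ {p q : ℤ} (hpq : p < q) (hq : q < p + m), ¬ (∃ k : ℤ, (p = a + k * m ∧ q = c + k * m)
        ∨ (p = c + k * m ∧ q = a + m + k * m)) →
        (s((a : ZMod m), (c : ZMod m)) : Sym2 (ZMod m)) ≠ s((p : ZMod m), (q : ZMod m)) := by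
      intro p q hpq hq h h'
      exact h ((mk_eq_mk_iff_of_lt (by omega) (by omega) hpq hq).1 h')
    have hE := Or.inl hac (b := IsBoundary (s((a : ZMod m), (c : ZMod m))))
    rintro (rfl | rfl | rfl | rfl)
    · refine ⟨hab.2.2, hne hab.1 hab.2.1 ?_, c, a, b, Sym2.eq_swap, rfl, ?_, hab.2.2, hbc.2.2⟩
      · rintro ⟨k, h | h⟩ <;> rcases mul_modulus_cases (m := m) k with h' | h' | h' | h' | h' <;> omega
      · rw [Sym2.eq_swap]; exact hE
    · refine ⟨hbc.2.2, hne hbc.1 hbc.2.1 ?_, a, c, b, rfl, Sym2.eq_swap, hE, ?_, ?_⟩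
      · rintro ⟨k, h | h⟩ <;> rcases mul_modulus_cases (m := m) k with h' | h' | h' | h' | h' <;> omega
      · rw [Sym2.eq_swap]; exact hbc.2.2
      · rw [Sym2.eq_swap]; exact hab.2.2
    · refine ⟨hcd.2.2, hne hcd.1 hcd.2.1 ?_, a, c, d, rfl, rfl, hE, hcd.2.2, ?_⟩
      · rintro ⟨k, h | h⟩ <;> rcases mul_modulus_cases (m := m) k with h' | h' | h' | h' | h' <;> omega
      · rw [Sym2.eq_swap]; exact had.2.2
    · refine ⟨had.2.2, hne had.1 had.2.1 ?_, c, a, d, Sym2.eq_swap, rfl, ?_, had.2.2, ?_⟩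
      · rintro ⟨k, h | h⟩ <;> rcases mul_modulus_cases (m := m) k with h' | h' | h' | h' | h' <;> omega
      · rw [Sym2.eq_swap]; exact hE
      · rw [Sym2.eq_swap]; exact hcd.2.2

/-- Every arc of a triangulation is the diagonal of a quadrilateral of edges. -/
theorem IsTriangulation.exists_corners (hm : 2 ≤ m) (hT : IsTriangulation T) {a c : ℤ}
    (hac : a < c) (hc : c < a + m) (h : s((a : ZMod m), (c : ZMod m)) ∈ T) :
    ∃ b d, Edge T a b ∧ Edge T b c ∧ Edge T c d ∧ Edge T a d := by
  have hA := (isArc_iff_of_lt hm hac hc).1 (hT.isArc h)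
  have hE : Edge T a c := ⟨hac, hc, Or.inl h⟩
  obtain ⟨b, -, -, h1, h2⟩ := hT.exists_triangle hm hE (by omega)
  obtain ⟨d, -, -, h3, h4⟩ := hT.exists_triangle hm hE.flip (by omega)
  exact ⟨b, d, h1, h2, h3, by simpa using h4.flip'⟩

theorem quad_rotate (a b c d : ℤ) : quad m b c d (a + m) = quad m a b c d := by
  unfold quad
  rw [intCast_add_modulus, Sym2.eq_swap (a := (b : ZMod m)) (b := (a : ZMod m)),
    Sym2.eq_swap (a := (d : ZMod m)) (b := (a : ZMod m))]
  ext e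
  simp only [Set.mem_insert_iff, Set.mem_singleton_iff]
  tauto

theorem quad_shift (k a b c d : ℤ) :
    quad m (a + k * m) (b + k * m) (c + k * m) (d + k * m) = quad m a b c d := by
  simp only [quad, intCast_add_mul_modulus]

theorem vertices_quad (a b c d : ℤ) :
    vertices (quad m a b c d) = {(a : ZMod m), (b : ZMod m), (c : ZMod m), (d : ZMod m)} := by
  ext v
  simp only [vertices, quad, Set.mem_ofPred_eq, Set.mem_insert_iff, Set.mem_singleton_iff,
    exists_eq_or_imp, exists_eq_left, Sym2.mem_iff]
  tauto

/-- The vertices of a quadrilateral determine their clockwise listing up to rotation. -/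
theorem rotation_of_vertices_eq {a b c d a' b' c' d' : ℤ} (hab : a < b) (hbc : b < c) (hcd : c < d)
    (hd : d < a + m) (hab' : a' < b') (hbc' : b' < c') (hcd' : c' < d') (hd' : d' < a' + m)
    (h : ({(a : ZMod m), (b : ZMod m), (c : ZMod m), (d : ZMod m)} : Set (ZMod m)) =
      {(a' : ZMod m), (b' : ZMod m), (c' : ZMod m), (d' : ZMod m)}) :
    ∃ k : ℤ, (a' = a + k * m ∧ b' = b + k * m ∧ c' = c + k * m ∧ d' = d + k * m) ∨
      (a' = b + k * m ∧ b' = c + k * m ∧ c' = d + k * m ∧ d' = a + m + k * m) ∨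
      (a' = c + k * m ∧ b' = d + k * m ∧ c' = a + m + k * m ∧ d' = b + m + k * m) ∨
      (a' = d + k * m ∧ b' = a + m + k * m ∧ c' = b + m + k * m ∧ d' = c + m + k * m) := by
  -- the case of a common first entry
  have key : ∀ {a b c d b' c' d' k : ℤ}, a < b → b < c → c < d → d < a + m → a + k * m < b' → b' < c' →
      c' < d' → d' < a + k * m + m →
      ({(a : ZMod m), (b : ZMod m), (c : ZMod m), (d : ZMod m)} : Set (ZMod m)) =
      {((a + k * m : ℤ) : ZMod m), (b' : ZMod m), (c' : ZMod m), (d' : ZMod m)} →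
      b' = b + k * m ∧ c' = c + k * m ∧ d' = d + k * m := by
    intro a b c d b' c' d' k h1 h2 h3 h4 h5 h6 h7 h8 h
    have lift : ∀ x : ℤ, a + k * m < x → x < a + k * m + m →
        (x : ZMod m) ∈ ({(a : ZMod m), (b : ZMod m), (c : ZMod m), (d : ZMod m)} : Set (ZMod m)) →
        x = b + k * m ∨ x = c + k * m ∨ x = d + k * m := by
      intro x hx1 hx2 hx
      simp only [Set.mem_insert_iff, Set.mem_singleton_iff, intCast_zmod_eq_iff] at hx
      have hkl : ∀ l : ℤ, (l + k) * m = l * m + k * m := fun l => by ring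
      rcases hx with ⟨l, hl⟩ | ⟨l, hl⟩ | ⟨l, hl⟩ | ⟨l, hl⟩ <;>
      · have := hkl l
        rcases mul_modulus_cases (m := m) (l + k) with h' | h' | h' | h' | h' <;> omega
    have hb := lift b' (by omega) (by omega) (by rw [h]; simp)
    have hc := lift c' (by omega) (by omega) (by rw [h]; simp)
    have hd := lift d' (by omega) (by omega) (by rw [h]; simp)
    omega
  have ha : (a' : ZMod m) ∈
      ({(a : ZMod m), (b : ZMod m), (c : ZMod m), (d : ZMod m)} : Set (ZMod m)) := by rw [h]; simp
  simp only [Set.mem_insert_iff, Set.mem_singleton_iff] at ha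
  have rot : ∀ x y z w : ZMod m, ({x, y, z, w} : Set (ZMod m)) = {y, z, w, x} := by
    intro x y z w
    ext v
    simp only [Set.mem_insert_iff, Set.mem_singleton_iff]
    tauto
  rcases ha with ha | ha | ha | ha <;> rw [eq_comm, intCast_zmod_eq_iff] at ha <;>
    obtain ⟨k, rfl⟩ := ha <;> refine ⟨k, ?_⟩
  · exact Or.inl ⟨rfl, key hab hbc hcd hd hab' hbc' hcd' hd' h⟩
  · refine Or.inr (Or.inl ⟨rfl, key hbc hcd hd (by omega) hab' hbc' hcd' hd' ?_⟩)
    rw [← h, intCast_add_modulus, ← rot]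
  · refine Or.inr (Or.inr (Or.inl ⟨rfl, key hcd hd (by omega) (by omega) hab' hbc' hcd' hd' ?_⟩))
    rw [← h, intCast_add_modulus, intCast_add_modulus, ← rot, ← rot]
  · refine Or.inr (Or.inr (Or.inr ⟨rfl, key hd (by omega) (by omega) (by omega) hab' hbc' hcd' hd' ?_⟩))
    rw [← h, intCast_add_modulus, intCast_add_modulus, intCast_add_modulus, ← rot, ← rot, ← rot]

/-- The vertices of a quadrilateral can be listed clockwise from any starting point. -/
theorem quad_window {a b c d : ℤ} (hab : a < b) (hbc : b < c) (hcd : c < d) (hd : d < a + m)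
    (i : ℤ) : ∃ a' b' c' d', i ≤ a' ∧ a' < b' ∧ b' < c' ∧ c' < d' ∧ d' < i + m ∧
      quad m a b c d = quad m a' b' c' d' := by
  obtain ⟨k, hk1, hk2⟩ : ∃ k : ℤ, i ≤ a + k * m ∧ a + k * m < i + m := by
    obtain ⟨x, hx, h1, h2⟩ := exists_int_lift (m := m) (by omega) (a : ZMod m) i
    obtain ⟨k, hk⟩ := (intCast_zmod_eq_iff a x).1 hx.symm
    exact ⟨k, by omega, by omega⟩
  have hr1 := quad_rotate (m := m) (a + k * m - m) (b + k * m - m) (c + k * m - m) (d + k * m - m)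
  have hr2 := quad_rotate (m := m) (b + k * m - m) (c + k * m - m) (d + k * m - m) (a + k * m)
  have hr3 := quad_rotate (m := m) (c + k * m - m) (d + k * m - m) (a + k * m) (b + k * m)
  have hr4 := quad_rotate (m := m) (d + k * m - m) (a + k * m) (b + k * m) (c + k * m)
  simp only [sub_add_cancel] at hr1 hr2 hr3 hr4
  rw [← quad_shift k]
  by_cases h1 : d + k * m < i + m
  · exact ⟨_, _, _, _, hk1, by omega, by omega, by omega, h1, rfl⟩
  by_cases h2 : c + k * m < i + m
  · exact ⟨_, _, _, _, by omega, by omega, by omega, by omega, h2, hr4⟩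
  by_cases h3 : b + k * m < i + m
  · exact ⟨_, _, _, _, by omega, by omega, by omega, by omega, h3, hr4.trans hr3⟩
  · exact ⟨_, _, _, _, by omega, by omega, by omega, by omega, hk2, hr4.trans (hr3.trans hr2)⟩

/-- A laminar family of segments, given by integers in one fundamental interval, is contained in the
edges of a triangulation. -/
theorem exists_triangulation_of_laminar (hm : 2 ≤ m) (i : ℤ) (P : ℤ → ℤ → Prop)
    (hP : ∀ p q, P p q → i ≤ p ∧ p < q ∧ q ≤ i + m ∧ q < p + m)
    (hL : ∀ p q r s, P p q → P r s → p < r → r < q → q < s → False) :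
    ∃ T : Set (Sym2 (ZMod m)), IsTriangulation T ∧ ∀ p q, P p q → Edge T p q := by
  have : NeZero m := ⟨by omega⟩
  have : Finite (Sym2 (ZMod m)) := Quot.finite _
  let S : Set (Sym2 (ZMod m)) := {e | IsArc e ∧ ∃ p q, P p q ∧ e = s((p : ZMod m), (q : ZMod m))}
  have hS : (∀ e ∈ S, IsArc e) ∧ ∀ e ∈ S, ∀ f ∈ S, ¬ Crosses e f := by
    refine ⟨fun e he => he.1, ?_⟩
    rintro _ ⟨-, p, q, hpq, rfl⟩ _ ⟨-, r, s, hrs, rfl⟩ hc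
    obtain ⟨h1, h2, h3, h4⟩ := hP p q hpq
    obtain ⟨h5, h6, h7, h8⟩ := hP r s hrs
    rcases hc.interlaced_of_window h1 h2 h3 h4 h5 h6 h7 h8 with h | h
    · exact hL p q r s hpq hrs h.1 h.2.1 h.2.2
    · exact hL r s p q hrs hpq h.1 h.2.1 h.2.2
  obtain ⟨T, hST, hT⟩ := Finite.exists_le_maximal (p := fun S : Set (Sym2 (ZMod m)) =>
    (∀ e ∈ S, IsArc e) ∧ ∀ e ∈ S, ∀ f ∈ S, ¬ Crosses e f) hS
  refine ⟨T, hT, fun p q hpq => ?_⟩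
  obtain ⟨h1, h2, h3, h4⟩ := hP p q hpq
  refine ⟨h2, h4, ?_⟩
  by_cases hB : IsBoundary (s((p : ZMod m), (q : ZMod m)))
  · exact Or.inr hB
  · exact Or.inl (hST ⟨⟨not_isDiag_of_lt h2 h4, hB⟩, p, q, hpq, rfl⟩)

/-- The quadrilaterals are exactly the four-gons with distinct vertices. -/
theorem mem_quadrilaterals_iff (hm : 2 ≤ m) {q : Set (Sym2 (ZMod m))} :
    q ∈ quadrilaterals m ↔
      ∃ a b c d : ℤ, a < b ∧ b < c ∧ c < d ∧ d < a + m ∧ q = quad m a b c d := by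
  constructor
  · rintro ⟨T, γ, hT, hγ, rfl⟩
    obtain ⟨a, c, ha, hac, hc, rfl⟩ :=
      exists_lift_of_not_isDiag (by omega : 0 < m) (hT.isArc hγ).1 0
    obtain ⟨b, d, h1, h2, h3, h4⟩ := hT.exists_corners hm hac (by omega) hγ
    exact ⟨a, b, c, d, h1.1, h2.1, h3.1, h4.2.1, hT.quadrilateral_eq hm h1 h2 h3 h4 hγ⟩
  · rintro ⟨a, b, c, d, h1, h2, h3, h4, rfl⟩
    obtain ⟨T, hT, hE⟩ := exists_triangulation_of_laminar hm a
      (fun p q => (p = a ∧ q = b) ∨ (p = b ∧ q = c) ∨ (p = c ∧ q = d) ∨ (p = a ∧ q = d) ∨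
        (p = a ∧ q = c)) (by intro p q; omega) (by intro p q r s; omega)
    have hac := (hE a c (by omega)).mem_of_ne hm (by omega) (by omega)
    exact ⟨T, _, hT, hac, (hT.quadrilateral_eq hm (hE a b (by omega)) (hE b c (by omega))
      (hE c d (by omega)) (hE a d (by omega)) hac).symm⟩

end ConvexPolygon

/-! ### Counting increasing sequences -/

theorem card_fin_orderEmbedding (k M : ℕ) : Nat.card (Fin k ↪o Fin M) = M.choose k := by
  rw [Nat.card_congr Set.powersetCard.ofFinEmbEquiv, Set.powersetCard.card, Nat.card_fin]

section Counting

variable {α : Type*} {m M : ℕ}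

/-- Objects given by two distinct residues modulo `m`, in any order. -/
theorem ncard_cyclic_pairs (F : ℤ → ℤ → α) (hrot : ∀ a b, F b (a + m) = F a b)
    (hinj : ∀ a b a' b' : ℤ, 0 ≤ a → a < b → b < m → 0 ≤ a' → a' < b' → b' < m →
      F a b = F a' b' → a = a' ∧ b = b') :
    {q | ∃ a b : ℤ, a < b ∧ b < a + m ∧ q = F a b}.ncard = m.choose 2 := by
  rw [← card_fin_orderEmbedding 2 m]
  let G : (Fin 2 ↪o Fin m) → α := fun f => F (f 0 : ℕ) (f 1 : ℕ)
  have hlt : ∀ f : Fin 2 ↪o Fin m, (f 0 : ℕ) < f 1 ∧ (f 1 : ℕ) < m :=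
    fun f => ⟨f.strictMono (by decide), (f 1).2⟩
  have hG : Function.Injective G := by
    intro f g hfg
    have h1 := hlt f
    have h2 := hlt g
    have := hinj _ _ _ _ (by omega) (by omega) (by omega) (by omega) (by omega) (by omega) hfg
    ext t
    fin_cases t <;> simp only [Fin.zero_eta, Fin.mk_one] <;> omega
  have hshift : ∀ k a b : ℤ, F (a + k * m) (b + k * m) = F a b := by
    have step : ∀ j a b : ℤ, F (a + (j + 1) * m) (b + (j + 1) * m) = F (a + j * m) (b + j * m) := by
      intro j a b
      rw [← hrot (a + j * m), ← hrot (b + j * m)]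
      congr 1 <;> ring
    intro k a b
    induction k with
    | zero => simp
    | succ k ih => rw [step, ih]
    | pred k ih => rw [← step, sub_add_cancel, ih]
  rw [← Set.ncard_range_of_injective hG]
  congr 1
  ext q
  constructor
  · rintro ⟨a, b, h1, h2, rfl⟩
    obtain ⟨x, hx, hx1, hx2⟩ := exists_int_lift (m := m) (by omega) (a : ZMod m) 0
    obtain ⟨k, rfl⟩ := (intCast_zmod_eq_iff a x).1 hx.symm
    rw [← hshift k]
    -- rotate the pair if its second entry lies beyond the fundamental interval
    obtain ⟨x, y, hx, hxy, hy, h⟩ : ∃ x y : ℤ, 0 ≤ x ∧ x < y ∧ y < m ∧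
        F (a + k * m) (b + k * m) = F x y := by
      by_cases h : b + k * m < m
      · exact ⟨_, _, hx1, by omega, h, rfl⟩
      · refine ⟨b + k * m - m, a + k * m, by omega, by omega, by omega, ?_⟩
        rw [← hrot (b + k * m - m), sub_add_cancel]
    rw [h]
    lift x to ℕ using hx
    lift y to ℕ using by omega
    have hmono : StrictMono (![⟨x, by omega⟩, ⟨y, by omega⟩] : Fin 2 → Fin m) := by
      rw [Fin.strictMono_iff_lt_succ]
      intro j
      fin_cases j
      simp [Fin.lt_def]; omega
    exact ⟨OrderEmbedding.ofStrictMono _ hmono, rfl⟩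
  · rintro ⟨f, rfl⟩
    have h1 := hlt f
    exact ⟨_, _, by omega, by omega, rfl⟩

/-- Objects given by a base point modulo `m` and an increasing sequence of offsets below `M`. -/
theorem ncard_based (hm : 0 < m) {k : ℕ} (F : ℤ → (Fin k ↪o Fin M) → α)
    (hshift : ∀ (l a : ℤ) (f : Fin k ↪o Fin M), F (a + l * m) f = F a f)
    (hinj : ∀ (a a' : ℤ) (f f' : Fin k ↪o Fin M), 0 ≤ a → a < m → 0 ≤ a' → a' < m →
      F a f = F a' f' → a = a' ∧ f = f') :
    {q | ∃ (a : ℤ) (f : Fin k ↪o Fin M), q = F a f}.ncard = m * M.choose k := by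
  have hcard : Nat.card (Fin m × (Fin k ↪o Fin M)) = m * M.choose k := by
    rw [Nat.card_prod, card_fin_orderEmbedding, Nat.card_fin]
  rw [← hcard]
  let G : Fin m × (Fin k ↪o Fin M) → α := fun x => F (x.1 : ℕ) x.2
  have hG : Function.Injective G := by
    rintro ⟨i, f⟩ ⟨j, g⟩ h
    have hi := i.2
    have hj := j.2
    obtain ⟨h1, rfl⟩ := hinj (i : ℕ) (j : ℕ) f g (by omega) (by omega) (by omega) (by omega) h
    obtain rfl : i = j := by ext; omega
    rfl
  rw [← Set.ncard_range_of_injective hG]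
  congr 1
  ext q
  constructor
  · rintro ⟨a, f, rfl⟩
    obtain ⟨x, hx, hx1, hx2⟩ := exists_int_lift hm (a : ZMod m) 0
    obtain ⟨k, rfl⟩ := (intCast_zmod_eq_iff a x).1 hx.symm
    obtain ⟨i, hi⟩ := Int.eq_ofNat_of_zero_le hx1
    refine ⟨⟨⟨i, by omega⟩, f⟩, ?_⟩
    rw [← hshift k, hi]
  · rintro ⟨⟨i, f⟩, rfl⟩
    exact ⟨_, f, rfl⟩

theorem ncard_based_pairs (hm : 0 < m) (F : ℤ → ℤ → α)
    (hshift : ∀ k a b : ℤ, F (a + k * m) (b + k * m) = F a b)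
    (hinj : ∀ a b a' b' : ℤ, 0 ≤ a → a < m → a < b → b ≤ a + M → 0 ≤ a' → a' < m → a' < b' →
      b' ≤ a' + M → F a b = F a' b' → a = a' ∧ b = b') :
    {q | ∃ a b : ℤ, a < b ∧ b ≤ a + M ∧ q = F a b}.ncard = m * M := by
  have h := ncard_based (M := M) hm (k := 1) (fun a f => F a (a + (f 0 : ℕ) + 1)) ?_ ?_
  · rw [Nat.choose_one_right] at h
    rw [← h]
    congr 1
    ext q
    constructor
    · rintro ⟨a, b, h1, h2, rfl⟩
      obtain ⟨x, hx⟩ := Int.eq_ofNat_of_zero_le (a := b - a - 1) (by omega)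
      have hmono : StrictMono (![⟨x, by omega⟩] : Fin 1 → Fin M) := Subsingleton.strictMono _
      refine ⟨a, OrderEmbedding.ofStrictMono _ hmono, ?_⟩
      change _ = F a (a + x + 1)
      congr 1; omega
    · rintro ⟨a, f, rfl⟩
      have := (f 0).2
      exact ⟨_, _, by omega, by omega, rfl⟩
  · intro k a f
    rw [← hshift k a]
    congr 1; ring
  · intro a a' f f' h1 h2 h3 h4 h
    have h5 := (f 0).2
    have h6 := (f' 0).2
    have := hinj _ _ _ _ h1 h2 (by omega) (by omega) h3 h4 (by omega) (by omega) h
    refine ⟨this.1, ?_⟩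
    ext t
    fin_cases t
    simp only [Fin.zero_eta]; omega

theorem ncard_based_triples (hm : 0 < m) (F : ℤ → ℤ → ℤ → α)
    (hshift : ∀ k a b c : ℤ, F (a + k * m) (b + k * m) (c + k * m) = F a b c)
    (hinj : ∀ a b c a' b' c' : ℤ, 0 ≤ a → a < m → a < b → b < c → c ≤ a + M → 0 ≤ a' → a' < m →
      a' < b' → b' < c' → c' ≤ a' + M → F a b c = F a' b' c' → a = a' ∧ b = b' ∧ c = c') :
    {q | ∃ a b c : ℤ, a < b ∧ b < c ∧ c ≤ a + M ∧ q = F a b c}.ncard = m * M.choose 2 := by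
  have hlt : ∀ f : Fin 2 ↪o Fin M, (f 0 : ℕ) < f 1 ∧ (f 1 : ℕ) < M :=
    fun f => ⟨f.strictMono (by decide), (f 1).2⟩
  rw [← ncard_based (M := M) hm (k := 2)
    (fun a f => F a (a + (f 0 : ℕ) + 1) (a + (f 1 : ℕ) + 1)) ?_ ?_]
  · congr 1
    ext q
    constructor
    · rintro ⟨a, b, c, h1, h2, h3, rfl⟩
      obtain ⟨x, hx⟩ := Int.eq_ofNat_of_zero_le (a := b - a - 1) (by omega)
      obtain ⟨y, hy⟩ := Int.eq_ofNat_of_zero_le (a := c - a - 1) (by omega)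
      have hmono : StrictMono (![⟨x, by omega⟩, ⟨y, by omega⟩] : Fin 2 → Fin M) := by
        rw [Fin.strictMono_iff_lt_succ]
        intro j
        fin_cases j
        simp [Fin.lt_def]; omega
      refine ⟨a, OrderEmbedding.ofStrictMono _ hmono, ?_⟩
      change _ = F a (a + x + 1) (a + y + 1)
      congr 1 <;> omega
    · rintro ⟨a, f, rfl⟩
      have := hlt f
      exact ⟨_, _, _, by omega, by omega, by omega, rfl⟩
  · intro k a f
    rw [← hshift k a]
    congr 1 <;> ring
  · intro a a' f f' h1 h2 h3 h4 h
    have h5 := hlt f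
    have h6 := hlt f'
    have := hinj _ _ _ _ _ _ h1 h2 (by omega) (by omega) (by omega) h3 h4 (by omega) (by omega)
      (by omega) h
    refine ⟨this.1, ?_⟩
    ext t
    fin_cases t <;> simp only [Fin.zero_eta, Fin.mk_one] <;> omega

theorem ncard_based_quadruples (hm : 0 < m) (F : ℤ → ℤ → ℤ → ℤ → α)
    (hshift : ∀ k a b c d : ℤ, F (a + k * m) (b + k * m) (c + k * m) (d + k * m) = F a b c d)
    (hinj : ∀ a b c d a' b' c' d' : ℤ, 0 ≤ a → a < m → a < b → b < c → c < d → d ≤ a + M →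
      0 ≤ a' → a' < m → a' < b' → b' < c' → c' < d' → d' ≤ a' + M → F a b c d = F a' b' c' d' →
      a = a' ∧ b = b' ∧ c = c' ∧ d = d') :
    {q | ∃ a b c d : ℤ, a < b ∧ b < c ∧ c < d ∧ d ≤ a + M ∧ q = F a b c d}.ncard =
      m * M.choose 3 := by
  have hlt : ∀ f : Fin 3 ↪o Fin M, (f 0 : ℕ) < f 1 ∧ (f 1 : ℕ) < f 2 ∧ (f 2 : ℕ) < M :=
    fun f => ⟨f.strictMono (by decide), f.strictMono (by decide), (f 2).2⟩
  rw [← ncard_based (M := M) hm (k := 3)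
    (fun a f => F a (a + (f 0 : ℕ) + 1) (a + (f 1 : ℕ) + 1) (a + (f 2 : ℕ) + 1)) ?_ ?_]
  · congr 1
    ext q
    constructor
    · rintro ⟨a, b, c, d, h1, h2, h3, h4, rfl⟩
      obtain ⟨x, hx⟩ := Int.eq_ofNat_of_zero_le (a := b - a - 1) (by omega)
      obtain ⟨y, hy⟩ := Int.eq_ofNat_of_zero_le (a := c - a - 1) (by omega)
      obtain ⟨z, hz⟩ := Int.eq_ofNat_of_zero_le (a := d - a - 1) (by omega)
      have hmono : StrictMono (![⟨x, by omega⟩, ⟨y, by omega⟩, ⟨z, by omega⟩] : Fin 3 → Fin M) := by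
        rw [Fin.strictMono_iff_lt_succ]
        intro j
        fin_cases j <;> simp [Fin.lt_def] <;> omega
      refine ⟨a, OrderEmbedding.ofStrictMono _ hmono, ?_⟩
      change _ = F a (a + x + 1) (a + y + 1) (a + z + 1)
      congr 1 <;> omega
    · rintro ⟨a, f, rfl⟩
      have := hlt f
      exact ⟨_, _, _, _, by omega, by omega, by omega, by omega, rfl⟩
  · intro k a f
    rw [← hshift k a]
    congr 1 <;> ring
  · intro a a' f f' h1 h2 h3 h4 h
    have h5 := hlt f
    have h6 := hlt f'
    have := hinj _ _ _ _ _ _ _ _ h1 h2 (by omega) (by omega) (by omega) (by omega) h3 h4 (by omega)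
      (by omega) (by omega) (by omega) h
    refine ⟨this.1, ?_⟩
    ext t
    fin_cases t <;> simp only [Fin.zero_eta, Fin.mk_one, Fin.reduceFinMk] <;> omega

end Counting

namespace ConvexPolygon

theorem ncard_quadrilaterals {m : ℕ} (hm : 2 ≤ m) : (quadrilaterals m).ncard = m.choose 4 := by
  rw [← card_fin_orderEmbedding 4 m]
  let F : (Fin 4 ↪o Fin m) → Set (Sym2 (ZMod m)) := fun f =>
    quad m (f 0 : ℕ) (f 1 : ℕ) (f 2 : ℕ) (f 3 : ℕ)
  have hlt : ∀ f : Fin 4 ↪o Fin m, (f 0 : ℕ) < f 1 ∧ (f 1 : ℕ) < f 2 ∧ (f 2 : ℕ) < f 3 := fun f =>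
    ⟨f.strictMono (by decide), f.strictMono (by decide), f.strictMono (by decide)⟩
  have hF : Function.Injective F := by
    intro f g hfg
    have hv : vertices (F f) = vertices (F g) := by rw [hfg]
    simp only [F, vertices_quad] at hv
    have h1 := hlt f
    have h2 := hlt g
    have h3 := (f 3).2
    have h4 := (g 3).2
    obtain ⟨k, hk⟩ := rotation_of_vertices_eq (m := m) (by omega) (by omega) (by omega) (by omega)
      (by omega) (by omega) (by omega) (by omega) hv
    have hcases := mul_modulus_cases (m := m) k
    ext j
    fin_cases j <;> simp only [Fin.zero_eta, Fin.mk_one, Fin.reduceFinMk] <;> omega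
  rw [← Set.ncard_range_of_injective hF]
  congr 1
  ext q
  rw [mem_quadrilaterals_iff hm]
  constructor
  · rintro ⟨a, b, c, d, h1, h2, h3, h4, rfl⟩
    obtain ⟨a, b, c, d, h0, h1, h2, h3, h4, h5⟩ := quad_window h1 h2 h3 h4 0
    rw [h5]
    lift a to ℕ using h0
    lift b to ℕ using by omega
    lift c to ℕ using by omega
    lift d to ℕ using by omega
    have hmono : StrictMono (![⟨a, by omega⟩, ⟨b, by omega⟩, ⟨c, by omega⟩, ⟨d, by omega⟩] :
        Fin 4 → Fin m) := by
      rw [Fin.strictMono_iff_lt_succ]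
      intro j
      fin_cases j <;> simp [Fin.lt_def] <;> omega
    exact ⟨OrderEmbedding.ofStrictMono _ hmono, rfl⟩
  · rintro ⟨f, rfl⟩
    have h1 := hlt f
    have h3 := (f 3).2
    exact ⟨_, _, _, _, by omega, by omega, by omega, by omega, rfl⟩

end ConvexPolygon

/-! ### The central symmetry -/

namespace SymmetricPolygon

open ConvexPolygon

variable {n : ℕ}

theorem opp_intCast (a : ℤ) :
    opp (a : ZMod (2 * n + 2)) = ((a + (n + 1) : ℤ) : ZMod (2 * n + 2)) := by
  unfold opp; push_cast; rfl

theorem act_mk (a b : ℤ) :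
    act (s((a : ZMod (2 * n + 2)), (b : ZMod (2 * n + 2)))) =
      s(((a + (n + 1) : ℤ) : ZMod (2 * n + 2)), ((b + (n + 1) : ℤ) : ZMod (2 * n + 2))) := by
  rw [← opp_intCast, ← opp_intCast]; rfl

theorem intCast_add_two_halves (a : ℤ) :
    ((a + (n + 1) + (n + 1) : ℤ) : ZMod (2 * n + 2)) = a := by
  have := intCast_add_modulus (m := 2 * n + 2) a
  rw [← this]; push_cast; ring

theorem opp_opp (i : ZMod (2 * n + 2)) : opp (opp i) = i := by
  obtain ⟨a, rfl, -, -⟩ := exists_int_lift (by omega : 0 < 2 * n + 2) i 0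
  rw [opp_intCast, opp_intCast, intCast_add_two_halves]

theorem act_act (e : Sym2 (ZMod (2 * n + 2))) : act (act e) = e := by
  unfold act
  rw [Sym2.map_map, show opp ∘ opp = (id : ZMod (2 * n + 2) → _) from funext opp_opp, Sym2.map_id]
  rfl

theorem IsBoundary.act {e : Sym2 (ZMod (2 * n + 2))} (h : IsBoundary e) : IsBoundary (act e) := by
  obtain ⟨i, rfl⟩ := h
  refine ⟨opp i, ?_⟩
  have : opp (i + 1) = opp i + 1 := by unfold opp; ring
  rw [← this]; rfl

theorem not_isDiag_act {e : Sym2 (ZMod (2 * n + 2))} (h : ¬ e.IsDiag) : ¬ (act e).IsDiag := by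
  induction e with
  | _ x y =>
    intro h'
    apply h
    have h'' : opp x = opp y := h'
    have : x = y := by rw [← opp_opp x, h'', opp_opp]
    exact this

theorem IsArc.act {e : Sym2 (ZMod (2 * n + 2))} (h : IsArc e) : IsArc (act e) :=
  ⟨not_isDiag_act h.1, fun hB => h.2 (by rw [← act_act e]; exact IsBoundary.act hB)⟩

theorem Crosses.act {e f : Sym2 (ZMod (2 * n + 2))} (he : ¬ e.IsDiag) (hf : ¬ f.IsDiag)
    (h : Crosses e f) : Crosses (act e) (act f) := by
  obtain ⟨a, b, c, d, h1, h2, h3, h4, rfl, rfl⟩ := h.exists_interlaced (by omega) he hf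
  rw [act_mk, act_mk]
  exact crosses_of_interlaced (by omega) (by omega) (by omega) (by omega)

variable {T : Set (Sym2 (ZMod (2 * n + 2)))}

theorem IsSymmTriangulation.act_mem (hT : IsSymmTriangulation T) {e : Sym2 (ZMod (2 * n + 2))}
    (he : e ∈ T) : act e ∈ T := by
  rw [← hT.2]; exact ⟨e, he, rfl⟩

theorem IsSymmTriangulation.edge_act (hT : IsSymmTriangulation T) {a b : ℤ} (h : Edge T a b) :
    Edge T (a + (n + 1)) (b + (n + 1)) := by
  refine ⟨by have := h.1; omega, by have := h.2.1; omega, ?_⟩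
  rw [← act_mk]
  rcases h.2.2 with h' | h'
  · exact Or.inl (hT.act_mem h')
  · exact Or.inr (IsBoundary.act h')

/-- A centrally symmetric triangulation contains a diameter: a longest edge is one, since otherwise
the diameter at its first endpoint could be added. -/
theorem IsSymmTriangulation.exists_diameter (hT : IsSymmTriangulation T) :
    ∃ i : ℤ, Edge T i (i + (n + 1)) := by
  obtain ⟨L, ⟨a, b, hab, hL, hb⟩, hmax⟩ := Int.exists_greatest_of_bdd
    (P := fun L => ∃ a b : ℤ, Edge T a b ∧ b - a = L ∧ b ≤ a + (n + 1))
    ⟨n + 1, by rintro z ⟨a, b, -, h1, h2⟩; omega⟩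
    ⟨1, 0, 0 + 1, edge_succ (by omega) 0, by omega, by omega⟩
  refine ⟨a, hT.1.edge_of_not_interlaced (by omega) (by omega) ?_⟩
  intro x y hxy hax hxa hay hya
  have h0 := hab.1
  have h1 : b ≤ x := by
    by_contra! h
    exact hT.1.not_interlaced (by omega) hab hxy hax h (by omega) hya
  have h2 : b + (n + 1) ≤ y := by
    by_contra! h
    exact hT.1.not_interlaced (by omega) hxy (hT.edge_act hab) hxa hay h (by omega)
  rcases le_or_gt y (x + (n + 1)) with h | h
  · have := hmax (y - x) ⟨x, y, hxy, rfl, h⟩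
    omega
  · have := hmax _ ⟨y, _, hxy.flip, rfl, by omega⟩
    omega

/-- A laminar family of segments in a closed half-disk is contained in the edges of a centrally
symmetric triangulation, which contains the bounding diameter as well. -/
theorem exists_symmTriangulation_of_laminar (hn : 1 ≤ n) (i : ℤ) (P : ℤ → ℤ → Prop)
    (hP : ∀ p q, P p q → i ≤ p ∧ p < q ∧ q ≤ i + (n + 1))
    (hL : ∀ p q r s, P p q → P r s → p < r → r < q → q < s → False) :
    ∃ T : Set (Sym2 (ZMod (2 * n + 2))), IsSymmTriangulation T ∧ (∀ p q, P p q → Edge T p q) ∧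
      Edge T i (i + (n + 1)) := by
  have : Finite (Sym2 (ZMod (2 * n + 2))) := Quot.finite _
  let P' : ℤ → ℤ → Prop := fun p q =>
    P p q ∨ P (p - (n + 1)) (q - (n + 1)) ∨ (p = i ∧ q = i + (n + 1))
  have hP' : ∀ p q, P' p q → i ≤ p ∧ p < q ∧ q ≤ i + (2 * n + 2 : ℕ) ∧ q < p + (2 * n + 2 : ℕ) ∧
      (q ≤ i + (n + 1) ∨ i + (n + 1) ≤ p) := by
    rintro p q (h | h | ⟨h1, h2⟩)
    · have := hP _ _ h; omega
    · have := hP _ _ h; omega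
    · omega
  have hL' : ∀ p q r s, P' p q → P' r s → p < r → r < q → q < s → False := by
    intro p q r s hpq hrs h1 h2 h3
    have h4 := hP' _ _ hpq
    have h5 := hP' _ _ hrs
    rcases hpq with h | h | h <;> rcases hrs with h' | h' | h'
    · exact hL _ _ _ _ h h' h1 h2 h3
    · have := hP _ _ h; have := hP _ _ h'; omega
    · omega
    · have := hP _ _ h; have := hP _ _ h'; omega
    · exact hL _ _ _ _ h h' (by omega) (by omega) (by omega)
    · omega
    · omega
    · omega
    · omega
  let S : Set (Sym2 (ZMod (2 * n + 2))) :=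
    {e | IsArc e ∧ ∃ p q : ℤ, P' p q ∧ e = s((p : ZMod _), (q : ZMod _))}
  let V : Set (Sym2 (ZMod (2 * n + 2))) → Prop := fun S =>
    ((∀ e ∈ S, IsArc e) ∧ ∀ e ∈ S, ∀ f ∈ S, ¬ Crosses e f) ∧ ∀ e ∈ S, act e ∈ S
  have hS : V S := by
    refine ⟨⟨fun e he => he.1, ?_⟩, ?_⟩
    · rintro _ ⟨-, p, q, hpq, rfl⟩ _ ⟨-, r, s, hrs, rfl⟩ hc
      obtain ⟨h1, h2, h3, h4, -⟩ := hP' p q hpq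
      obtain ⟨h5, h6, h7, h8, -⟩ := hP' r s hrs
      rcases hc.interlaced_of_window h1 h2 h3 h4 h5 h6 h7 h8 with h | h
      · exact hL' p q r s hpq hrs h.1 h.2.1 h.2.2
      · exact hL' r s p q hrs hpq h.1 h.2.1 h.2.2
    · rintro _ ⟨ha, p, q, hpq, rfl⟩
      refine ⟨IsArc.act ha, ?_⟩
      rw [act_mk]
      rcases hpq with h | h | ⟨rfl, rfl⟩
      · exact ⟨_, _, Or.inr (Or.inl (by simpa using h)), rfl⟩
      · refine ⟨_, _, Or.inl h, ?_⟩
        rw [← intCast_add_two_halves (p - (n + 1)), ← intCast_add_two_halves (q - (n + 1))]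
        simp
      · refine ⟨p, p + (n + 1), Or.inr (Or.inr ⟨rfl, rfl⟩), ?_⟩
        rw [intCast_add_two_halves, Sym2.eq_swap]
  obtain ⟨T, hST, hT⟩ := Finite.exists_le_maximal (p := V) hS
  have hiT : s((i : ZMod (2 * n + 2)), ((i + (n + 1) : ℤ) : ZMod (2 * n + 2))) ∈ T :=
    hST ⟨(isArc_iff_of_lt (by omega) (by omega) (by omega)).2 (by omega), i, _,
      Or.inr (Or.inr ⟨rfl, rfl⟩), rfl⟩
  have htri : IsTriangulation T := by
    refine ⟨hT.1.1, fun S' hS' hTS' e he => ?_⟩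
    have heA := hS'.1 e he
    -- `e` lies in a half-disk of the diameter at `i`, so it does not cross its mirror image
    obtain ⟨p, q, hip, hpq, hq, hpe⟩ : ∃ p q : ℤ, i ≤ p ∧ p < q ∧ (q ≤ i + (n + 1) ∨
        i + (n + 1) ≤ p ∧ q ≤ i + (2 * n + 2 : ℕ)) ∧ e = s((p : ZMod _), (q : ZMod _)) := by
      obtain ⟨p, q, h1, h2, h3, rfl⟩ := exists_lift_of_not_isDiag (by omega) heA.1 i
      by_cases h4 : q ≤ i + (n + 1)
      · exact ⟨p, q, h1, h2, Or.inl h4, rfl⟩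
      by_cases h5 : i + (n + 1) ≤ p
      · exact ⟨p, q, h1, h2, Or.inr ⟨h5, by omega⟩, rfl⟩
      rcases h1.eq_or_lt with rfl | h6
      · refine ⟨q, i + (2 * n + 2 : ℕ), by omega, by omega, Or.inr ⟨by omega, le_rfl⟩, ?_⟩
        rw [intCast_add_modulus, Sym2.eq_swap]
      · exact (hS'.2 _ (hTS' hiT) _ he
          (crosses_of_interlaced h6 (by omega) (by omega) (by omega))).elim
    have hself : ¬ Crosses e (act e) := by
      intro hc
      rw [hpe, act_mk] at hc
      rcases hq with hq | hq
      · have := hc.interlaced_of_window (i := i) hip hpq (by omega) (by omega) (by omega) (by omega)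
          (by omega) (by omega)
        omega
      · have h1 : ∀ x : ℤ, ((x + (n + 1) : ℤ) : ZMod (2 * n + 2)) =
            ((x - (n + 1) : ℤ) : ZMod (2 * n + 2)) := fun x => by
          rw [← intCast_add_two_halves (x - (n + 1))]; simp
        rw [h1, h1] at hc
        have := hc.interlaced_of_window (i := i) hip hpq (by omega) (by omega) (by omega) (by omega)
          (by omega) (by omega)
        omega
    have heT : ∀ f ∈ T, ¬ Crosses e f := fun f hf => hS'.2 e he f (hTS' hf)
    have heT' : ∀ f ∈ T, ¬ Crosses (act e) f := fun f hf hc => by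
      have := Crosses.act (not_isDiag_act heA.1) (hT.1.1.1 f hf).1 hc
      rw [act_act] at this
      exact heT _ (hT.1.2 f hf) this
    refine hT.2 (y := insert e (insert (act e) T)) ⟨⟨?_, ?_⟩, ?_⟩ ?_ (Set.mem_insert _ _)
    · rintro f (rfl | rfl | hf)
      · exact heA
      · exact IsArc.act heA
      · exact hT.1.1.1 f hf
    · rintro f (rfl | rfl | hf) g (rfl | rfl | hg)
      · exact fun h => h.1 rfl
      · exact hself
      · exact heT g hg
      · exact fun h => hself (crosses_symm h)
      · exact fun h => h.1 rfl
      · exact heT' g hg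
      · exact fun h => heT f hf (crosses_symm h)
      · exact fun h => heT' f hf (crosses_symm h)
      · exact hT.1.1.2 f hf g hg
    · rintro f (rfl | rfl | hf)
      · exact Or.inr (Or.inl rfl)
      · exact Or.inl (act_act e)
      · exact Or.inr (Or.inr (hT.1.2 f hf))
    · exact (Set.subset_insert _ _).trans (Set.subset_insert _ _)
  refine ⟨T, ⟨htri, ?_⟩, fun p q hpq => ?_, ⟨by omega, by omega, Or.inl hiT⟩⟩
  · ext e
    exact ⟨by rintro ⟨f, hf, rfl⟩; exact hT.1.2 f hf, fun he => ⟨act e, hT.1.2 e he, act_act e⟩⟩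
  · obtain ⟨h1, h2, h3⟩ := hP p q hpq
    have h4 : q < p + (2 * n + 2 : ℕ) := by omega
    refine ⟨h2, h4, ?_⟩
    by_cases hB : IsBoundary (s((p : ZMod (2 * n + 2)), (q : ZMod (2 * n + 2))))
    · exact Or.inr hB
    · exact Or.inl (hST ⟨⟨not_isDiag_of_lt h2 h4, hB⟩, p, q, Or.inl hpq, rfl⟩)

/-! ### The vertex flip -/

theorem intCast_mem_halfDisk_iff {i v : ℤ} (h1 : i ≤ v) (h2 : v < i + (2 * n + 2)) :
    (v : ZMod (2 * n + 2)) ∈ halfDisk (i : ZMod (2 * n + 2)) ↔ v ≤ i + (n + 1) := by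
  have h : (((v : ZMod (2 * n + 2)) - (i : ZMod (2 * n + 2))).val : ℤ) = v - i := by
    rw [← Int.cast_sub, ZMod.val_intCast, Int.emod_eq_of_lt (by omega) (by push_cast; omega)]
  change ((v : ZMod (2 * n + 2)) - (i : ZMod (2 * n + 2))).val ≤ n + 1 ↔ _
  omega

theorem mem_Q₁_iff {q : Set (Sym2 (ZMod (2 * n + 2)))} :
    q ∈ Q₁ n ↔ ∃ a b c d : ℤ, a < b ∧ b < c ∧ c < d ∧ d ≤ a + (n + 1) ∧
      q = quad (2 * n + 2) a b c d := by
  constructor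
  · rintro ⟨hq, i, hi⟩
    obtain ⟨a, b, c, d, h1, h2, h3, h4, rfl⟩ := (mem_quadrilaterals_iff (by omega)).1 hq
    obtain ⟨j, hj⟩ : ∃ j : ℤ, vertices (quad (2 * n + 2) a b c d) ⊆ halfDisk (j : ZMod (2 * n + 2)) := by
      obtain ⟨j, rfl, -, -⟩ := exists_int_lift (by omega : 0 < 2 * n + 2) i 0
      rcases hi with hi | hi
      · exact ⟨j, hi⟩
      · exact ⟨j + (n + 1), by rwa [← opp_intCast]⟩
    obtain ⟨a, b, c, d, h0, h1, h2, h3, h4, h5⟩ := quad_window h1 h2 h3 h4 j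
    rw [h5] at hj ⊢
    rw [vertices_quad] at hj
    have := (intCast_mem_halfDisk_iff (by omega) (by omega)).1
      (hj (show (d : ZMod (2 * n + 2)) ∈ _ by simp))
    exact ⟨a, b, c, d, h1, h2, h3, by omega, rfl⟩
  · rintro ⟨a, b, c, d, h1, h2, h3, h4, rfl⟩
    refine ⟨(mem_quadrilaterals_iff (by omega)).2 ⟨a, b, c, d, h1, h2, h3, by omega, rfl⟩, a, ?_⟩
    left
    rw [vertices_quad]
    rintro v (rfl | rfl | rfl | rfl) <;>
      exact (intCast_mem_halfDisk_iff (by omega) (by omega)).2 (by omega)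

/-- The flipped quadrilaterals are exactly the elements of `Q₂`. Listing the vertices of a
quadrilateral clockwise, the excesses of its two diagonals over a half-turn are rotated by a right
angle when the list is rotated by one step; so exactly one of the four rotations puts them into the
quadrant that belongs to flipped quadrilaterals. -/
theorem mem_Q₂_iff {q : Set (Sym2 (ZMod (2 * n + 2)))} :
    q ∈ Q₂ n ↔ ∃ a b c d : ℤ, a < b ∧ b < c ∧ c < d ∧ d ≤ a + (n + 1) ∧
      q = quad (2 * n + 2) a c d (b + (n + 1)) := by
  constructor
  · rintro ⟨hq, hq1, hq2⟩
    obtain ⟨a, b, c, d, h1, h2, h3, h4, rfl⟩ := (mem_quadrilaterals_iff (by omega)).1 hq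
    rw [mem_Q₁_iff] at hq1
    have hr1 := quad_rotate (m := 2 * n + 2) a b c d
    have hr2 := quad_rotate (m := 2 * n + 2) b c d (a + (2 * n + 2 : ℕ))
    have hr3 := quad_rotate (m := 2 * n + 2) c d (a + (2 * n + 2 : ℕ)) (b + (2 * n + 2 : ℕ))
    have h5 : ¬ d ≤ a + (n + 1) := fun h => hq1 ⟨a, b, c, d, h1, h2, h3, h, rfl⟩
    have h6 : ¬ a + (2 * n + 2 : ℕ) ≤ b + (n + 1) := fun h =>
      hq1 ⟨_, _, _, _, h2, h3, h4, h, hr1.symm⟩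
    have h7 : ¬ b + (2 * n + 2 : ℕ) ≤ c + (n + 1) := fun h =>
      hq1 ⟨_, _, _, _, h3, h4, by omega, h, (hr2.trans hr1).symm⟩
    have h8 : ¬ c + (2 * n + 2 : ℕ) ≤ d + (n + 1) := fun h =>
      hq1 ⟨_, _, _, _, h4, by omega, by omega, h, (hr3.trans (hr2.trans hr1)).symm⟩
    have h9 : ¬ (c = a + (n + 1) ∧ d = b + (n + 1)) := by
      rintro ⟨rfl, rfl⟩
      exact hq2 ⟨a, b, by rw [vertices_quad, opp_intCast, opp_intCast]⟩
    by_cases c1 : c ≤ a + (n + 1) ∧ d < b + (n + 1)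
    · exact ⟨a, d - (n + 1), b, c, by omega, by omega, by omega, by omega, by simp⟩
    by_cases c2 : d ≤ b + (n + 1) ∧ a + (2 * n + 2 : ℕ) < c + (n + 1)
    · exact ⟨b, a + (2 * n + 2 : ℕ) - (n + 1), c, d, by omega, by omega, by omega, by omega, by
        rw [sub_add_cancel]; exact hr1.symm⟩
    by_cases c3 : a + (2 * n + 2 : ℕ) ≤ c + (n + 1) ∧ b + (2 * n + 2 : ℕ) < d + (n + 1)
    · exact ⟨c, b + (2 * n + 2 : ℕ) - (n + 1), d, a + (2 * n + 2 : ℕ), by omega, by omega, by omega,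
        by omega, by rw [sub_add_cancel]; exact (hr2.trans hr1).symm⟩
    · exact ⟨d, c + (2 * n + 2 : ℕ) - (n + 1), a + (2 * n + 2 : ℕ), b + (2 * n + 2 : ℕ), by omega,
        by omega, by omega, by omega, by
        rw [sub_add_cancel]; exact (hr3.trans (hr2.trans hr1)).symm⟩
  · rintro ⟨a, b, c, d, h1, h2, h3, h4, rfl⟩
    refine ⟨(mem_quadrilaterals_iff (by omega)).2
      ⟨_, _, _, _, by omega, by omega, by omega, by omega, rfl⟩, ?_, ?_⟩
    · rw [mem_Q₁_iff]
      rintro ⟨a', b', c', d', h1', h2', h3', h4', h⟩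
      have hv := congrArg vertices h
      rw [vertices_quad, vertices_quad] at hv
      obtain ⟨k, hk⟩ := rotation_of_vertices_eq (m := 2 * n + 2) (by omega) (by omega) (by omega)
        (by omega) (by omega) (by omega) (by omega) (by omega) hv
      omega
    · rintro ⟨i, j, h⟩
      rw [vertices_quad] at h
      -- the vertex set is not stable under the symmetry, as it lacks the opposite of `c`
      have hc : opp (c : ZMod (2 * n + 2)) ∈ ({i, j, opp i, opp j} : Set (ZMod (2 * n + 2))) := by
        have : (c : ZMod (2 * n + 2)) ∈ ({i, j, opp i, opp j} : Set (ZMod (2 * n + 2))) := by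
          rw [← h]; simp
        rcases this with h | h | h | h <;> rw [h] <;> simp [opp_opp]
      rw [← h, opp_intCast] at hc
      simp only [Set.mem_insert_iff, Set.mem_singleton_iff, intCast_zmod_eq_iff] at hc
      rcases hc with ⟨k, hk⟩ | ⟨k, hk⟩ | ⟨k, hk⟩ | ⟨k, hk⟩ <;>
      rcases mul_modulus_cases (m := 2 * n + 2) k with h' | h' | h' | h' | h' <;> omega

theorem exists_vertex_flip (n : ℕ) :
    ∃ α : Q₁ n → Q₂ n, Function.Bijective α ∧
      ∀ (q : Q₁ n) (a b c d : ZMod (2 * n + 2)), IsHalfDiskList q.1 a b c d →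
        vertices (α q).1 = {a, c, d, opp b} := by
  choose A B C D h1 h2 h3 h4 h5 using fun q : Q₁ n => mem_Q₁_iff.1 q.2
  refine ⟨fun q => ⟨_, mem_Q₂_iff.2 ⟨A q, B q, C q, D q, h1 q, h2 q, h3 q, h4 q, rfl⟩⟩,
    ⟨fun q q' h => ?_, ?_⟩, ?_⟩
  · have hv := congrArg vertices (Subtype.ext_iff.1 h)
    simp only [vertices_quad] at hv
    have g1 := h1 q
    have g2 := h2 q
    have g3 := h3 q
    have g4 := h4 q
    have g1' := h1 q'
    have g2' := h2 q'
    have g3' := h3 q'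
    have g4' := h4 q'
    obtain ⟨k, hk⟩ := rotation_of_vertices_eq (m := 2 * n + 2) (by omega) (by omega) (by omega)
      (by omega) (by omega) (by omega) (by omega) (by omega) hv
    have hk : A q' = A q + k * (2 * n + 2 : ℕ) ∧ B q' = B q + k * (2 * n + 2 : ℕ) ∧
        C q' = C q + k * (2 * n + 2 : ℕ) ∧ D q' = D q + k * (2 * n + 2 : ℕ) := by omega
    apply Subtype.ext
    rw [h5 q, h5 q', hk.1, hk.2.1, hk.2.2.1, hk.2.2.2, quad_shift]
  · rintro ⟨p, hp⟩
    obtain ⟨a, b, c, d, g1, g2, g3, g4, rfl⟩ := mem_Q₂_iff.1 hp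
    refine ⟨⟨_, mem_Q₁_iff.2 ⟨a, b, c, d, g1, g2, g3, g4, rfl⟩⟩, ?_⟩
    apply Subtype.ext
    generalize hq : (⟨_, mem_Q₁_iff.2 ⟨a, b, c, d, g1, g2, g3, g4, rfl⟩⟩ : Q₁ n) = q
    have hv := congrArg vertices ((Subtype.ext_iff.1 hq).trans (h5 q))
    simp only [vertices_quad] at hv
    have g1' := h1 q
    have g2' := h2 q
    have g3' := h3 q
    have g4' := h4 q
    obtain ⟨k, hk⟩ := rotation_of_vertices_eq (m := 2 * n + 2) (by omega) (by omega) (by omega)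
      (by omega) (by omega) (by omega) (by omega) (by omega) hv
    have hk : A q = a + k * (2 * n + 2 : ℕ) ∧ C q = c + k * (2 * n + 2 : ℕ) ∧
        D q = d + k * (2 * n + 2 : ℕ) ∧
        B q + (n + 1) = b + (n + 1) + k * (2 * n + 2 : ℕ) := by omega
    change quad (2 * n + 2) (A q) (C q) (D q) (B q + (n + 1)) = _
    rw [hk.1, hk.2.1, hk.2.2.1, hk.2.2.2, quad_shift]
  · rintro q a b c d ⟨hv, hb, hc, hd, hH⟩
    obtain ⟨a, rfl, -, -⟩ := exists_int_lift (by omega : 0 < 2 * n + 2) a 0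
    have hlift : ∀ x : ZMod (2 * n + 2), x = ((a + (x - (a : ZMod (2 * n + 2))).val : ℤ) :
        ZMod (2 * n + 2)) := by
      intro x
      push_cast
      rw [ZMod.natCast_zmod_val]
      ring
    have hdH : (d - (a : ZMod (2 * n + 2))).val ≤ n + 1 := hH (by rw [hv]; simp)
    have hb' := hlift b
    have hc' := hlift c
    have hd' := hlift d
    generalize (b - (a : ZMod (2 * n + 2))).val = x at *
    generalize (c - (a : ZMod (2 * n + 2))).val = y at *
    generalize (d - (a : ZMod (2 * n + 2))).val = z at *
    rw [h5 q, vertices_quad, hb', hc', hd'] at hv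
    have g1 := h1 q
    have g2 := h2 q
    have g3 := h3 q
    have g4 := h4 q
    obtain ⟨k, hk⟩ := rotation_of_vertices_eq (m := 2 * n + 2) (by omega) (by omega) (by omega)
      (by omega) (by omega) (by omega) (by omega) (by omega) hv
    have hk : a = A q + k * (2 * n + 2 : ℕ) ∧ a + x = B q + k * (2 * n + 2 : ℕ) ∧
        a + y = C q + k * (2 * n + 2 : ℕ) ∧ a + z = D q + k * (2 * n + 2 : ℕ) := by omega
    rw [vertices_quad, hb', hc', hd', opp_intCast, hk.2.1, hk.2.2.1, hk.2.2.2, hk.1]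
    simp only [add_right_comm _ (k * ((2 * n + 2 : ℕ) : ℤ)), intCast_add_mul_modulus]

end SymmetricPolygon

namespace SymmetricPolygon

open ConvexPolygon

variable {n : ℕ} {T : Set (Sym2 (ZMod (2 * n + 2)))}

/-! ### Quadrilaterals of orbits in the symmetric polygon -/

/-- The union of the quadrilateral with vertices `a`, `b`, `c`, `d` and its image under the central
symmetry. -/
def doubleQuad (n : ℕ) (a b c d : ℤ) : Set (Sym2 (ZMod (2 * n + 2))) :=
  quad (2 * n + 2) a b c d ∪
    quad (2 * n + 2) (a + (n + 1)) (b + (n + 1)) (c + (n + 1)) (d + (n + 1))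

/-- The rectangle whose diagonals are the diameters at `a` and `c`. -/
def rectangle (n : ℕ) (a c : ℤ) : Set (Sym2 (ZMod (2 * n + 2))) :=
  quad (2 * n + 2) a c (a + (n + 1)) (c + (n + 1))

theorem orbitQuadrilateral_eq (T : Set (Sym2 (ZMod (2 * n + 2)))) (γ : Sym2 (ZMod (2 * n + 2))) :
    orbitQuadrilateral T γ = ConvexPolygon.quadrilateral T γ ∪
      ConvexPolygon.quadrilateral T (act γ) := by
  ext e
  constructor
  · rintro ⟨he, δ, rfl | rfl, h⟩
    · exact Or.inl ⟨he, h⟩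
    · exact Or.inr ⟨he, h⟩
  · rintro (⟨he, h⟩ | ⟨he, h⟩)
    · exact ⟨he, γ, Or.inl rfl, h⟩
    · exact ⟨he, act γ, Or.inr rfl, h⟩

theorem IsSymmTriangulation.orbitQuadrilateral_eq_doubleQuad (hT : IsSymmTriangulation T)
    {a b c d : ℤ} (hab : Edge T a b) (hbc : Edge T b c) (hcd : Edge T c d) (had : Edge T a d)
    (hac : s((a : ZMod (2 * n + 2)), (c : ZMod (2 * n + 2))) ∈ T) :
    orbitQuadrilateral T (s((a : ZMod (2 * n + 2)), (c : ZMod (2 * n + 2)))) =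
      doubleQuad n a b c d := by
  rw [orbitQuadrilateral_eq, hT.1.quadrilateral_eq (by omega) hab hbc hcd had hac, act_mk,
    hT.1.quadrilateral_eq (by omega) (hT.edge_act hab) (hT.edge_act hbc) (hT.edge_act hcd)
      (hT.edge_act had) (by rw [← act_mk]; exact hT.act_mem hac)]
  rfl

theorem IsSymmTriangulation.orbitQuadrilateral_eq_rectangle (hT : IsSymmTriangulation T)
    {a b : ℤ} (hab : Edge T a b) (hb : Edge T b (a + (n + 1)))
    (hac : s((a : ZMod (2 * n + 2)), ((a + (n + 1) : ℤ) : ZMod (2 * n + 2))) ∈ T) :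
    orbitQuadrilateral T (s((a : ZMod (2 * n + 2)), ((a + (n + 1) : ℤ) : ZMod (2 * n + 2)))) =
      rectangle n a b := by
  have h1 := hT.edge_act hab
  have h2 : Edge T a (b + (n + 1)) := by
    have := (hT.edge_act hb).flip'
    convert this using 1
    push_cast; ring
  rw [orbitQuadrilateral_eq, act_mk, intCast_add_two_halves,
    Sym2.eq_swap (a := ((a + (n + 1) : ℤ) : ZMod (2 * n + 2))), Set.union_self,
    hT.1.quadrilateral_eq (by omega) hab hb h1 h2 hac]
  rfl

theorem doubleQuad_add_half (a b c d : ℤ) :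
    doubleQuad n (a + (n + 1)) (b + (n + 1)) (c + (n + 1)) (d + (n + 1)) = doubleQuad n a b c d := by
  unfold doubleQuad
  rw [Set.union_comm]
  congr 1
  simp only [quad, intCast_add_two_halves]

theorem doubleQuad_rotate (a b c d : ℤ) :
    doubleQuad n b c d (a + (2 * n + 2 : ℕ)) = doubleQuad n a b c d := by
  unfold doubleQuad
  rw [quad_rotate, add_right_comm, quad_rotate]

theorem rectangle_rotate (a c : ℤ) : rectangle n c (a + (n + 1)) = rectangle n a c := by
  unfold rectangle
  rw [← quad_rotate a c]
  congr 1
  push_cast; ring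

theorem doubleQuad_shift (k a b c d : ℤ) :
    doubleQuad n (a + k * (n + 1 : ℕ)) (b + k * (n + 1 : ℕ)) (c + k * (n + 1 : ℕ))
      (d + k * (n + 1 : ℕ)) = doubleQuad n a b c d := by
  have step : ∀ j a b c d : ℤ, doubleQuad n (a + (j + 1) * (n + 1 : ℕ)) (b + (j + 1) * (n + 1 : ℕ))
      (c + (j + 1) * (n + 1 : ℕ)) (d + (j + 1) * (n + 1 : ℕ)) = doubleQuad n (a + j * (n + 1 : ℕ))
      (b + j * (n + 1 : ℕ)) (c + j * (n + 1 : ℕ)) (d + j * (n + 1 : ℕ)) := by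
    intro j a b c d
    rw [← doubleQuad_add_half (a + j * (n + 1 : ℕ))]
    congr 1 <;> push_cast <;> ring
  induction k with
  | zero => simp
  | succ k ih => rw [step, ih]
  | pred k ih => rw [← step, sub_add_cancel, ih]

theorem mem_orbitQuadrilaterals_iff (hn : 1 ≤ n) {q : Set (Sym2 (ZMod (2 * n + 2)))} :
    q ∈ orbitQuadrilaterals n ↔ (∃ a c : ℤ, a < c ∧ c < a + (n + 1) ∧ q = rectangle n a c) ∨
      ∃ a b c d : ℤ, a < b ∧ b < c ∧ c < d ∧ d ≤ a + (n + 1) ∧ q = doubleQuad n a b c d := by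
  constructor
  · rintro ⟨T, γ, hT, hγ, rfl⟩
    obtain ⟨a, c, hac, hc, rfl⟩ : ∃ a c : ℤ, a < c ∧ c ≤ a + (n + 1) ∧
        γ = s((a : ZMod _), (c : ZMod _)) := by
      obtain ⟨a, c, h1, h2, h3, rfl⟩ :=
        exists_lift_of_not_isDiag (by omega) (hT.1.isArc hγ).1 0
      rcases le_or_gt c (a + (n + 1)) with h | h
      · exact ⟨a, c, h2, h, rfl⟩
      · refine ⟨c, a + (2 * n + 2 : ℕ), by omega, by omega, ?_⟩
        rw [intCast_add_modulus, Sym2.eq_swap]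
    obtain ⟨b, d, hab, hbc, hcd, had⟩ := hT.1.exists_corners (by omega) hac (by omega) hγ
    have := hab.1
    have := hbc.1
    have := hcd.1
    have := had.2.1
    rcases hc.eq_or_lt with rfl | hc
    · exact Or.inl ⟨a, b, by omega, by omega, hT.orbitQuadrilateral_eq_rectangle hab hbc hγ⟩
    right
    rw [hT.orbitQuadrilateral_eq_doubleQuad hab hbc hcd had hγ]
    -- a diameter that has the arc on its clockwise side
    obtain ⟨i, hia, hai, hi⟩ : ∃ i : ℤ, i ≤ a ∧ a < i + (n + 1) ∧ Edge T i (i + (n + 1)) := by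
      obtain ⟨j, hj⟩ := hT.exists_diameter
      obtain ⟨x, hx, hx1, hx2⟩ := exists_int_lift (m := 2 * n + 2) (by omega) (j : ZMod (2 * n + 2))
        (a - (2 * n + 2 : ℕ) + 1)
      obtain ⟨k, rfl⟩ := (intCast_zmod_eq_iff j x).1 hx.symm
      have hjk := hj.shift k
      rw [add_right_comm] at hjk
      by_cases h : a < j + k * (2 * n + 2 : ℕ) + (n + 1)
      · exact ⟨_, by omega, h, hjk⟩
      · exact ⟨_, by omega, by omega, hT.edge_act hjk⟩
    have hci : c ≤ i + (n + 1) := by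
      by_contra! h
      exact hT.1.not_interlaced (by omega) hi ⟨hac, by omega, Or.inl hγ⟩ (by omega) hai h (by omega)
    have hd : d ≤ i + (n + 1) ∨ i + (2 * n + 2 : ℕ) ≤ d := by
      by_contra! h
      rcases hci.eq_or_lt with h' | h'
      · exact hT.1.not_interlaced (by omega) hi.flip had.flip (by omega) (by omega) (by omega)
          (by omega)
      · exact hT.1.not_interlaced (by omega) hcd hi.flip (by omega) (by omega) (by omega) (by omega)
    rcases hd with hd | hd
    · exact ⟨a, b, c, d, by omega, by omega, by omega, by omega, rfl⟩
    · refine ⟨d - (2 * n + 2 : ℕ), a, b, c, by omega, by omega, by omega, by omega, ?_⟩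
      rw [← doubleQuad_rotate (d - (2 * n + 2 : ℕ)), sub_add_cancel]
  · rintro (⟨a, c, h1, h2, rfl⟩ | ⟨a, b, c, d, h1, h2, h3, h4, rfl⟩)
    · obtain ⟨T, hT, hE, hD⟩ := exists_symmTriangulation_of_laminar hn a
        (fun p q => (p = a ∧ q = c) ∨ (p = c ∧ q = a + (n + 1))) (by intro p q; omega)
        (by intro p q r s; omega)
      have hγ := hD.mem_of_ne (by omega) (by omega) (by omega)
      exact ⟨T, _, hT, hγ, (hT.orbitQuadrilateral_eq_rectangle (hE a c (by omega))
        (hE c _ (by omega)) hγ).symm⟩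
    · obtain ⟨T, hT, hE, -⟩ := exists_symmTriangulation_of_laminar hn a
        (fun p q => (p = a ∧ q = b) ∨ (p = b ∧ q = c) ∨ (p = c ∧ q = d) ∨ (p = a ∧ q = d) ∨
        (p = a ∧ q = c)) (by intro p q; omega) (by intro p q r s; omega)
      have hγ := (hE a c (by omega)).mem_of_ne (by omega) (by omega) (by omega)
      exact ⟨T, _, hT, hγ, (hT.orbitQuadrilateral_eq_doubleQuad (hE a b (by omega))
        (hE b c (by omega)) (hE c d (by omega)) (hE a d (by omega)) hγ).symm⟩

/-! ### Counting in the symmetric polygon -/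

/-- Two segments are equal up to the symmetry only if their lifts spanning at most a half-turn
differ by a number of half-turns. -/
theorem exists_half_turns_of_mk_eq {p q r s : ℤ} (hpq : p < q) (hq : q ≤ p + (n + 1)) (hrs : r < s)
    (hs : s ≤ r + (n + 1))
    (h : (s((p : ZMod (2 * n + 2)), (q : ZMod (2 * n + 2))) : Sym2 (ZMod (2 * n + 2))) =
      s((r : ZMod (2 * n + 2)), (s : ZMod (2 * n + 2)))) :
    ∃ k : ℤ, p = r + k * (n + 1 : ℕ) ∧ q = s + k * (n + 1 : ℕ) := by
  rw [eq_comm, mk_eq_mk_iff_of_lt hrs (by omega) hpq (by omega)] at h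
  obtain ⟨k, ⟨h1, h2⟩ | ⟨h1, h2⟩⟩ := h
  · refine ⟨2 * k, ?_, ?_⟩
    · rw [h1]; push_cast; ring
    · rw [h2]; push_cast; ring
  · obtain rfl : s = r + (n + 1) := by omega
    refine ⟨2 * k + 1, ?_, ?_⟩
    · rw [h1]; push_cast; ring
    · rw [h2]; push_cast; ring

theorem exists_of_mem_doubleQuad {a b c d p q : ℤ} (hab : a < b) (hbc : b < c) (hcd : c < d)
    (hd : d ≤ a + (n + 1)) (hpq : p < q) (hq : q ≤ p + (n + 1))
    (h : s((p : ZMod (2 * n + 2)), (q : ZMod (2 * n + 2))) ∈ doubleQuad n a b c d) :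
    ∃ k : ℤ, (p = a + k * (n + 1 : ℕ) ∧ q = b + k * (n + 1 : ℕ)) ∨
      (p = b + k * (n + 1 : ℕ) ∧ q = c + k * (n + 1 : ℕ)) ∨
      (p = c + k * (n + 1 : ℕ) ∧ q = d + k * (n + 1 : ℕ)) ∨
      (p = a + k * (n + 1 : ℕ) ∧ q = d + k * (n + 1 : ℕ)) := by
  have half : ∀ r s : ℤ, r < s → s ≤ r + (n + 1) →
      (s((p : ZMod (2 * n + 2)), (q : ZMod (2 * n + 2))) : Sym2 (ZMod (2 * n + 2))) =
        s(((r + (n + 1) : ℤ) : ZMod (2 * n + 2)), ((s + (n + 1) : ℤ) : ZMod (2 * n + 2))) →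
      ∃ k : ℤ, p = r + k * (n + 1 : ℕ) ∧ q = s + k * (n + 1 : ℕ) := by
    intro r s h1 h2 h3
    obtain ⟨k, h4, h5⟩ := exists_half_turns_of_mk_eq hpq hq (by omega) (by omega) h3
    refine ⟨k + 1, ?_, ?_⟩
    · rw [h4]; push_cast; ring
    · rw [h5]; push_cast; ring
  rcases h with (h | h | h | h) | (h | h | h | h)
  · obtain ⟨k, h1⟩ := exists_half_turns_of_mk_eq hpq hq (by omega) (by omega) h
    exact ⟨k, Or.inl h1⟩
  · obtain ⟨k, h1⟩ := exists_half_turns_of_mk_eq hpq hq (by omega) (by omega) h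
    exact ⟨k, Or.inr (Or.inl h1)⟩
  · obtain ⟨k, h1⟩ := exists_half_turns_of_mk_eq hpq hq (by omega) (by omega) h
    exact ⟨k, Or.inr (Or.inr (Or.inl h1))⟩
  · obtain ⟨k, h1⟩ := exists_half_turns_of_mk_eq hpq hq (by omega) (by omega) h
    exact ⟨k, Or.inr (Or.inr (Or.inr h1))⟩
  · obtain ⟨k, h1⟩ := half _ _ (by omega) (by omega) h
    exact ⟨k, Or.inl h1⟩
  · obtain ⟨k, h1⟩ := half _ _ (by omega) (by omega) h
    exact ⟨k, Or.inr (Or.inl h1)⟩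
  · obtain ⟨k, h1⟩ := half _ _ (by omega) (by omega) h
    exact ⟨k, Or.inr (Or.inr (Or.inl h1))⟩
  · obtain ⟨k, h1⟩ := half _ _ (by omega) (by omega) h
    exact ⟨k, Or.inr (Or.inr (Or.inr h1))⟩

theorem exists_of_mem_rectangle {a c p q : ℤ} (hac : a < c) (hc : c < a + (n + 1)) (hpq : p < q)
    (hq : q ≤ p + (n + 1))
    (h : s((p : ZMod (2 * n + 2)), (q : ZMod (2 * n + 2))) ∈ rectangle n a c) :
    ∃ k : ℤ, (p = a + k * (n + 1 : ℕ) ∧ q = c + k * (n + 1 : ℕ)) ∨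
      (p = c + k * (n + 1 : ℕ) ∧ q = a + (n + 1) + k * (n + 1 : ℕ)) := by
  rcases h with h | h | h | h
  · obtain ⟨k, h1⟩ := exists_half_turns_of_mk_eq hpq hq (by omega) (by omega) h
    exact ⟨k, Or.inl h1⟩
  · obtain ⟨k, h1⟩ := exists_half_turns_of_mk_eq hpq hq (by omega) (by omega) h
    exact ⟨k, Or.inr h1⟩
  · obtain ⟨k, h1, h2⟩ := exists_half_turns_of_mk_eq hpq hq (by omega) (by omega) h
    refine ⟨k + 1, Or.inl ⟨?_, ?_⟩⟩
    · rw [h1]; push_cast; ring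
    · rw [h2]; push_cast; ring
  · have h' : (s((p : ZMod (2 * n + 2)), (q : ZMod (2 * n + 2))) : Sym2 (ZMod (2 * n + 2))) =
        s(((c + (n + 1) : ℤ) : ZMod (2 * n + 2)), ((a + (2 * n + 2 : ℕ) : ℤ) : ZMod (2 * n + 2))) := by
      rw [intCast_add_modulus, Sym2.eq_swap (a := ((c + (n + 1) : ℤ) : ZMod (2 * n + 2)))]
      exact h
    obtain ⟨k, h1, h2⟩ := exists_half_turns_of_mk_eq hpq hq (by omega) (by omega) h'
    refine ⟨k + 1, Or.inr ⟨?_, ?_⟩⟩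
    · rw [h1]; push_cast; ring
    · rw [h2]; push_cast; ring

theorem mem_doubleQuad₁ (a b c d : ℤ) :
    s((a : ZMod (2 * n + 2)), (b : ZMod (2 * n + 2))) ∈ doubleQuad n a b c d := Or.inl (Or.inl rfl)

theorem mem_doubleQuad₃ (a b c d : ℤ) :
    s((c : ZMod (2 * n + 2)), (d : ZMod (2 * n + 2))) ∈ doubleQuad n a b c d :=
  Or.inl (Or.inr (Or.inr (Or.inl rfl)))

theorem mem_doubleQuad₄ (a b c d : ℤ) :
    s((a : ZMod (2 * n + 2)), (d : ZMod (2 * n + 2))) ∈ doubleQuad n a b c d :=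
  Or.inl (Or.inr (Or.inr (Or.inr rfl)))

theorem rectangle_injective {a c a' c' : ℤ} (ha : 0 ≤ a) (hac : a < c) (hc : c < n + 1)
    (ha' : 0 ≤ a') (hac' : a' < c') (hc' : c' < n + 1) (h : rectangle n a c = rectangle n a' c') :
    a = a' ∧ c = c' := by
  have hm : s((a : ZMod (2 * n + 2)), (c : ZMod (2 * n + 2))) ∈ rectangle n a' c' := by
    rw [← h]; exact Or.inl rfl
  obtain ⟨k, hk⟩ := exists_of_mem_rectangle hac' (by omega) hac (by omega) hm
  rcases mul_modulus_cases (m := n + 1) k with h' | h' | h' | h' | h' <;> omega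

theorem rectangle_ne_doubleQuad {a c a' b' c' d' : ℤ} (hac : a < c) (hc : c < a + (n + 1))
    (hab' : a' < b') (hbc' : b' < c') (hcd' : c' < d') (hd' : d' ≤ a' + (n + 1)) :
    rectangle n a c ≠ doubleQuad n a' b' c' d' := by
  intro h
  obtain ⟨k, hk⟩ := exists_of_mem_rectangle hac hc (by omega) (by omega)
    (h ▸ mem_doubleQuad₁ a' b' c' d')
  obtain ⟨l, hl⟩ := exists_of_mem_rectangle hac hc (by omega) (by omega)
    (h ▸ mem_doubleQuad₄ a' b' c' d')
  have hkl : (k - l) * (n + 1 : ℕ) = k * (n + 1 : ℕ) - l * (n + 1 : ℕ) := by ring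
  rcases mul_modulus_cases (m := n + 1) (k - l) with h' | h' | h' | h' | h' <;> omega

theorem doubleQuad_injective {a b c d a' b' c' d' : ℤ} (ha : 0 ≤ a) (han : a < n + 1) (hab : a < b)
    (hbc : b < c) (hcd : c < d) (hd : d ≤ a + (n + 1)) (ha' : 0 ≤ a') (han' : a' < n + 1)
    (hab' : a' < b') (hbc' : b' < c') (hcd' : c' < d') (hd' : d' ≤ a' + (n + 1))
    (h : doubleQuad n a b c d = doubleQuad n a' b' c' d') : a = a' ∧ b = b' ∧ c = c' ∧ d = d' := by
  -- the longest sides of both sets coincide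
  have h1 : a = a' ∧ d = d' := by
    obtain ⟨k, hk⟩ := exists_of_mem_doubleQuad hab' hbc' hcd' hd' (by omega) (by omega)
      (h ▸ mem_doubleQuad₄ a b c d)
    obtain ⟨l, hl⟩ := exists_of_mem_doubleQuad hab hbc hcd hd (by omega) (by omega)
      (h ▸ mem_doubleQuad₄ a' b' c' d')
    rcases mul_modulus_cases (m := n + 1) k with h' | h' | h' | h' | h' <;> omega
  obtain ⟨rfl, rfl⟩ := h1
  have h2 : b = b' := by
    obtain ⟨k, hk⟩ := exists_of_mem_doubleQuad hab' hbc' hcd' hd' (by omega) (by omega)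
      (h ▸ mem_doubleQuad₁ a b c d)
    obtain ⟨l, hl⟩ := exists_of_mem_doubleQuad hab hbc hcd hd (by omega) (by omega)
      (h ▸ mem_doubleQuad₁ a b' c' d)
    rcases mul_modulus_cases (m := n + 1) k with h' | h' | h' | h' | h' <;> omega
  have h3 : c = c' := by
    obtain ⟨k, hk⟩ := exists_of_mem_doubleQuad hab' hbc' hcd' hd' (by omega) (by omega)
      (h ▸ mem_doubleQuad₃ a b c d)
    obtain ⟨l, hl⟩ := exists_of_mem_doubleQuad hab hbc hcd hd (by omega) (by omega)
      (h ▸ mem_doubleQuad₃ a b' c' d)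
    rcases mul_modulus_cases (m := n + 1) k with h' | h' | h' | h' | h' <;>
    rcases mul_modulus_cases (m := n + 1) l with h' | h' | h' | h' | h' <;> omega
  exact ⟨rfl, h2, h3, rfl⟩

theorem ncard_Q₁ (n : ℕ) : (Q₁ n).ncard = (2 * n + 2) * (n + 1).choose 3 := by
  rw [← ncard_based_quadruples (by omega) (quad (2 * n + 2)) quad_shift ?_]
  · congr 1
    ext q
    exact mem_Q₁_iff
  · intro a b c d a' b' c' d' h1 h2 h3 h4 h5 h6 h1' h2' h3' h4' h5' h6' h
    have hv := congrArg vertices h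
    rw [vertices_quad, vertices_quad] at hv
    obtain ⟨k, hk⟩ := rotation_of_vertices_eq (m := 2 * n + 2) (by omega) (by omega) (by omega)
      (by omega) (by omega) (by omega) (by omega) (by omega) hv
    have hcases := mul_modulus_cases (m := 2 * n + 2) k
    omega

theorem ncard_orbitQuadrilaterals (hn : 1 ≤ n) :
    (orbitQuadrilaterals n).ncard = (n + 1).choose 2 + (n + 1) * (n + 1).choose 3 := by
  have : Finite (Sym2 (ZMod (2 * n + 2))) := Quot.finite _
  rw [← ncard_cyclic_pairs (m := n + 1) (rectangle n) ?_ ?_,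
    ← ncard_based_quadruples (m := n + 1) (by omega) (doubleQuad n) doubleQuad_shift ?_,
    ← Set.ncard_union_eq ?_ (Set.toFinite _) (Set.toFinite _)]
  · congr 1
    ext q
    exact mem_orbitQuadrilaterals_iff hn
  · rw [Set.disjoint_left]
    rintro _ ⟨a, c, h1, h2, rfl⟩ ⟨a', b', c', d', h3, h4, h5, h6, h⟩
    exact rectangle_ne_doubleQuad h1 h2 h3 h4 h5 h6 h
  · intro a b c d a' b' c' d' h1 h2 h3 h4 h5 h6 h1' h2' h3' h4' h5' h6' h
    exact doubleQuad_injective h1 h2 h3 h4 h5 h6 h1' h2' h3' h4' h5' h6' h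
  · exact rectangle_rotate
  · intro a b a' b' h1 h2 h3 h4 h5 h6 h
    exact rectangle_injective h1 h2 h3 h4 h5 h6 h

end SymmetricPolygon

/-! ### Crossing curves in the once-punctured polygon -/

namespace PuncturedPolygon

open TaggedCurve

variable {n : ℕ}

theorem mem_geodesic_iff {a b : ℝ} (hab : a < b) (z : ℂ) :
    z ∈ geodesic a b ↔ z.im < 0 ∧ (z.re - a) * (z.re - b) + z.im ^ 2 = 0 := by
  unfold geodesic
  refine and_congr_right fun _ => ?_
  have h := Complex.sq_norm (z - (((a + b) / 2 : ℝ) : ℂ))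
  rw [Complex.normSq_apply, Complex.sub_re, Complex.sub_im, Complex.ofReal_re, Complex.ofReal_im] at h
  rw [← sq_eq_sq₀ (norm_nonneg _) (by linarith), h]
  constructor <;> intro h' <;> nlinarith

theorem exists_mem_geodesic_of_interlaced {a b c d : ℝ} (hac : a < c) (hcb : c < b) (hbd : b < d) :
    ∃ z, z ∈ geodesic a b ∧ z ∈ geodesic c d := by
  have hD : 0 < c + d - a - b := by linarith
  set x := (c * d - a * b) / (c + d - a - b) with hx
  have hxD : x * (c + d - a - b) = c * d - a * b := by rw [hx]; field_simp
  have h1 : c < x := by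
    rw [hx, lt_div_iff₀ hD]
    nlinarith [mul_pos (sub_pos.2 hac) (sub_pos.2 hcb)]
  have h2 : x < b := by
    rw [hx, div_lt_iff₀ hD]
    nlinarith [mul_pos (sub_pos.2 hcb) (sub_pos.2 hbd)]
  have hp : 0 < (x - a) * (b - x) := mul_pos (by linarith) (by linarith)
  have hs := Real.sq_sqrt hp.le
  have hs0 := Real.sqrt_pos.2 hp
  refine ⟨⟨x, -Real.sqrt ((x - a) * (b - x))⟩, ?_, ?_⟩
  · rw [mem_geodesic_iff (by linarith)]
    exact ⟨by simpa using hs0, by simp only; nlinarith⟩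
  · rw [mem_geodesic_iff (by linarith)]
    exact ⟨by simpa using hs0, by simp only; nlinarith⟩

theorem interlaced_of_mem_geodesic {a b c d : ℝ} (hab : a < b) (hcd : c < d) {z : ℂ}
    (h1 : z ∈ geodesic a b) (h2 : z ∈ geodesic c d) :
    (a = c ∧ b = d) ∨ (a < c ∧ c < b ∧ b < d) ∨ (c < a ∧ a < d ∧ d < b) := by
  rw [mem_geodesic_iff hab] at h1
  rw [mem_geodesic_iff hcd] at h2
  obtain ⟨h0, h1⟩ := h1
  obtain ⟨-, h2⟩ := h2
  set x := z.re
  have hy : 0 < z.im ^ 2 := sq_pos_of_neg h0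
  have hpos1 : 0 < (x - a) * (b - x) := by nlinarith
  have hpos2 : 0 < (x - c) * (d - x) := by nlinarith
  have hbnd : ∀ {p q : ℝ}, p < q → 0 < (x - p) * (q - x) → p < x ∧ x < q := by
    intro p q hpq h
    rcases pos_and_pos_or_neg_and_neg_of_mul_pos h with h | h
    · exact ⟨by linarith [h.1], by linarith [h.2]⟩
    · linarith [h.1, h.2]
  obtain ⟨ha, hb⟩ := hbnd hab hpos1
  obtain ⟨hc, hd⟩ := hbnd hcd hpos2
  have heq : (x - a) * (b - x) = (x - c) * (d - x) := by linarith
  -- on nested intervals the two quadratic functions differ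
  rcases lt_trichotomy a c with hac | hac | hac
  · right; left
    refine ⟨hac, by linarith, ?_⟩
    by_contra! h
    have h3 : (x - c) * (b - x) < (x - a) * (b - x) :=
      mul_lt_mul_of_pos_right (by linarith) (by linarith)
    have h4 : (x - c) * (d - x) ≤ (x - c) * (b - x) :=
      mul_le_mul_of_nonneg_left (by linarith) (by linarith)
    linarith
  · left
    subst hac
    have := mul_left_cancel₀ (by linarith : x - a ≠ 0) heq
    exact ⟨rfl, by linarith⟩
  · right; right
    refine ⟨hac, by linarith, ?_⟩
    by_contra! h
    have h3 : (x - a) * (d - x) < (x - c) * (d - x) :=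
      mul_lt_mul_of_pos_right (by linarith) (by linarith)
    have h4 : (x - a) * (b - x) ≤ (x - a) * (d - x) :=
      mul_le_mul_of_nonneg_left (by linarith) (by linarith)
    linarith

/-- The universal covering map of the punctured disk. -/
noncomputable def cover (n : ℕ) (z : ℂ) : ℂ :=
  Complex.exp (-(2 * Real.pi * Complex.I * z / (n : ℂ)))

theorem cover_eq_cover_iff (hn : 0 < n) (z w : ℂ) :
    cover n z = cover n w ↔ ∃ k : ℤ, w = z + k * n := by
  have hn' : (n : ℂ) ≠ 0 := by exact_mod_cast hn.ne'
  have hpi : (2 * Real.pi * Complex.I : ℂ) ≠ 0 := Complex.two_pi_I_ne_zero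
  unfold cover
  rw [Complex.exp_eq_exp_iff_exists_int]
  refine exists_congr fun k => ?_
  constructor
  · intro h
    have h' : (2 * Real.pi * Complex.I) * w = (2 * Real.pi * Complex.I) * (z + k * n) := by
      field_simp at h
      linear_combination (2 * Real.pi * Complex.I) * h
    exact mul_left_cancel₀ hpi h'
  · rintro rfl
    field_simp
    ring

theorem geodesic_add (a b t : ℝ) (z : ℂ) :
    z + t ∈ geodesic (a + t) (b + t) ↔ z ∈ geodesic a b := by
  unfold geodesic
  have h1 : z + t - (((a + t + (b + t)) / 2 : ℝ) : ℂ) = z - (((a + b) / 2 : ℝ) : ℂ) := by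
    push_cast; ring
  simp only [Set.mem_ofPred_eq, h1, Complex.add_im, Complex.ofReal_im, add_zero, add_sub_add_right_eq_sub]

theorem geodesic_add_int (a b k : ℤ) (z : ℂ) :
    z + k * n ∈ geodesic ((a + k * n : ℤ) : ℝ) ((b + k * n : ℤ) : ℝ) ↔
      z ∈ geodesic (a : ℝ) (b : ℝ) := by
  rw [← geodesic_add (a : ℝ) (b : ℝ) (k * n : ℝ)]
  push_cast
  rfl

theorem chord_eq_chord_iff {a b c d : ℤ} (hab : a < b) (hb : b < a + n) (hcd : c < d)
    (hd : d < c + n) :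
    (chord (a : ZMod n) (b : ZMod n)) = chord (c : ZMod n) (d : ZMod n) ↔
      ∃ k : ℤ, c = a + k * n ∧ d = b + k * n := by
  rw [chord.injEq, intCast_zmod_eq_iff, intCast_zmod_eq_iff]
  constructor
  · rintro ⟨⟨k, hk⟩, l, hl⟩
    refine ⟨k, hk, ?_⟩
    have h3 : (l - k) * n = l * n - k * n := by ring
    rcases mul_modulus_cases (m := n) (l - k) with h | h | h | h | h <;> omega
  · rintro ⟨k, h1, h2⟩
    exact ⟨⟨k, h1⟩, k, h2⟩

theorem mem_curve_chord_iff {a b : ℤ} (hab : a < b) (hb : b < a + n) (w : ℂ) :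
    w ∈ curve (chord (a : ZMod n) (b : ZMod n)) ↔
      ∃ z ∈ geodesic (a : ℝ) (b : ℝ), w = cover n z := by
  constructor
  · rintro ⟨a', b', ha', hb', h1, h2, z, hz, rfl⟩
    obtain ⟨k, rfl, rfl⟩ := (chord_eq_chord_iff h1 h2 hab hb).1 (by rw [ha', hb'])
    exact ⟨z + k * n, (geodesic_add_int _ _ _ _).2 hz,
      (cover_eq_cover_iff (by omega) _ _).2 ⟨k, rfl⟩⟩
  · rintro ⟨z, hz, rfl⟩
    exact ⟨a, b, rfl, rfl, hab, hb, z, hz, rfl⟩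

theorem mem_curve_radius_iff (hn : 0 < n) (c : ℤ) (t : Bool) (w : ℂ) :
    w ∈ curve (radius (c : ZMod n) t) ↔ ∃ y : ℝ, y < 0 ∧ w = cover n (c + y * Complex.I) := by
  have hn' : (0 : ℝ) < n := by exact_mod_cast hn
  have hpi := Real.pi_pos
  have hcov : ∀ y : ℝ, cover n (c + y * Complex.I) =
      Real.exp (2 * Real.pi * y / n) * polyVertex n (c : ZMod n) := by
    intro y
    rw [ConvexPolygon.polyVertex_intCast hn, cover, Complex.ofReal_exp, ← Complex.exp_add]
    congr 1
    push_cast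
    linear_combination (-(2 * Real.pi * y / n) : ℂ) * Complex.I_sq
  constructor
  · rintro ⟨x, s, hx, hs, hxs, rfl⟩
    refine ⟨n * Real.log s / (2 * Real.pi), ?_, ?_⟩
    · have := Real.log_neg hs (by linarith)
      exact div_neg_of_neg_of_pos (mul_neg_of_pos_of_neg hn' this) (by positivity)
    · rw [hcov, show 2 * Real.pi * (n * Real.log s / (2 * Real.pi)) / n = Real.log s by
        field_simp, Real.exp_log hs, smul_zero, zero_add, Complex.real_smul]
  · rintro ⟨y, hy, rfl⟩
    have h1 : Real.exp (2 * Real.pi * y / n) < 1 := by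
      rw [Real.exp_lt_one_iff]
      exact div_neg_of_neg_of_pos (mul_neg_of_pos_of_neg (by positivity) hy) hn'
    refine ⟨1 - Real.exp (2 * Real.pi * y / n), Real.exp (2 * Real.pi * y / n), by linarith,
      Real.exp_pos _, by ring, ?_⟩
    rw [hcov, smul_zero, zero_add, Complex.real_smul]

/-- Two distinct chords meet in the punctured disk exactly if two of their geodesic lifts meet, and
distinct geodesics meet exactly if their endpoints are interlaced. -/
theorem compatible_chord_chord_iff {a b c d : ℤ} (hab : a < b) (hb : b < a + n) (hcd : c < d)
    (hd : d < c + n) :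
    Compatible (chord (a : ZMod n) (b : ZMod n)) (chord (c : ZMod n) (d : ZMod n)) ↔
      ∀ k : ℤ, ¬ (a < c + k * n ∧ c + k * n < b ∧ b < d + k * n) ∧
        ¬ (c + k * n < a ∧ a < d + k * n ∧ d + k * n < b) := by
  have hn : 0 < n := by omega
  change _ = _ ∨ Disjoint _ _ ↔ _
  constructor
  · rintro (h | h) k
    · obtain ⟨l, rfl, rfl⟩ := (chord_eq_chord_iff hab hb hcd hd).1 h
      have hkl : (k + l) * n = k * n + l * n := by ring
      rcases mul_modulus_cases (m := n) (k + l) with h | h | h | h | h <;> omega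
    · rw [Set.disjoint_left] at h
      have hz : ¬ ∃ z, z ∈ geodesic (a : ℝ) (b : ℝ) ∧
          z ∈ geodesic ((c + k * n : ℤ) : ℝ) ((d + k * n : ℤ) : ℝ) := by
        rintro ⟨z, h1, h2⟩
        refine h ((mem_curve_chord_iff hab hb _).2 ⟨z, h1, rfl⟩)
          ((mem_curve_chord_iff hcd hd _).2 ⟨z + (-k : ℤ) * n, ?_, ?_⟩)
        · rw [← geodesic_add_int (n := n) c d k]
          convert h2 using 1
          push_cast; ring
        · exact (cover_eq_cover_iff hn _ _).2 ⟨-k, rfl⟩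
      constructor
      · rintro ⟨h1, h2, h3⟩
        exact hz (exists_mem_geodesic_of_interlaced (by exact_mod_cast h1) (by exact_mod_cast h2)
          (by exact_mod_cast h3))
      · rintro ⟨h1, h2, h3⟩
        obtain ⟨z, h4, h5⟩ := exists_mem_geodesic_of_interlaced (a := ((c + k * n : ℤ) : ℝ))
          (b := ((d + k * n : ℤ) : ℝ)) (c := (a : ℝ)) (d := (b : ℝ)) (by exact_mod_cast h1)
          (by exact_mod_cast h2) (by exact_mod_cast h3)
        exact hz ⟨z, h5, h4⟩
  · intro h
    by_contra! hne
    obtain ⟨hne, hdis⟩ := hne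
    rw [Set.not_disjoint_iff] at hdis
    obtain ⟨w, h1, h2⟩ := hdis
    obtain ⟨z, hz, rfl⟩ := (mem_curve_chord_iff hab hb _).1 h1
    obtain ⟨z', hz', hw⟩ := (mem_curve_chord_iff hcd hd _).1 h2
    obtain ⟨k, rfl⟩ := (cover_eq_cover_iff hn _ _).1 hw.symm
    have hz2 := (geodesic_add_int (n := n) c d k z').2 hz'
    rcases interlaced_of_mem_geodesic (by exact_mod_cast hab) (by exact_mod_cast (by omega)) hz hz2
      with h3 | h3 | h3
    · apply hne
      rw [show a = c + k * n by exact_mod_cast h3.1, show b = d + k * n by exact_mod_cast h3.2,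
        intCast_add_mul_modulus, intCast_add_mul_modulus]
    · exact (h k).1 (by exact_mod_cast h3)
    · exact (h k).2 (by exact_mod_cast h3)

/-- The lifts of a radius are vertical rays, and such a ray meets a geodesic exactly if it starts
strictly between the endpoints of the geodesic. -/
theorem disjoint_chord_radius_iff {a b c : ℤ} (hab : a < b) (hb : b < a + n) (t : Bool) :
    Disjoint (curve (chord (a : ZMod n) (b : ZMod n))) (curve (radius (c : ZMod n) t)) ↔
      ∀ k : ℤ, ¬ (a < c + k * n ∧ c + k * n < b) := by
  have hn : 0 < n := by omega
  have hab' : (a : ℝ) < b := by exact_mod_cast hab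
  rw [Set.disjoint_left]
  constructor
  · rintro h k ⟨h1, h2⟩
    have h1' : (a : ℝ) < c + k * n := by exact_mod_cast h1
    have h2' : (c + k * n : ℝ) < b := by exact_mod_cast h2
    have hp : 0 < ((c + k * n : ℝ) - a) * (b - (c + k * n : ℝ)) := mul_pos (by linarith) (by linarith)
    have hs := Real.sq_sqrt hp.le
    have hs0 := Real.sqrt_pos.2 hp
    set y := Real.sqrt (((c + k * n : ℝ) - a) * (b - (c + k * n : ℝ)))
    refine h (a := cover n (((c + k * n : ℝ) : ℂ) + ((-y : ℝ) : ℂ) * Complex.I))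
      ((mem_curve_chord_iff hab hb _).2 ⟨_, ?_, rfl⟩)
      ((mem_curve_radius_iff hn c t _).2 ⟨-y, by linarith, ?_⟩)
    · rw [mem_geodesic_iff hab']
      simp only [Complex.add_re, Complex.add_im, Complex.re_ofReal_mul, Complex.im_ofReal_mul,
        Complex.ofReal_re, Complex.ofReal_im, Complex.I_re, Complex.I_im]
      constructor
      · linarith
      · nlinarith
    · refine (cover_eq_cover_iff hn _ _).2 ⟨-k, ?_⟩
      push_cast; ring
  · intro h w h1 h2
    obtain ⟨z, hz, rfl⟩ := (mem_curve_chord_iff hab hb _).1 h1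
    obtain ⟨y, hy, hw⟩ := (mem_curve_radius_iff hn c t _).1 h2
    obtain ⟨k, rfl⟩ := (cover_eq_cover_iff hn _ _).1 hw.symm
    rw [mem_geodesic_iff hab'] at hz
    have hre : ((c : ℂ) + y * Complex.I + k * n).re = (c + k * n : ℝ) := by simp
    obtain ⟨hz0, hz⟩ := hz
    rw [hre] at hz
    have hneg : ((c + k * n : ℝ) - a) * (b - (c + k * n : ℝ)) > 0 := by
      have : 0 < ((c : ℂ) + y * Complex.I + k * n).im ^ 2 := sq_pos_of_neg hz0
      nlinarith
    apply h k
    rcases pos_and_pos_or_neg_and_neg_of_mul_pos hneg with h' | h'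
    · constructor
      · have : (a : ℝ) < c + k * n := by linarith [h'.1]
        exact_mod_cast this
      · have : (c + k * n : ℝ) < b := by linarith [h'.2]
        exact_mod_cast this
    · linarith [h'.1, h'.2]

theorem Compatible.symm {x y : TaggedCurve n} (h : Compatible x y) : Compatible y x := by
  cases x <;> cases y
  · exact h.imp Eq.symm fun h' => h'.symm
  · exact h.imp Eq.symm fun h' => h'.symm
  · exact h.imp Eq.symm fun h' => h'.symm
  · exact h.imp Eq.symm Eq.symm

theorem compatible_self (x : TaggedCurve n) : Compatible x x := by
  cases x
  · exact Or.inl rfl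
  · exact Or.inl rfl

theorem compatible_chord_radius_iff {a b c : ℤ} (hab : a < b) (hb : b < a + n) (t : Bool) :
    Compatible (chord (a : ZMod n) (b : ZMod n)) (radius (c : ZMod n) t) ↔
      ∀ k : ℤ, ¬ (a < c + k * n ∧ c + k * n < b) := by
  rw [← disjoint_chord_radius_iff hab hb t]
  change _ = _ ∨ Disjoint _ _ ↔ _
  simp

end PuncturedPolygon

namespace PuncturedPolygon

open TaggedCurve

variable {n : ℕ} {T : Set (TaggedCurve n)}

/-! ### Tagged triangulations in integer coordinates -/

/-- `Edge T a b`: the integers `a < b` span less than a full turn, and the chord that the geodesic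
from `a` to `b` covers is an edge of `T`. -/
def Edge (T : Set (TaggedCurve n)) (a b : ℤ) : Prop :=
  a < b ∧ b < a + n ∧ chord (a : ZMod n) (b : ZMod n) ∈ edges T

/-- `Rad T c t`: the radius with tag `t` at the vertex represented by `c` belongs to `T`. -/
def Rad (T : Set (TaggedCurve n)) (c : ℤ) (t : Bool) : Prop := radius (c : ZMod n) t ∈ T

theorem isBoundary_chord_iff (hn : 2 ≤ n) {a b : ℤ} (hab : a < b) (hb : b < a + n) :
    IsBoundary (chord (a : ZMod n) (b : ZMod n)) ↔ b = a + 1 := by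
  constructor
  · rintro ⟨i, hi⟩
    obtain ⟨c, rfl, -, -⟩ := exists_int_lift (by omega : 0 < n) i 0
    have hc : ((c : ZMod n) + 1) = ((c + 1 : ℤ) : ZMod n) := by push_cast; rfl
    rw [hc, chord_eq_chord_iff hab hb (by omega) (by omega)] at hi
    obtain ⟨k, h⟩ := hi
    omega
  · rintro rfl
    exact ⟨a, by push_cast; rfl⟩

theorem intCast_ne_of_lt {a b : ℤ} (hab : a < b) (hb : b < a + n) : (a : ZMod n) ≠ (b : ZMod n) := by
  rw [Ne, intCast_zmod_eq_iff]
  rintro ⟨k, hk⟩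
  rcases mul_modulus_cases (m := n) k with h | h | h | h | h <;> omega

theorem isArc_chord_iff (hn : 2 ≤ n) {a b : ℤ} (hab : a < b) (hb : b < a + n) :
    IsArc (chord (a : ZMod n) (b : ZMod n)) ↔ b ≠ a + 1 := by
  change _ ∧ _ ↔ _
  rw [isBoundary_chord_iff hn hab hb]
  exact and_iff_right (intCast_ne_of_lt hab hb)

theorem exists_lift_of_ne (hn : 0 < n) {i j : ZMod n} (hij : i ≠ j) (x : ℤ) :
    ∃ a b : ℤ, x ≤ a ∧ a < x + n ∧ a < b ∧ b < a + n ∧ (a : ZMod n) = i ∧ (b : ZMod n) = j := by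
  obtain ⟨a, rfl, ha1, ha2⟩ := exists_int_lift hn i x
  obtain ⟨b, rfl, hb1, hb2⟩ := exists_int_lift hn j a
  exact ⟨a, b, ha1, ha2, lt_of_le_of_ne hb1 (by rintro rfl; exact hij rfl), hb2, rfl, rfl⟩

theorem edge_succ (hn : 2 ≤ n) (a : ℤ) : Edge T a (a + 1) :=
  ⟨by omega, by omega, Or.inr ⟨a, by push_cast; rfl⟩⟩

theorem Edge.shift {a b : ℤ} (h : Edge T a b) (k : ℤ) : Edge T (a + k * n) (b + k * n) := by
  refine ⟨by have := h.1; omega, by have := h.2.1; omega, ?_⟩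
  rw [intCast_add_mul_modulus, intCast_add_mul_modulus]
  exact h.2.2

theorem Edge.add_modulus {a b : ℤ} (h : Edge T a b) : Edge T (a + n) (b + n) := by
  simpa using h.shift 1

theorem Edge.sub_modulus {a b : ℤ} (h : Edge T a b) : Edge T (a - n) (b - n) := by
  simpa [← sub_eq_add_neg] using h.shift (-1)

theorem Rad.shift {c : ℤ} {t : Bool} (h : Rad T c t) (k : ℤ) : Rad T (c + k * n) t := by
  unfold Rad
  rw [intCast_add_mul_modulus]
  exact h

theorem Rad.add_modulus {c : ℤ} {t : Bool} (h : Rad T c t) : Rad T (c + n) t := by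
  simpa using h.shift 1

theorem Rad.sub_modulus {c : ℤ} {t : Bool} (h : Rad T c t) : Rad T (c - n) t := by
  simpa [← sub_eq_add_neg] using h.shift (-1)

theorem Edge.mem_of_ne (hn : 2 ≤ n) {a b : ℤ} (h : Edge T a b) (h1 : b ≠ a + 1) :
    chord (a : ZMod n) (b : ZMod n) ∈ T := by
  rcases h.2.2 with h3 | h3
  · exact h3
  · rw [isBoundary_chord_iff hn h.1 h.2.1] at h3
    exact absurd h3 h1

theorem IsTriangulation.ne_of_chord_mem (hn : 2 ≤ n) (hT : IsTriangulation T) {i j : ZMod n}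
    (h : chord i j ∈ edges T) : i ≠ j := by
  rcases h with h | ⟨k, h⟩
  · exact (hT.1.1 _ h).1
  · obtain ⟨c, rfl, -, -⟩ := exists_int_lift (by omega : 0 < n) k 0
    rw [chord.injEq] at h
    rw [h.1, h.2]
    have := intCast_ne_of_lt (n := n) (a := c) (b := c + 1) (by omega) (by omega)
    push_cast at this
    exact this

theorem radius_mem_edges_iff {i : ZMod n} {t : Bool} : radius i t ∈ edges T ↔ radius i t ∈ T := by
  constructor
  · rintro (h | ⟨j, h⟩)
    · exact h
    · cases h
  · exact Or.inl

theorem IsTriangulation.mem_of_compatible (hT : IsTriangulation T) {x : TaggedCurve n}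
    (hx : IsArc x) (h : ∀ y ∈ T, Compatible x y) : x ∈ T := by
  refine hT.2 (y := insert x T) ⟨?_, ?_⟩ (Set.subset_insert _ _) (Set.mem_insert _ _)
  · rintro y (rfl | hy)
    · exact hx
    · exact hT.1.1 y hy
  · rintro y (rfl | hy) z (rfl | hz)
    · exact compatible_self _
    · exact h z hz
    · exact (h y hy).symm
    · exact hT.1.2 y hy z hz

theorem IsTriangulation.not_interlaced (hn : 2 ≤ n) (hT : IsTriangulation T) {a b c d : ℤ}
    (h1 : Edge T a b) (h2 : Edge T c d) (hac : a < c) (hcb : c < b) (hbd : b < d) : False := by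
  have h := hT.1.2 _ (h1.mem_of_ne hn (by omega)) _ (h2.mem_of_ne hn (by omega))
  rw [compatible_chord_chord_iff h1.1 h1.2.1 h2.1 h2.2.1] at h
  have := (h 0).1
  simp only [zero_mul, add_zero] at this
  exact this ⟨hac, hcb, hbd⟩

theorem IsTriangulation.not_covered (hn : 2 ≤ n) (hT : IsTriangulation T) {a b c : ℤ} {t : Bool}
    (h1 : Edge T a b) (h2 : Rad T c t) (hac : a < c) (hcb : c < b) : False := by
  have h := hT.1.2 _ (h1.mem_of_ne hn (by omega)) _ h2
  rw [compatible_chord_radius_iff h1.1 h1.2.1] at h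
  have := h 0
  simp only [zero_mul, add_zero] at this
  exact this ⟨hac, hcb⟩

theorem IsTriangulation.rad_compatible (hT : IsTriangulation T) {c d : ℤ} {s t : Bool}
    (h1 : Rad T c s) (h2 : Rad T d t) : (c : ZMod n) = (d : ZMod n) ∨ s = t :=
  hT.1.2 _ h1 _ h2

theorem IsTriangulation.exists_edge_of_chord_mem (hn : 2 ≤ n) (hT : IsTriangulation T)
    {i j : ZMod n} (h : chord i j ∈ edges T) (x : ℤ) :
    ∃ a b : ℤ, x ≤ a ∧ a < x + n ∧ Edge T a b ∧ i = a ∧ j = b := by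
  obtain ⟨a, b, h1, h2, h3, h4, rfl, rfl⟩ :=
    exists_lift_of_ne (by omega) (hT.ne_of_chord_mem hn h) x
  exact ⟨a, b, h1, h2, ⟨h3, h4, h⟩, rfl, rfl⟩

theorem IsTriangulation.edge_of_not_interlaced (hn : 2 ≤ n) (hT : IsTriangulation T) {a b : ℤ}
    (hab : a < b) (hb : b < a + n)
    (h1 : ∀ c d, Edge T c d → ¬ (a < c ∧ c < b ∧ b < d) ∧ ¬ (c < a ∧ a < d ∧ d < b))
    (h2 : ∀ c t, Rad T c t → ¬ (a < c ∧ c < b)) : Edge T a b := by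
  refine ⟨hab, hb, ?_⟩
  by_cases hB : IsBoundary (chord (a : ZMod n) (b : ZMod n))
  · exact Or.inr hB
  left
  refine hT.mem_of_compatible ⟨intCast_ne_of_lt hab hb, hB⟩ ?_
  rintro (⟨i, j⟩ | ⟨i, t⟩) hy
  · obtain ⟨c, d, -, -, hcd, rfl, rfl⟩ := hT.exists_edge_of_chord_mem hn (Or.inl hy) 0
    rw [compatible_chord_chord_iff hab hb hcd.1 hcd.2.1]
    exact fun k => h1 _ _ (hcd.shift k)
  · obtain ⟨c, rfl, -, -⟩ := exists_int_lift (by omega : 0 < n) i 0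
    rw [compatible_chord_radius_iff hab hb]
    exact fun k => h2 _ _ (Rad.shift hy k)

theorem IsTriangulation.rad_of_not_covered (hn : 2 ≤ n) (hT : IsTriangulation T) {c : ℤ} {t : Bool}
    (h1 : ∀ a b, Edge T a b → ¬ (a < c ∧ c < b))
    (h2 : ∀ d s, Rad T d s → (c : ZMod n) = (d : ZMod n) ∨ t = s) : Rad T c t := by
  refine hT.mem_of_compatible trivial ?_
  rintro (⟨i, j⟩ | ⟨i, s⟩) hy
  · obtain ⟨a, b, -, -, hab, rfl, rfl⟩ := hT.exists_edge_of_chord_mem hn (Or.inl hy) 0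
    apply Compatible.symm
    rw [compatible_chord_radius_iff hab.1 hab.2.1]
    intro k hk
    refine h1 _ _ (hab.shift (-k)) ?_
    have hkl : -k * n = -(k * n) := by ring
    omega
  · obtain ⟨d, rfl, -, -⟩ := exists_int_lift (by omega : 0 < n) i 0
    exact h2 d s hy

/-- On the side away from the puncture, a chord that is not a boundary segment bounds a triangle. -/
theorem IsTriangulation.exists_triangle (hn : 2 ≤ n) (hT : IsTriangulation T) {a b : ℤ}
    (h : Edge T a b) (hab : a + 1 < b) : ∃ c, a < c ∧ c < b ∧ Edge T a c ∧ Edge T c b := by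
  obtain ⟨c, ⟨h1, h2, h3⟩, hmax⟩ :=
    Int.exists_greatest_of_bdd (P := fun c => a < c ∧ c < b ∧ Edge T a c) ⟨b, fun z hz => by omega⟩
      ⟨a + 1, by omega, hab, edge_succ hn a⟩
  refine ⟨c, h1, h2, h3, hT.edge_of_not_interlaced hn h2 (by have := h.2.1; omega) ?_ ?_⟩
  · refine fun x y hxy => ⟨fun ⟨h4, h5, h6⟩ => hT.not_interlaced hn h hxy (by omega) h5 h6,
      fun ⟨h4, h5, h6⟩ => ?_⟩
    rcases lt_trichotomy x a with h7 | rfl | h7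
    · exact hT.not_interlaced hn hxy h h7 (by omega) h6
    · have := hmax y ⟨by omega, h6, hxy⟩
      omega
    · exact hT.not_interlaced hn h3 hxy h7 h4 h5
  · exact fun x t hx h4 => hT.not_covered hn h hx (by omega) h4.2

/-- If both versions of a radius belong to `T`, then this radius lies inside a once-punctured digon
of `T`: the loop around the puncture at its endpoint bounds a triangle. -/
theorem IsTriangulation.exists_digon (hn : 2 ≤ n) (hT : IsTriangulation T) {i : ℤ} {t : Bool}
    (h : Rad T i t) (h' : Rad T i (!t)) : ∃ j, Edge T i j ∧ Edge T j (i + n) := by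
  obtain ⟨j, ⟨h1, h2, h3⟩, hmax⟩ :=
    Int.exists_greatest_of_bdd (P := fun j => i < j ∧ j < i + n ∧ Edge T i j)
      ⟨i + n, fun z hz => by omega⟩ ⟨i + 1, by omega, by omega, edge_succ hn i⟩
  refine ⟨j, h3, hT.edge_of_not_interlaced hn h2 (by omega) ?_ ?_⟩
  · refine fun x y hxy => ⟨fun ⟨h4, h5, h6⟩ => hT.not_covered hn hxy h.add_modulus h5 h6,
      fun ⟨h4, h5, h6⟩ => ?_⟩
    rcases lt_trichotomy x i with h7 | rfl | h7
    · exact hT.not_covered hn hxy h h7 (by omega)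
    · have := hmax y ⟨by omega, h6, hxy⟩
      omega
    · exact hT.not_interlaced hn h3 hxy h7 h4 h5
  · rintro x s hx ⟨h4, h5⟩
    have hne := intCast_ne_of_lt (n := n) (a := i) (b := x) (by omega) h5
    have e1 := (hT.rad_compatible h hx).resolve_left hne
    have e2 := (hT.rad_compatible h' hx).resolve_left hne
    rw [← e1] at e2
    cases t <;> cases e2

/-- Every tagged triangulation contains a radius, as the ends of a longest chord lie under no chord.
-/
theorem IsTriangulation.exists_rad (hn : 2 ≤ n) (hT : IsTriangulation T) : ∃ c t, Rad T c t := by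
  obtain ⟨L, ⟨a, b, hab, hL⟩, hmax⟩ := Int.exists_greatest_of_bdd
    (P := fun L => ∃ a b : ℤ, Edge T a b ∧ b - a = L)
    ⟨n, by rintro z ⟨a, b, h1, h2⟩; have := h1.2.1; omega⟩ ⟨1, 0, 0 + 1, edge_succ hn 0, by omega⟩
  by_contra! hno
  refine hno a true (hT.rad_of_not_covered hn ?_ fun d s h => (hno d s h).elim)
  rintro x y hxy ⟨h1, h2⟩
  rcases lt_or_ge y b with h3 | h3
  · exact hT.not_interlaced hn hxy hab h1 h2 h3
  · have := hmax _ ⟨x, y, hxy, rfl⟩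
    omega

/-- A radius of `T` occurs with both tags, or else there is a radius with a different endpoint and
all radii have the same tag. -/
theorem IsTriangulation.rad_alternative (hn : 2 ≤ n) (hT : IsTriangulation T) {i : ℤ} {t : Bool}
    (h : Rad T i t) : Rad T i (!t) ∨
      (∃ j, i < j ∧ j < i + n ∧ Rad T j t) ∧ ∀ c s, Rad T c s → s = t := by
  by_cases h' : Rad T i (!t)
  · exact Or.inl h'
  right
  have htag : ∀ c s, Rad T c s → s = t := by
    intro c s hc
    rcases hT.rad_compatible h hc with h1 | h1
    · by_contra hst
      apply h'
      unfold Rad at hc ⊢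
      rw [h1, show (!t) = s by cases s <;> cases t <;> simp_all]
      exact hc
    · exact h1.symm
  refine ⟨?_, htag⟩
  by_contra! hno
  refine h' (hT.rad_of_not_covered hn (fun a b hab hc => hT.not_covered hn hab h hc.1 hc.2) ?_)
  intro d s hd
  left
  obtain rfl := htag d s hd
  obtain ⟨x, hx, h1, h2⟩ := exists_int_lift (by omega : 0 < n) (d : ZMod n) i
  rcases h1.eq_or_lt with rfl | h1
  · exact hx
  · refine (hno x h1 h2 ?_).elim
    unfold Rad
    rw [hx]
    exact hd

/-! ### Digons and adjacency -/

theorem hasDigon_iff (hn : 2 ≤ n) {a : ℤ} {q : ZMod n} :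
    HasDigon T (a : ZMod n) q ↔ ∃ b : ℤ, q = b ∧ Edge T a b ∧ Edge T b (a + n) := by
  constructor
  · rintro ⟨hne, h1, h2⟩
    obtain ⟨b, rfl, hb1, hb2⟩ := exists_int_lift (by omega : 0 < n) q a
    have hab : a < b := lt_of_le_of_ne hb1 (by rintro rfl; exact hne rfl)
    refine ⟨b, rfl, ⟨hab, hb2, h1⟩, hb2, by omega, ?_⟩
    rw [intCast_add_modulus]
    exact h2
  · rintro ⟨b, rfl, h1, h2⟩
    have h3 := h2.2.2
    rw [intCast_add_modulus] at h3
    exact ⟨intCast_ne_of_lt h1.1 h1.2.1, h1.2.2, h3⟩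

theorem HasDigon.symm {p q : ZMod n} (h : HasDigon T p q) : HasDigon T q p :=
  ⟨h.1.symm, h.2.2, h.2.1⟩

theorem mem_digonRadii_iff {p q i : ZMod n} {t : Bool} :
    radius i t ∈ digonRadii p q ↔ i = p ∨ i = q := by
  constructor
  · rintro ⟨s, h | h⟩ <;> cases h
    · exact Or.inl rfl
    · exact Or.inr rfl
  · rintro (rfl | rfl)
    · exact ⟨t, Or.inl rfl⟩
    · exact ⟨t, Or.inr rfl⟩

theorem chord_notMem_digonRadii {p q i j : ZMod n} : chord i j ∉ digonRadii p q := by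
  rintro ⟨s, h | h⟩ <;> cases h

/-- The edges adjacent to a chord: the sides of the triangles on its two sides, or, towards the
puncture, the sides of a once-punctured digon and the two versions of the radius subdividing it. -/
theorem mem_quadrilateral_chord_iff (hn : 2 ≤ n) {a b : ℤ}
    (hab : Edge T a b) (x : TaggedCurve n) :
    x ∈ quadrilateral T (chord (a : ZMod n) (b : ZMod n)) ↔
      (∃ c : ℤ, Edge T a c ∧ Edge T c b ∧ (x = chord ↑a ↑c ∨ x = chord ↑c ↑b)) ∨
      (∃ d : ℤ, Edge T a d ∧ Edge T b d ∧ (x = chord ↑a ↑d ∨ x = chord ↑b ↑d)) ∨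
      (∃ d : ℤ, Edge T d a ∧ Edge T d b ∧ (x = chord ↑d ↑a ∨ x = chord ↑d ↑b)) ∨
      (∃ t, Rad T a t ∧ Rad T b t ∧ (x = radius ↑a t ∨ x = radius ↑b t)) ∨
      (Edge T b (a + n) ∧ ∃ i : ℤ, (i = a ∨ i = b) ∧ (∀ t, Rad T i t) ∧
        (x = chord ↑b ↑a ∨ x = radius ↑i false ∨ x = radius ↑i true)) := by
  have hgen : ∀ {p q : ℤ}, p < q → q < p + n → chord (p : ZMod n) (q : ZMod n) =
      chord (a : ZMod n) (b : ZMod n) → ∃ k : ℤ, a = p + k * n ∧ b = q + k * n :=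
    fun h1 h2 h3 => (chord_eq_chord_iff h1 h2 hab.1 hab.2.1).1 h3
  constructor
  · rintro (⟨hx, hne, hadj, -⟩ | ⟨i, j, -, h, -⟩)
    · rcases hadj with ⟨Δ, ⟨hΔ, hform⟩, h1, h2⟩ | ⟨i, j, hd, hr, h1, h2⟩
      · rcases hform with ⟨p, q, r, hpq, hqr, hr, rfl⟩ | ⟨i, j, t, hij, rfl⟩
        · have epq : Edge T p q := ⟨hpq, by omega, hΔ (by simp)⟩
          have eqr : Edge T q r := ⟨hqr, by omega, hΔ (by simp)⟩
          have epr : Edge T p r := ⟨by omega, hr, hΔ (by simp)⟩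
          simp only [Set.mem_insert_iff, Set.mem_singleton_iff] at h1 h2
          rcases h1 with h1 | h1 | h1
          · obtain ⟨k, rfl, rfl⟩ := hgen epq.1 epq.2.1 h1.symm
            right; left
            refine ⟨r + k * n, epr.shift k, eqr.shift k, ?_⟩
            simp only [intCast_add_mul_modulus] at hne h1 ⊢
            rcases h2 with h2 | h2 | h2
            · exact absurd h2.symm hne
            · exact Or.inr h2
            · exact Or.inl h2
          · obtain ⟨k, rfl, rfl⟩ := hgen eqr.1 eqr.2.1 h1.symm
            right; right; left
            refine ⟨p + k * n, epq.shift k, epr.shift k, ?_⟩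
            simp only [intCast_add_mul_modulus] at hne h1 ⊢
            rcases h2 with h2 | h2 | h2
            · exact Or.inl h2
            · exact absurd h2.symm hne
            · exact Or.inr h2
          · obtain ⟨k, rfl, rfl⟩ := hgen epr.1 epr.2.1 h1.symm
            left
            refine ⟨q + k * n, epq.shift k, eqr.shift k, ?_⟩
            simp only [intCast_add_mul_modulus] at hne h1 ⊢
            rcases h2 with h2 | h2 | h2
            · exact Or.inl h2
            · exact Or.inr h2
            · exact absurd h2.symm hne
        · right; right; right; left
          simp only [Set.mem_insert_iff, Set.mem_singleton_iff, reduceCtorEq, or_false] at h1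
          rw [chord.injEq] at h1
          obtain ⟨rfl, rfl⟩ := h1
          refine ⟨t, radius_mem_edges_iff.1 (hΔ (by simp)), radius_mem_edges_iff.1 (hΔ (by simp)), ?_⟩
          rcases h2 with h2 | h2 | h2
          · exact absurd h2.symm hne
          · exact Or.inl h2
          · exact Or.inr h2
      · right; right; right; right
        simp only [Set.mem_insert_iff, Set.mem_singleton_iff, reduceCtorEq, or_false,
          chord.injEq] at h1
        rcases h1 with ⟨rfl, rfl⟩ | ⟨rfl, rfl⟩
        · refine ⟨⟨hab.2.1, by have := hab.1; omega, ?_⟩, a, Or.inl rfl, hr, ?_⟩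
          · rw [intCast_add_modulus]; exact hd.2.2
          · rcases h2 with h2 | h2 | h2
            · exact absurd h2.symm hne
            · exact Or.inl h2
            · exact Or.inr h2
        · refine ⟨⟨hab.2.1, by have := hab.1; omega, ?_⟩, b, Or.inr rfl, hr, ?_⟩
          · rw [intCast_add_modulus]; exact hd.2.1
          · rcases h2 with h2 | h2 | h2
            · exact Or.inl h2
            · exact absurd h2.symm hne
            · exact Or.inr h2
    · exact (chord_notMem_digonRadii h).elim
  · have hnd : ∀ y, ¬ ∃ i j : ZMod n, HasDigon T i j ∧ chord (a : ZMod n) (b : ZMod n) ∈ digonRadii i j ∧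
        y ∈ digonRadii i j := fun y ⟨_, _, _, h, _⟩ => chord_notMem_digonRadii h
    have hne : ∀ {p q : ℤ}, p < q → q < p + n → (¬ ∃ k : ℤ, a = p + k * n ∧ b = q + k * n) →
        chord (a : ZMod n) (b : ZMod n) ≠ chord (p : ZMod n) (q : ZMod n) :=
      fun h1 h2 h3 h4 => h3 (hgen h1 h2 h4.symm)
    have tri : ∀ {p q r : ℤ}, Edge T p q → Edge T q r → Edge T p r →
        ({chord (p : ZMod n) (q : ZMod n), chord (q : ZMod n) (r : ZMod n),
          chord (p : ZMod n) (r : ZMod n)} : Set (TaggedCurve n)) ∈ triangles T := by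
      intro p q r h1 h2 h3
      refine ⟨?_, Or.inl ⟨p, q, r, h1.1, h2.1, h3.2.1, rfl⟩⟩
      rintro y (rfl | rfl | rfl)
      · exact h1.2.2
      · exact h2.2.2
      · exact h3.2.2
    have tri' : ∀ {t : Bool}, (a : ZMod n) ≠ (b : ZMod n) → Rad T a t → Rad T b t →
        ({chord (a : ZMod n) (b : ZMod n), radius (a : ZMod n) t, radius (b : ZMod n) t} :
          Set (TaggedCurve n)) ∈ triangles T := by
      intro t hij h1 h2
      refine ⟨?_, Or.inr ⟨_, _, t, hij, rfl⟩⟩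
      rintro y (rfl | rfl | rfl)
      · exact hab.2.2
      · exact Or.inl h1
      · exact Or.inl h2
    rintro (⟨c, h1, h2, rfl | rfl⟩ | ⟨d, h1, h2, rfl | rfl⟩ | ⟨d, h1, h2, rfl | rfl⟩ |
      ⟨t, h1, h2, rfl | rfl⟩ | ⟨h1, i, hi, hr, rfl | hx⟩)
    · have := h2.1
      exact Or.inl ⟨h1.2.2, hne h1.1 h1.2.1 (by rintro ⟨k, h3, h4⟩; omega),
        Or.inl ⟨_, tri h1 h2 hab, by simp, by simp⟩, hnd _⟩
    · have := h1.1
      exact Or.inl ⟨h2.2.2, hne h2.1 h2.2.1 (by rintro ⟨k, h3, h4⟩; omega),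
        Or.inl ⟨_, tri h1 h2 hab, by simp, by simp⟩, hnd _⟩
    · have := h2.1
      exact Or.inl ⟨h1.2.2, hne h1.1 h1.2.1 (by rintro ⟨k, h3, h4⟩; omega),
        Or.inl ⟨_, tri hab h2 h1, by simp, by simp⟩, hnd _⟩
    · refine Or.inl ⟨h2.2.2, hne h2.1 h2.2.1 ?_, Or.inl ⟨_, tri hab h2 h1, by simp, by simp⟩, hnd _⟩
      rintro ⟨k, h3, h4⟩
      have h5 := hab.1
      have h6 := h1.2.1
      rcases mul_modulus_cases (m := n) k with h | h | h | h | h <;> omega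
    · refine Or.inl ⟨h1.2.2, hne h1.1 h1.2.1 ?_, Or.inl ⟨_, tri h1 hab h2, by simp, by simp⟩, hnd _⟩
      rintro ⟨k, h3, h4⟩
      have h5 := hab.1
      have h6 := h2.2.1
      rcases mul_modulus_cases (m := n) k with h | h | h | h | h <;> omega
    · have := h1.1
      exact Or.inl ⟨h2.2.2, hne h2.1 h2.2.1 (by rintro ⟨k, h3, h4⟩; omega),
        Or.inl ⟨_, tri h1 hab h2, by simp, by simp⟩, hnd _⟩
    all_goals
      have hij := intCast_ne_of_lt hab.1 hab.2.1
    · exact Or.inl ⟨Or.inl h1, by simp, Or.inl ⟨_, tri' hij h1 h2, by simp, by simp⟩, hnd _⟩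
    · exact Or.inl ⟨Or.inl h2, by simp, Or.inl ⟨_, tri' hij h1 h2, by simp, by simp⟩, hnd _⟩
    all_goals
      have hd : HasDigon T (a : ZMod n) (b : ZMod n) := (hasDigon_iff hn).2 ⟨b, rfl, hab, h1⟩
    · refine Or.inl ⟨hd.2.2, ?_, Or.inr ?_, hnd _⟩
      · rw [Ne, chord.injEq]; exact fun h => hij h.1
      · rcases hi with rfl | rfl
        · exact ⟨_, _, hd, hr, by simp, by simp⟩
        · exact ⟨_, _, hd.symm, hr, by simp, by simp⟩
    · refine Or.inl ⟨?_, ?_, Or.inr ?_, hnd _⟩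
      · rcases hx with rfl | rfl
        · exact Or.inl (hr false)
        · exact Or.inl (hr true)
      · rcases hx with rfl | rfl <;> simp
      · rcases hi with rfl | rfl
        · exact ⟨_, _, hd, hr, by simp, Or.inr (Or.inr hx)⟩
        · exact ⟨_, _, hd.symm, hr, by simp, Or.inr (Or.inr hx)⟩

end PuncturedPolygon

namespace PuncturedPolygon

open TaggedCurve

variable {n : ℕ} {T : Set (TaggedCurve n)}

/-! ### The shapes of quadrilaterals in the once-punctured polygon -/

/-- The quadrilateral with four vertices `a < b < c < d`, with the puncture behind its side from `a`
to `d`. -/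
def outerQuad (n : ℕ) (a b c d : ℤ) : Set (TaggedCurve n) :=
  {chord a b, chord b c, chord c d, chord a d}

/-- The quadrilateral with the three vertices `a < b < c` and the puncture as its corners. -/
def innerQuad (n : ℕ) (a b c : ℤ) (t : Bool) : Set (TaggedCurve n) :=
  {chord a b, chord b c, radius a t, radius c t}

/-- The once-punctured triangle with vertices `a < b < c`, with both versions of the radius at `a`.
-/
def loopQuad (n : ℕ) (a b c : ℤ) : Set (TaggedCurve n) :=
  {chord a b, chord b c, chord c a, radius a false, radius a true}

/-- The once-punctured digon with vertices `a` and `b`, with two radii of different tags. -/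
def digonQuad (n : ℕ) (a b : ℤ) : Set (TaggedCurve n) :=
  {chord a b, chord b a, radius a true, radius b false}

theorem IsTriangulation.not_rad_of_forall_rad (hT : IsTriangulation T) {a b : ℤ} {t : Bool}
    (hne : (a : ZMod n) ≠ b) (ha : ∀ s, Rad T a s) (hb : Rad T b t) : False := by
  have h1 := (hT.rad_compatible (ha true) hb).resolve_left hne
  have h2 := (hT.rad_compatible (ha false) hb).resolve_left hne
  rw [← h1] at h2
  cases h2

/-- A chord bounds at most one triangle on the side away from the puncture. -/
theorem IsTriangulation.inner_unique (hn : 2 ≤ n) (hT : IsTriangulation T) {a b c c' : ℤ}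
    (h1 : Edge T a c) (h2 : Edge T c b) (h3 : Edge T a c') (h4 : Edge T c' b) : c = c' := by
  have := h1.1
  have := h2.1
  have := h3.1
  have := h4.1
  rcases lt_trichotomy c c' with h | h | h
  · exact (hT.not_interlaced hn h3 h2 (by omega) h (by omega)).elim
  · exact h
  · exact (hT.not_interlaced hn h1 h4 (by omega) h (by omega)).elim

theorem IsTriangulation.quadrilateral_eq_outerQuad_right (hn : 2 ≤ n) (hT : IsTriangulation T)
    {a b c d : ℤ} (hab : Edge T a b) (hbc : Edge T b c) (hac : Edge T a c) (hcd : Edge T c d)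
    (had : Edge T a d) :
    quadrilateral T (chord (a : ZMod n) (c : ZMod n)) = outerQuad n a b c d := by
  have h1 := hab.1
  have h2 := hbc.1
  have h3 := hcd.1
  have h4 := had.2.1
  ext x
  rw [mem_quadrilateral_chord_iff hn hac]
  constructor
  · rintro (⟨c', h5, h6, hx⟩ | ⟨d', h5, h6, hx⟩ | ⟨d', h5, h6, -⟩ | ⟨t, -, h6, -⟩ | ⟨h5, i, hi, hr, -⟩)
    · obtain rfl := hT.inner_unique hn hab hbc h5 h6
      exact hx.elim Or.inl fun h => Or.inr (Or.inl h)
    · have h7 := h6.1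
      rcases lt_trichotomy d d' with h | rfl | h
      · exact (hT.not_interlaced hn had h6 (by omega) h3 h).elim
      · exact Or.inr (Or.inr hx.symm)
      · exact (hT.not_interlaced hn h5 hcd (by omega) h7 h).elim
    · exact (hT.not_interlaced hn h6 had h5.1 (by omega) h3).elim
    · exact (hT.not_covered hn had h6 (by omega) h3).elim
    · exact (hT.not_interlaced hn had h5 (by omega) h3 h4).elim
  · rintro (rfl | rfl | rfl | rfl)
    · exact Or.inl ⟨b, hab, hbc, Or.inl rfl⟩
    · exact Or.inl ⟨b, hab, hbc, Or.inr rfl⟩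
    · exact Or.inr (Or.inl ⟨d, had, hcd, Or.inr rfl⟩)
    · exact Or.inr (Or.inl ⟨d, had, hcd, Or.inl rfl⟩)

theorem IsTriangulation.quadrilateral_eq_outerQuad_left (hn : 2 ≤ n) (hT : IsTriangulation T)
    {a b c d : ℤ} (hbc : Edge T b c) (hcd : Edge T c d) (hbd : Edge T b d) (hab : Edge T a b)
    (had : Edge T a d) :
    quadrilateral T (chord (b : ZMod n) (d : ZMod n)) = outerQuad n a b c d := by
  have h1 := hab.1
  have h2 := hbc.1
  have h3 := hcd.1
  have h4 := had.2.1
  ext x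
  rw [mem_quadrilateral_chord_iff hn hbd]
  constructor
  · rintro (⟨c', h5, h6, hx⟩ | ⟨d', h5, h6, -⟩ | ⟨a', h5, h6, hx⟩ | ⟨t, h6, -, -⟩ | ⟨h5, i, hi, hr, -⟩)
    · obtain rfl := hT.inner_unique hn hbc hcd h5 h6
      exact hx.elim (fun h => Or.inr (Or.inl h)) fun h => Or.inr (Or.inr (Or.inl h))
    · exact (hT.not_interlaced hn had h5 h1 (by omega) h6.1).elim
    · have h7 := h5.1
      rcases lt_trichotomy a a' with h | rfl | h
      · exact (hT.not_interlaced hn hab h6 h h7 (by omega)).elim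
      · exact hx.elim Or.inl fun h => Or.inr (Or.inr (Or.inr h))
      · exact (hT.not_interlaced hn h5 had h h1 (by omega)).elim
    · exact (hT.not_covered hn had h6 h1 (by omega)).elim
    · exact (hT.not_interlaced hn h5 had.add_modulus (by omega) (by omega) (by omega)).elim
  · rintro (rfl | rfl | rfl | rfl)
    · exact Or.inr (Or.inr (Or.inl ⟨a, hab, had, Or.inl rfl⟩))
    · exact Or.inl ⟨c, hbc, hcd, Or.inl rfl⟩
    · exact Or.inl ⟨c, hbc, hcd, Or.inr rfl⟩
    · exact Or.inr (Or.inr (Or.inl ⟨a, hab, had, Or.inr rfl⟩))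

theorem IsTriangulation.quadrilateral_eq_innerQuad (hn : 2 ≤ n) (hT : IsTriangulation T)
    {a b c : ℤ} {t : Bool} (hab : Edge T a b) (hbc : Edge T b c) (hac : Edge T a c)
    (ha : Rad T a t) (hc : Rad T c t) :
    quadrilateral T (chord (a : ZMod n) (c : ZMod n)) = innerQuad n a b c t := by
  have h1 := hab.1
  have h2 := hbc.1
  have hne := intCast_ne_of_lt hac.1 hac.2.1
  ext x
  rw [mem_quadrilateral_chord_iff hn hac]
  constructor
  · rintro (⟨b', h5, h6, hx⟩ | ⟨d', h5, h6, -⟩ | ⟨d', h5, h6, -⟩ | ⟨s, h5, h6, hx⟩ | ⟨h5, i, hi, hr, -⟩)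
    · obtain rfl := hT.inner_unique hn hab hbc h5 h6
      exact hx.elim Or.inl fun h => Or.inr (Or.inl h)
    · exact (hT.not_covered hn h5 hc (by omega) h6.1).elim
    · exact (hT.not_covered hn h6 ha h5.1 (by omega)).elim
    · obtain rfl := (hT.rad_compatible ha h6).resolve_left hne
      exact Or.inr (Or.inr hx)
    · rcases hi with rfl | rfl
      · exact (hT.not_rad_of_forall_rad hne hr hc).elim
      · exact (hT.not_rad_of_forall_rad hne.symm hr ha).elim
  · rintro (rfl | rfl | rfl | rfl)
    · exact Or.inl ⟨b, hab, hbc, Or.inl rfl⟩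
    · exact Or.inl ⟨b, hab, hbc, Or.inr rfl⟩
    · exact Or.inr (Or.inr (Or.inr (Or.inl ⟨t, ha, hc, Or.inl rfl⟩)))
    · exact Or.inr (Or.inr (Or.inr (Or.inl ⟨t, ha, hc, Or.inr rfl⟩)))

/-- The members of the quadrilateral of a chord that is a side of a once-punctured digon subdivided
by both versions of a radius. -/
theorem IsTriangulation.mem_quadrilateral_side_of_digon (hn : 2 ≤ n) (hT : IsTriangulation T)
    {a b c i : ℤ} (hab : Edge T a b) (hbc : Edge T b c) (hac : Edge T a c)
    (hca : Edge T c (a + n)) (hi : i = a ∨ i = c) (hr : ∀ t, Rad T i t) (x : TaggedCurve n) :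
    x ∈ quadrilateral T (chord (a : ZMod n) (c : ZMod n)) ↔ x = chord ↑a ↑b ∨ x = chord ↑b ↑c ∨
      x = chord ↑c ↑a ∨ x = radius ↑i false ∨ x = radius ↑i true := by
  have h1 := hab.1
  have h2 := hbc.1
  have hne := intCast_ne_of_lt hac.1 hac.2.1
  rw [mem_quadrilateral_chord_iff hn hac]
  constructor
  · rintro (⟨b', h5, h6, hx⟩ | ⟨d', h5, h6, -⟩ | ⟨d', h5, h6, -⟩ | ⟨s, h5, h6, hx⟩ | ⟨-, j, hj, hr', hx⟩)
    · obtain rfl := hT.inner_unique hn hab hbc h5 h6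
      exact hx.elim Or.inl fun h => Or.inr (Or.inl h)
    · exact (hT.not_interlaced hn h5 hca (by omega) h6.1 h5.2.1).elim
    · exact (hT.not_interlaced hn hca h6.add_modulus (by have := h6.2.1; omega)
        (by have := h5.1; omega) (by omega)).elim
    · rcases hi with rfl | rfl
      · exact (hT.not_rad_of_forall_rad hne hr h6).elim
      · exact (hT.not_rad_of_forall_rad hne.symm hr h5).elim
    · obtain rfl : j = i := by
        rcases hi with rfl | rfl <;> rcases hj with rfl | rfl
        · rfl
        · exact (hT.not_rad_of_forall_rad hne hr (hr' true)).elim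
        · exact (hT.not_rad_of_forall_rad hne hr' (hr true)).elim
        · rfl
      exact Or.inr (Or.inr hx)
  · rintro (rfl | rfl | hx)
    · exact Or.inl ⟨b, hab, hbc, Or.inl rfl⟩
    · exact Or.inl ⟨b, hab, hbc, Or.inr rfl⟩
    · exact Or.inr (Or.inr (Or.inr (Or.inr ⟨hca, i, hi, hr, hx⟩)))

theorem IsTriangulation.quadrilateral_eq_loopQuad (hn : 2 ≤ n) (hT : IsTriangulation T)
    {a b c : ℤ} (hab : Edge T a b) (hbc : Edge T b c) (hac : Edge T a c) (hca : Edge T c (a + n))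
    (hr : ∀ t, Rad T a t) :
    quadrilateral T (chord (a : ZMod n) (c : ZMod n)) = loopQuad n a b c := by
  ext x
  exact hT.mem_quadrilateral_side_of_digon hn hab hbc hac hca (Or.inl rfl) hr x

theorem IsTriangulation.quadrilateral_eq_loopQuad' (hn : 2 ≤ n) (hT : IsTriangulation T)
    {a b c : ℤ} (hab : Edge T a b) (hbc : Edge T b c) (hac : Edge T a c) (hca : Edge T c (a + n))
    (hr : ∀ t, Rad T c t) :
    quadrilateral T (chord (a : ZMod n) (c : ZMod n)) = loopQuad n c (a + n) (b + n) := by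
  ext x
  rw [hT.mem_quadrilateral_side_of_digon hn hab hbc hac hca (Or.inr rfl) hr x]
  unfold loopQuad
  rw [intCast_add_modulus, intCast_add_modulus]
  simp only [Set.mem_insert_iff, Set.mem_singleton_iff]
  tauto

/-- The possible quadrilaterals of a chord. The chord lies under a shortest longer chord, whose
triangle then has the given chord as a side, or else its ends see the puncture. -/
theorem IsTriangulation.quadrilateral_chord (hn : 2 ≤ n) (hT : IsTriangulation T) {a c : ℤ}
    (hac : Edge T a c) (hac' : a + 1 < c) :
    (∃ p q r s : ℤ, p < q ∧ q < r ∧ r < s ∧ s < p + n ∧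
      quadrilateral T (chord (a : ZMod n) (c : ZMod n)) = outerQuad n p q r s) ∨
    (∃ p q r : ℤ, p < q ∧ q < r ∧ r < p + n ∧
      quadrilateral T (chord (a : ZMod n) (c : ZMod n)) = loopQuad n p q r) ∨
    ∃ (b : ℤ) (t : Bool), a < b ∧ b < c ∧ Rad T a t ∧ Rad T c t ∧
      quadrilateral T (chord (a : ZMod n) (c : ZMod n)) = innerQuad n a b c t := by
  obtain ⟨b, h1, h2, hab, hbc⟩ := hT.exists_triangle hn hac hac'
  have hne := intCast_ne_of_lt hac.1 hac.2.1
  by_cases hcov : ∃ x y : ℤ, Edge T x y ∧ x ≤ a ∧ c ≤ y ∧ ¬ (x = a ∧ y = c)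
  · -- a shortest chord above the given one
    obtain ⟨L, ⟨x, y, hxy, hxa, hcy, hne', hL⟩, hmin⟩ := Int.exists_least_of_bdd
      (P := fun L => ∃ x y : ℤ, Edge T x y ∧ x ≤ a ∧ c ≤ y ∧ ¬ (x = a ∧ y = c) ∧ y - x = L)
      ⟨0, by rintro z ⟨x, y, h, -, -, -, h'⟩; have := h.1; omega⟩
      (by obtain ⟨x, y, h⟩ := hcov; exact ⟨_, x, y, h.1, h.2.1, h.2.2.1, h.2.2.2, rfl⟩)
    obtain ⟨z, hz1, hz2, hxz, hzy⟩ := hT.exists_triangle hn hxy (by omega)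
    have hz : z ≤ a ∨ c ≤ z := by
      by_contra! h
      rcases hxa.eq_or_lt with rfl | h3
      · exact hT.not_interlaced hn hac hzy h.1 h.2 (by omega)
      · exact hT.not_interlaced hn hxz hac h3 h.1 h.2
    left
    rcases hz with hz | hz
    · have heq : z = a ∧ y = c := by
        by_contra h
        have := hmin _ ⟨z, y, hzy, hz, hcy, h, rfl⟩
        omega
      obtain ⟨rfl, rfl⟩ := heq
      exact ⟨x, z, b, y, hz1, h1, h2, hxy.2.1,
        hT.quadrilateral_eq_outerQuad_left hn hab hbc hac hxz hxy⟩
    · have heq : x = a ∧ z = c := by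
        by_contra h
        have := hmin _ ⟨x, z, hxz, hxa, hz, h, rfl⟩
        omega
      obtain ⟨rfl, rfl⟩ := heq
      exact ⟨x, b, z, y, h1, h2, hz2, hxy.2.1,
        hT.quadrilateral_eq_outerQuad_right hn hab hbc hac hzy hxy⟩
  · push Not at hcov
    have seen_a : ∀ x y, Edge T x y → ¬ (x < a ∧ a < y) := by
      rintro x y hxy ⟨h3, h4⟩
      rcases lt_or_ge y c with h5 | h5
      · exact hT.not_interlaced hn hxy hac h3 h4 h5
      · have := hcov x y hxy (by omega) h5
        omega
    have seen_c : ∀ x y, Edge T x y → ¬ (x < c ∧ c < y) := by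
      rintro x y hxy ⟨h3, h4⟩
      rcases lt_or_ge a x with h5 | h5
      · exact hT.not_interlaced hn hac hxy h5 h3 h4
      · have := hcov x y hxy h5 (by omega)
        omega
    right
    obtain ⟨i, t, hi⟩ := hT.exists_rad hn
    rcases hT.rad_alternative hn hi with hi' | ⟨-, htag⟩
    · left
      have hall : ∀ s, Rad T i s := by
        intro s
        rcases Bool.eq_or_eq_not s t with rfl | rfl
        · exact hi
        · exact hi'
      -- the digon around the puncture has the given chord as a side
      obtain ⟨j, hj, hj1, hj2⟩ := exists_int_lift (by omega : 0 < n) (i : ZMod n) a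
      have hall' : ∀ s, Rad T j s := by
        intro s
        unfold Rad
        rw [hj]
        exact hall s
      obtain ⟨k, hjk, hkj⟩ := hT.exists_digon hn (hall' true) (hall' false)
      have hk1 := hjk.1
      have hk2 := hkj.1
      rcases hj1.eq_or_lt with rfl | hj1
      · have hk3 : c ≤ k := by
          by_contra! h
          exact hT.not_interlaced hn hac hkj hk1 h hac.2.1
        obtain rfl := (hcov _ k hjk le_rfl hk3).2
        exact ⟨_, b, k, h1, h2, hac.2.1, hT.quadrilateral_eq_loopQuad hn hab hbc hac hkj hall'⟩
      · have hjc : c ≤ j := by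
          by_contra! h
          exact hT.not_covered hn hac (hall' true) hj1 h
        have hkn : k ≤ a + n ∨ c + n ≤ k := by
          by_contra! h
          exact hT.not_interlaced hn hjk hac.add_modulus (by omega) h.1 h.2
        rcases hkn with hkn | hkn
        · have h3 := hkj.sub_modulus
          rw [add_sub_cancel_right] at h3
          obtain ⟨rfl, rfl⟩ := hcov _ j h3 (by omega) hjc
          have h6 : Edge T j (k - n + n) := by rwa [sub_add_cancel]
          exact ⟨_, _, _, h6.1, by omega, by have := hac.1; omega,
            hT.quadrilateral_eq_loopQuad' hn hab hbc hac h6 hall'⟩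
        · exfalso
          have h3 := hjk.sub_modulus
          have h4 := hcov (j - n) (k - n) h3 (by omega) (by omega)
          omega
    · right
      have ha : Rad T a t := hT.rad_of_not_covered hn seen_a fun d s h => Or.inr (htag d s h).symm
      have hc : Rad T c t := hT.rad_of_not_covered hn seen_c fun d s h => Or.inr (htag d s h).symm
      exact ⟨b, t, h1, h2, ha, hc, hT.quadrilateral_eq_innerQuad hn hab hbc hac ha hc⟩

end PuncturedPolygon

namespace PuncturedPolygon

open TaggedCurve

variable {n : ℕ} {T : Set (TaggedCurve n)}

/-! ### Quadrilaterals of radii -/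

theorem eq_or_eq_of_mem_triangle {i p q : ZMod n} {t s : Bool}
    (h : radius i t ∈ ({chord p q, radius p s, radius q s} : Set (TaggedCurve n))) :
    s = t ∧ (p = i ∨ q = i) := by
  simp only [Set.mem_insert_iff, Set.mem_singleton_iff, reduceCtorEq, false_or, radius.injEq] at h
  rcases h with ⟨rfl, rfl⟩ | ⟨rfl, rfl⟩
  · exact ⟨rfl, Or.inl rfl⟩
  · exact ⟨rfl, Or.inr rfl⟩

/-- What is adjacent to a radius: the sides of the triangles with a corner at the puncture, or the
sides of a subdivided once-punctured digon. -/
theorem Adjacent.radius_cases {i : ℤ} {t : Bool} {x : TaggedCurve n}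
    (h : Adjacent T (radius (i : ZMod n) t) x) :
    (∃ q : ZMod n, (i : ZMod n) ≠ q ∧ chord (i : ZMod n) q ∈ edges T ∧ radius q t ∈ T ∧
        (x = chord ↑i q ∨ x = radius q t)) ∨
      (∃ q : ZMod n, q ≠ i ∧ chord q (i : ZMod n) ∈ edges T ∧ radius q t ∈ T ∧
        (x = chord q ↑i ∨ x = radius q t)) ∨
      ∃ q : ZMod n, HasDigon T i q ∧ (∀ s, Rad T i s) ∧
        (x = chord ↑i q ∨ x = chord q ↑i ∨ x = radius ↑i (!t)) := by
  obtain ⟨hne, h | h, -⟩ := h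
  · obtain ⟨Δ, ⟨hΔ, hform⟩, h1, h2⟩ := h
    rcases hform with ⟨a, b, c, -, -, -, rfl⟩ | ⟨p, q, s, hpq, rfl⟩
    · simp at h1
    · obtain ⟨rfl, rfl | rfl⟩ := eq_or_eq_of_mem_triangle h1
      · refine Or.inl ⟨q, hpq, hΔ (by simp), radius_mem_edges_iff.1 (hΔ (by simp)), ?_⟩
        rcases h2 with h2 | h2 | h2
        · exact Or.inl h2
        · exact absurd h2.symm hne
        · exact Or.inr h2
      · refine Or.inr (Or.inl ⟨p, hpq, hΔ (by simp), radius_mem_edges_iff.1 (hΔ (by simp)), ?_⟩)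
        rcases h2 with h2 | h2 | h2
        · exact Or.inl h2
        · exact Or.inr h2
        · exact absurd h2.symm hne
  · obtain ⟨p, q, hd, hr, h1, h2⟩ := h
    simp only [Set.mem_insert_iff, Set.mem_singleton_iff, reduceCtorEq, false_or, radius.injEq] at h1
    obtain rfl : (i : ZMod n) = p := h1.elim And.left And.left
    refine Or.inr (Or.inr ⟨q, hd, hr, ?_⟩)
    rcases h2 with h2 | h2 | h2 | h2
    · exact Or.inl h2
    · exact Or.inr (Or.inl h2)
    · cases t
      · exact absurd h2.symm hne
      · exact Or.inr (Or.inr h2)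
    · cases t
      · exact Or.inr (Or.inr h2)
      · exact absurd h2.symm hne

theorem IsTriangulation.digon_unique (hn : 2 ≤ n) (hT : IsTriangulation T) {i j : ℤ}
    (hij : Edge T i j) (hji : Edge T j (i + n)) {q : ZMod n} (h : HasDigon T i q) :
    q = j := by
  obtain ⟨b, rfl, h1, h2⟩ := (hasDigon_iff hn).1 h
  rw [hT.inner_unique hn hij hji h1 h2]

/-- A radius inside a once-punctured digon ends at a corner of the digon. -/
theorem IsTriangulation.eq_of_digon (hn : 2 ≤ n) (hT : IsTriangulation T) {i j : ℤ}
    (hij : Edge T i j) (hji : Edge T j (i + n)) {q : ZMod n} {s : Bool} (hq : radius q s ∈ T) :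
    q = i ∨ q = j := by
  obtain ⟨b, rfl, hb1, hb2⟩ := exists_int_lift (by omega : 0 < n) q i
  rcases hb1.eq_or_lt with rfl | hb1
  · exact Or.inl rfl
  · rcases lt_trichotomy b j with h | rfl | h
    · exact (hT.not_covered hn hij hq hb1 h).elim
    · exact Or.inr rfl
    · exact (hT.not_covered hn hji hq h hb2).elim

theorem edge_mems {i j : ℤ} (hij : Edge T i j) (hji : Edge T j (i + n)) :
    chord (i : ZMod n) (j : ZMod n) ∈ edges T ∧ chord (j : ZMod n) (i : ZMod n) ∈ edges T := by
  have := hji.2.2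
  rw [intCast_add_modulus] at this
  exact ⟨hij.2.2, this⟩

theorem triangle_mem {p q : ℤ} {t : Bool} (hne : (p : ZMod n) ≠ q)
    (h : chord (p : ZMod n) (q : ZMod n) ∈ edges T) (hp : Rad T p t) (hq : Rad T q t) :
    ({chord (p : ZMod n) (q : ZMod n), radius (p : ZMod n) t, radius (q : ZMod n) t} :
      Set (TaggedCurve n)) ∈ triangles T := by
  refine ⟨?_, Or.inr ⟨_, _, t, hne, rfl⟩⟩
  rintro y (rfl | rfl | rfl)
  · exact h
  · exact Or.inl hp
  · exact Or.inl hq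

theorem IsTriangulation.quadrilateral_radius_of_digon (hn : 2 ≤ n) (hT : IsTriangulation T)
    {i j : ℤ} {t : Bool} (hij : Edge T i j) (hji : Edge T j (i + n)) (hi : Rad T i t)
    (h : Rad T i (!t) ∨ Rad T j t) :
    quadrilateral T (radius (i : ZMod n) t) =
      {chord ↑i ↑j, chord ↑j ↑i, radius ↑i (!t), radius ↑j t} := by
  have hne := intCast_ne_of_lt hij.1 hij.2.1
  obtain ⟨e1, e2⟩ := edge_mems hij hji
  have hd : HasDigon T (i : ZMod n) (j : ZMod n) := ⟨hne, e1, e2⟩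
  ext x
  constructor
  · rintro (⟨hx, hadj⟩ | ⟨p, q, hpq, h1, h2, hxne, hc⟩)
    · rcases hadj.radius_cases with ⟨q, hq, -, hr, hx⟩ | ⟨q, hq, -, hr, hx⟩ | ⟨q, hq, -, hx⟩
      · obtain rfl := (hT.eq_of_digon hn hij hji hr).resolve_left hq.symm
        exact hx.elim Or.inl fun h => Or.inr (Or.inr (Or.inr h))
      · obtain rfl := (hT.eq_of_digon hn hij hji hr).resolve_left hq
        exact hx.elim (fun h => Or.inr (Or.inl h)) fun h => Or.inr (Or.inr (Or.inr h))
      · obtain rfl := hT.digon_unique hn hij hji hq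
        exact hx.elim Or.inl fun h => Or.inr (h.elim Or.inl fun h => Or.inr (Or.inl h))
    · have h3 : ∀ s, radius (i : ZMod n) s ≠ radius (i : ZMod n) t → s = !t := by
        intro s hs
        rcases Bool.eq_or_eq_not s t with rfl | h
        · exact absurd rfl hs
        · exact h
      have key : ∃ s, x = radius ↑i s ∨ x = radius ↑j s := by
        rw [mem_digonRadii_iff] at h1
        obtain ⟨s, h2⟩ := h2
        rcases h1 with rfl | rfl
        · obtain rfl := hT.digon_unique hn hij hji hpq
          exact ⟨s, h2⟩
        · obtain rfl := hT.digon_unique hn hij hji hpq.symm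
          exact ⟨s, h2.symm⟩
      obtain ⟨s, rfl | rfl⟩ := key
      · rw [h3 s hxne]
        exact Or.inr (Or.inr (Or.inl rfl))
      · obtain rfl := Or.resolve_left hc hne
        exact Or.inr (Or.inr (Or.inr rfl))
  · have hndig : ∀ p q : ZMod n, ¬ ∃ i' j' : ZMod n, HasDigon T i' j' ∧
        radius (i : ZMod n) t ∈ digonRadii i' j' ∧ chord p q ∈ digonRadii i' j' :=
      fun p q ⟨_, _, _, _, h⟩ => chord_notMem_digonRadii h
    have hall : Rad T i (!t) → ∀ s, radius (i : ZMod n) s ∈ T := by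
      intro h s
      rcases Bool.eq_or_eq_not s t with rfl | rfl
      · exact hi
      · exact h
    have hit : radius (i : ZMod n) t ∈
        ({chord ↑i ↑j, chord ↑j ↑i, radius ↑i false, radius ↑i true} : Set (TaggedCurve n)) := by
      cases t <;> simp
    rintro (rfl | rfl | rfl | rfl)
    · refine Or.inl ⟨e1, by simp, ?_, hndig _ _⟩
      rcases h with h | h
      · exact Or.inr ⟨_, _, hd, hall h, hit, by simp⟩
      · exact Or.inl ⟨_, triangle_mem hne e1 hi h, by simp, by simp⟩
    · refine Or.inl ⟨e2, by simp, ?_, hndig _ _⟩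
      rcases h with h | h
      · exact Or.inr ⟨_, _, hd, hall h, hit, by simp⟩
      · exact Or.inl ⟨_, triangle_mem hne.symm e2 h hi, by simp, by simp⟩
    · refine Or.inr ⟨_, _, hd, mem_digonRadii_iff.2 (Or.inl rfl), mem_digonRadii_iff.2 (Or.inl rfl),
        ?_, Or.inl rfl⟩
      cases t <;> simp
    · refine Or.inr ⟨_, _, hd, mem_digonRadii_iff.2 (Or.inl rfl), mem_digonRadii_iff.2 (Or.inr rfl),
        ?_, Or.inr rfl⟩
      simpa using hne.symm

theorem IsTriangulation.quadrilateral_radius_of_three (hn : 2 ≤ n) (hT : IsTriangulation T)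
    {i j k : ℤ} {t : Bool} (hji : Edge T j i) (hik : Edge T i k) (hkj : k < j + n)
    (hj : Rad T j t) (hi : Rad T i t) (hk : Rad T k t) :
    quadrilateral T (radius (i : ZMod n) t) = innerQuad n j i k t := by
  have h1 := hji.1
  have h2 := hik.1
  have hneji := intCast_ne_of_lt hji.1 hji.2.1
  have hneik := intCast_ne_of_lt hik.1 hik.2.1
  have hnd : ∀ q, ¬ HasDigon T (i : ZMod n) q := by
    intro q hq
    obtain ⟨b, rfl, h3, h4⟩ := (hasDigon_iff hn).1 hq
    rcases lt_trichotomy b k with h | rfl | h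
    · exact hT.not_covered hn h4 hk h (by omega)
    · exact hT.not_covered hn h4 hj.add_modulus (by omega) (by omega)
    · exact hT.not_covered hn h3 hk h2 h
  have hnd' : ∀ p q x, ¬ (HasDigon T p q ∧ radius (i : ZMod n) t ∈ digonRadii p q ∧
      x ∈ digonRadii p q) := by
    rintro p q x ⟨h3, h4, -⟩
    rw [mem_digonRadii_iff] at h4
    rcases h4 with rfl | rfl
    · exact hnd _ h3
    · exact hnd _ h3.symm
  ext x
  constructor
  · rintro (⟨hx, hadj⟩ | ⟨p, q, h3, h4, h5, -⟩)
    · rcases hadj.radius_cases with ⟨q, hq, he, hr, hx⟩ | ⟨q, hq, he, hr, hx⟩ | ⟨q, hq, -⟩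
      · obtain ⟨b, rfl, hb1, hb2⟩ := exists_int_lift (by omega : 0 < n) q i
        have hib : Edge T i b := ⟨lt_of_le_of_ne hb1 (by rintro rfl; exact hq rfl), hb2, he⟩
        obtain rfl : b = k := by
          rcases lt_trichotomy b k with h | h | h
          · exact (hT.not_covered hn hik hr hib.1 h).elim
          · exact h
          · exact (hT.not_covered hn hib hk h2 h).elim
        exact hx.elim (fun h => Or.inr (Or.inl h)) fun h => Or.inr (Or.inr (Or.inr h))
      · obtain ⟨b, rfl, hb1, hb2⟩ := exists_int_lift (by omega : 0 < n) q (i - n)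
        have hb3 : i - n ≠ b := by
          rintro rfl
          apply hq
          rw [← intCast_add_modulus, sub_add_cancel]
        have hbi : Edge T b i := ⟨by omega, by omega, he⟩
        obtain rfl : b = j := by
          rcases lt_trichotomy b j with h | h | h
          · exact (hT.not_covered hn hbi hj h h1).elim
          · exact h
          · exact (hT.not_covered hn hji hr h hbi.1).elim
        exact hx.elim Or.inl fun h => Or.inr (Or.inr (Or.inl h))
      · exact (hnd q hq).elim
    · exact (hnd' p q x ⟨h3, h4, h5⟩).elim
  · have hnd2 : ∀ x, ¬ ∃ p q : ZMod n, HasDigon T p q ∧ radius (i : ZMod n) t ∈ digonRadii p q ∧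
        x ∈ digonRadii p q := fun x ⟨p, q, h⟩ => hnd' p q x h
    rintro (rfl | rfl | rfl | rfl)
    · exact Or.inl ⟨hji.2.2, by simp,
        Or.inl ⟨_, triangle_mem hneji hji.2.2 hj hi, by simp, by simp⟩, hnd2 _⟩
    · exact Or.inl ⟨hik.2.2, by simp,
        Or.inl ⟨_, triangle_mem hneik hik.2.2 hi hk, by simp, by simp⟩, hnd2 _⟩
    · exact Or.inl ⟨Or.inl hj, by simpa using hneji.symm,
        Or.inl ⟨_, triangle_mem hneji hji.2.2 hj hi, by simp, by simp⟩, hnd2 _⟩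
    · exact Or.inl ⟨Or.inl hk, by simpa using hneik,
        Or.inl ⟨_, triangle_mem hneik hik.2.2 hi hk, by simp, by simp⟩, hnd2 _⟩

/-- The possible quadrilaterals of a radius. -/
theorem IsTriangulation.quadrilateral_radius (hn : 2 ≤ n) (hT : IsTriangulation T) {i : ℤ} {t : Bool}
    (hi : Rad T i t) :
    (∃ p q r : ℤ, p < q ∧ q < r ∧ r < p + n ∧
      quadrilateral T (radius (i : ZMod n) t) = innerQuad n p q r t) ∨
    ∃ p q : ℤ, p < q ∧ q < p + n ∧ quadrilateral T (radius (i : ZMod n) t) = digonQuad n p q := by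
  have hdig : ∀ {j : ℤ}, Edge T i j → Edge T j (i + n) → (Rad T i (!t) ∨ Rad T j t) →
      ∃ p q : ℤ, p < q ∧ q < p + n ∧
        quadrilateral T (radius (i : ZMod n) t) = digonQuad n p q := by
    intro j h1 h2 h
    have h3 := h1.1
    have h4 := h2.1
    have hq := hT.quadrilateral_radius_of_digon hn h1 h2 hi h
    cases t
    · exact ⟨i, j, h1.1, h1.2.1, hq⟩
    · refine ⟨j, i + n, h4, by omega, ?_⟩
      rw [hq, digonQuad, intCast_add_modulus]
      ext x
      simp only [Set.mem_insert_iff, Set.mem_singleton_iff, Bool.not_true]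
      tauto
  rcases hT.rad_alternative hn hi with h | ⟨⟨j₀, hj₀, hj₀', hj₀r⟩, htag⟩
  · obtain ⟨j, h1, h2⟩ := hT.exists_digon hn hi h
    exact Or.inr (hdig h1 h2 (Or.inl h))
  -- the radii next to the given one on its two sides
  obtain ⟨k, ⟨hk, hkr⟩, hkmin⟩ := Int.exists_least_of_bdd (P := fun k => i < k ∧ Rad T k t)
    ⟨i, fun z hz => by omega⟩ ⟨j₀, hj₀, hj₀r⟩
  obtain ⟨j, ⟨hj, hjr⟩, hjmax⟩ := Int.exists_greatest_of_bdd (P := fun j => j < i ∧ Rad T j t)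
    ⟨i, fun z hz => by omega⟩ ⟨j₀ - n, by omega, hj₀r.sub_modulus⟩
  have hk0 := hkmin j₀ ⟨hj₀, hj₀r⟩
  have hj0 := hjmax (j₀ - n) ⟨by omega, hj₀r.sub_modulus⟩
  have hkj := hkmin (j + n) ⟨by omega, hjr.add_modulus⟩
  have hik : Edge T i k := by
    refine hT.edge_of_not_interlaced hn hk (by omega) (fun x y hxy => ⟨?_, ?_⟩) ?_
    · rintro ⟨h1, h2, h3⟩
      exact hT.not_covered hn hxy hkr h2 h3
    · rintro ⟨h1, h2, h3⟩
      exact hT.not_covered hn hxy hi h1 h2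
    · rintro x s hx ⟨h1, h2⟩
      obtain rfl := htag x s hx
      have := hkmin x ⟨h1, hx⟩
      omega
  have hji : Edge T j i := by
    refine hT.edge_of_not_interlaced hn hj (by omega) (fun x y hxy => ⟨?_, ?_⟩) ?_
    · rintro ⟨h1, h2, h3⟩
      exact hT.not_covered hn hxy hi h2 h3
    · rintro ⟨h1, h2, h3⟩
      exact hT.not_covered hn hxy hjr h1 h2
    · rintro x s hx ⟨h1, h2⟩
      obtain rfl := htag x s hx
      have := hjmax x ⟨h2, hx⟩
      omega
  rcases hkj.eq_or_lt with rfl | hkj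
  · exact Or.inr (hdig hik hji.add_modulus (Or.inr hkr))
  · exact Or.inl ⟨j, i, k, hj, hk, hkj,
      hT.quadrilateral_radius_of_three hn hji hik hkj hjr hi hkr⟩

/-! ### Existence of tagged triangulations -/

theorem finite_taggedCurve (hn : 0 < n) : Finite (TaggedCurve n) := by
  have : NeZero n := ⟨hn.ne'⟩
  refine Finite.of_surjective
    (Sum.elim (fun p => chord p.1 p.2) (fun p => radius p.1 p.2) :
      (ZMod n × ZMod n) ⊕ (ZMod n × Bool) → TaggedCurve n) ?_
  rintro (⟨i, j⟩ | ⟨i, t⟩)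
  · exact ⟨Sum.inl (i, j), rfl⟩
  · exact ⟨Sum.inr (i, t), rfl⟩

/-- A laminar family of chords that are given by integers in one closed fundamental interval,
together with compatible radii outside of them, is contained in the edges of a triangulation. -/
theorem exists_triangulation_of_laminar (hn : 2 ≤ n) (i : ℤ) (P : ℤ → ℤ → Prop) (R : ℤ → Bool → Prop)
    (hP : ∀ p q, P p q → i ≤ p ∧ p < q ∧ q ≤ i + n ∧ q < p + n)
    (hL : ∀ p q r s, P p q → P r s → p < r → r < q → q < s → False)
    (hR : ∀ c t, R c t → i ≤ c ∧ c ≤ i + n)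
    (hPR : ∀ p q c t, P p q → R c t → p < c → c < q → False)
    (hRR : ∀ c s d t, R c s → R d t → c = d ∨ s = t) :
    ∃ T : Set (TaggedCurve n), IsTriangulation T ∧ (∀ p q, P p q → Edge T p q) ∧
      ∀ c t, R c t → Rad T c t := by
  have := finite_taggedCurve (n := n) (by omega)
  let S : Set (TaggedCurve n) := {x | IsArc x ∧ ((∃ p q : ℤ, P p q ∧ x = chord ↑p ↑q) ∨
    ∃ (c : ℤ) (t : Bool), R c t ∧ x = radius ↑c t)}
  have hchord : ∀ p q r s, P p q → P r s →
      Compatible (chord (p : ZMod n) (q : ZMod n)) (chord (r : ZMod n) (s : ZMod n)) := by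
    intro p q r s h1 h2
    obtain ⟨a1, a2, a3, a4⟩ := hP p q h1
    obtain ⟨b1, b2, b3, b4⟩ := hP r s h2
    rw [compatible_chord_chord_iff a2 a4 b2 b4]
    intro k
    have e1 := hL p q r s h1 h2
    have e2 := hL r s p q h2 h1
    rcases mul_modulus_cases (m := n) k with h | h | h | h | h
    · omega
    · omega
    · rw [h, add_zero, add_zero]
      exact ⟨fun h => e1 h.1 h.2.1 h.2.2, fun h => e2 h.1 h.2.1 h.2.2⟩
    · omega
    · omega
  have hrad : ∀ p q c t, P p q → R c t →
      Compatible (chord (p : ZMod n) (q : ZMod n)) (radius (c : ZMod n) t) := by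
    intro p q c t h1 h2
    obtain ⟨a1, a2, a3, a4⟩ := hP p q h1
    have b := hR c t h2
    rw [compatible_chord_radius_iff a2 a4]
    intro k hk
    have e1 := hPR p q c t h1 h2
    rcases mul_modulus_cases (m := n) k with h | h | h | h | h
    · omega
    · omega
    · rw [h, add_zero] at hk
      exact e1 hk.1 hk.2
    · omega
    · omega
  have hS : (∀ x ∈ S, IsArc x) ∧ ∀ x ∈ S, ∀ y ∈ S, Compatible x y := by
    refine ⟨fun e he => he.1, ?_⟩
    rintro _ ⟨-, ⟨p, q, h1, rfl⟩ | ⟨c, t, h1, rfl⟩⟩ _ ⟨-, ⟨r, s, h2, rfl⟩ | ⟨d, u, h2, rfl⟩⟩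
    · exact hchord p q r s h1 h2
    · exact hrad p q d u h1 h2
    · exact (hrad r s c t h2 h1).symm
    · exact (hRR c t d u h1 h2).imp (fun h => by rw [h]) id
  obtain ⟨T, hST, hT⟩ := Finite.exists_le_maximal (p := fun S : Set (TaggedCurve n) =>
    (∀ x ∈ S, IsArc x) ∧ ∀ x ∈ S, ∀ y ∈ S, Compatible x y) hS
  refine ⟨T, hT, fun p q hpq => ?_, fun c t h => hST ⟨trivial, Or.inr ⟨c, t, h, rfl⟩⟩⟩
  obtain ⟨h1, h2, h3, h4⟩ := hP p q hpq
  refine ⟨h2, h4, ?_⟩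
  by_cases hB : IsBoundary (chord (p : ZMod n) (q : ZMod n))
  · exact Or.inr hB
  · exact Or.inl (hST ⟨⟨intCast_ne_of_lt h2 h4, hB⟩, Or.inl ⟨p, q, hpq, rfl⟩⟩)

/-! ### Classification of the quadrilaterals -/

/-- Quadrilaterals without corner or curve at the puncture. -/
def outerQuads (n : ℕ) : Set (Set (TaggedCurve n)) :=
  {q | ∃ a b c d : ℤ, a < b ∧ b < c ∧ c < d ∧ d < a + n ∧ q = outerQuad n a b c d}

/-- Quadrilaterals with a corner at the puncture. -/
def innerQuads (n : ℕ) : Set (Set (TaggedCurve n)) :=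
  {q | ∃ (a b c : ℤ) (t : Bool), a < b ∧ b < c ∧ c < a + n ∧ q = innerQuad n a b c t}

/-- Once-punctured triangles with both versions of a radius. -/
def loopQuads (n : ℕ) : Set (Set (TaggedCurve n)) :=
  {q | ∃ a b c : ℤ, a < b ∧ b < c ∧ c < a + n ∧ q = loopQuad n a b c}

/-- Once-punctured digons with two radii of different tags. -/
def digonQuads (n : ℕ) : Set (Set (TaggedCurve n)) :=
  {q | ∃ a b : ℤ, a < b ∧ b < a + n ∧ q = digonQuad n a b}

/-- Once-punctured digons, given by their two sides only. -/
def bareDigons (n : ℕ) : Set (Set (TaggedCurve n)) :=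
  {q | ∃ a b : ℤ, a < b ∧ b < a + n ∧ q = {chord ↑a ↑b, chord ↑b ↑a}}

theorem exists_outerQuad (hn : 2 ≤ n) {a b c d : ℤ} (hab : a < b) (hbc : b < c) (hcd : c < d)
    (hd : d < a + n) : ∃ T : Set (TaggedCurve n), IsTriangulation T ∧ (∀ t, Rad T a t) ∧
      chord (a : ZMod n) (c : ZMod n) ∈ T ∧
      quadrilateral T (chord (a : ZMod n) (c : ZMod n)) = outerQuad n a b c d := by
  obtain ⟨T, hT, hE, hR⟩ := exists_triangulation_of_laminar hn a
    (fun p q => (p = a ∧ q = b) ∨ (p = b ∧ q = c) ∨ (p = c ∧ q = d) ∨ (p = a ∧ q = d) ∨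
        (p = a ∧ q = c)) (fun x _ => x = a) (by intro p q; omega) (by intro p q r s; omega)
    (by intro x t; omega) (by intro p q x t; omega) (by intro x s y t h1 h2; left; omega)
  have hac := (hE a c (by omega))
  exact ⟨T, hT, fun t => hR a t rfl, hac.mem_of_ne hn (by omega),
    hT.quadrilateral_eq_outerQuad_right hn (hE a b (by omega)) (hE b c (by omega)) hac
      (hE c d (by omega)) (hE a d (by omega))⟩

theorem exists_loopQuad (hn : 2 ≤ n) {a b c : ℤ} (hab : a < b) (hbc : b < c)
    (hc : c < a + n) : ∃ T : Set (TaggedCurve n), IsTriangulation T ∧ (∀ t, Rad T a t) ∧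
      chord (a : ZMod n) (c : ZMod n) ∈ T ∧
      quadrilateral T (chord (a : ZMod n) (c : ZMod n)) = loopQuad n a b c := by
  obtain ⟨T, hT, hE, hR⟩ := exists_triangulation_of_laminar hn a
    (fun p q => (p = a ∧ q = b) ∨ (p = b ∧ q = c) ∨ (p = a ∧ q = c) ∨ (p = c ∧ q = a + n))
    (fun x _ => x = a) (by intro p q; omega) (by intro p q r s; omega)
    (by intro x t; omega) (by intro p q x t; omega) (by intro x s y t h1 h2; left; omega)
  have hac := (hE a c (by omega))
  exact ⟨T, hT, fun t => hR a t rfl, hac.mem_of_ne hn (by omega),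
    hT.quadrilateral_eq_loopQuad hn (hE a b (by omega)) (hE b c (by omega)) hac
      (hE c _ (by omega)) fun t => hR a t rfl⟩

theorem exists_innerQuad (hn : 2 ≤ n) {a b c : ℤ} (t : Bool) (hab : a < b) (hbc : b < c)
    (hc : c < a + n) : ∃ T : Set (TaggedCurve n), IsTriangulation T ∧
      chord (a : ZMod n) (c : ZMod n) ∈ T ∧
      quadrilateral T (chord (a : ZMod n) (c : ZMod n)) = innerQuad n a b c t := by
  obtain ⟨T, hT, hE, hR⟩ := exists_triangulation_of_laminar hn a
    (fun p q => (p = a ∧ q = b) ∨ (p = b ∧ q = c) ∨ (p = a ∧ q = c))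
    (fun x s => (x = a ∨ x = c) ∧ s = t) (by intro p q; omega) (by intro p q r s; omega)
    (by rintro x s ⟨h, -⟩; omega) (by rintro p q x s h1 ⟨h2, -⟩; omega)
    (by rintro x s y u ⟨-, h1⟩ ⟨-, h2⟩; right; rw [h1, h2])
  have hac := (hE a c (by omega))
  exact ⟨T, hT, hac.mem_of_ne hn (by omega),
    hT.quadrilateral_eq_innerQuad hn (hE a b (by omega)) (hE b c (by omega)) hac
      (hR a t ⟨Or.inl rfl, rfl⟩) (hR c t ⟨Or.inr rfl, rfl⟩)⟩

theorem exists_digonTriangulation (hn : 2 ≤ n) {a b : ℤ} (hab : a < b) (hb : b < a + n) :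
    ∃ T : Set (TaggedCurve n), IsTriangulation T ∧ (∀ t, Rad T a t) ∧ Edge T a b ∧
      Edge T b (a + n) := by
  obtain ⟨T, hT, hE, hR⟩ := exists_triangulation_of_laminar hn a
    (fun p q => (p = a ∧ q = b) ∨ (p = b ∧ q = a + n))
    (fun x _ => x = a) (by intro p q; omega) (by intro p q r s; omega)
    (by intro x t; omega) (by intro p q x t; omega) (by intro x s y t h1 h2; left; omega)
  exact ⟨T, hT, fun t => hR a t rfl, hE a b (by omega), hE b _ (by omega)⟩

theorem quadrilaterals_eq (hn : 2 ≤ n) :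
    quadrilaterals n = outerQuads n ∪ innerQuads n ∪ loopQuads n ∪ digonQuads n := by
  ext q
  constructor
  · rintro ⟨T, ⟨i, j⟩ | ⟨i, t⟩, hT, hγ, rfl⟩
    · obtain ⟨a, c, -, -, hac, rfl, rfl⟩ := hT.exists_edge_of_chord_mem hn (Or.inl hγ) 0
      have hne := (isArc_chord_iff hn hac.1 hac.2.1).1 (hT.1.1 _ hγ)
      have h1 := hac.1
      have h2 := hac.2.1
      rcases hT.quadrilateral_chord hn hac (by omega) with ⟨p, q, r, s, h⟩ | ⟨p, q, r, h⟩ |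
        ⟨b, t, h3, h4, -, -, h⟩
      · exact Or.inl (Or.inl (Or.inl ⟨p, q, r, s, h⟩))
      · exact Or.inl (Or.inr ⟨p, q, r, h⟩)
      · exact Or.inl (Or.inl (Or.inr ⟨a, b, c, t, h3, h4, h2, h⟩))
    · obtain ⟨c, rfl, -, -⟩ := exists_int_lift (by omega : 0 < n) i 0
      rcases hT.quadrilateral_radius hn hγ with ⟨p, q, r, h1, h2, h3, h⟩ | ⟨p, q, h⟩
      · exact Or.inl (Or.inl (Or.inr ⟨p, q, r, t, h1, h2, h3, h⟩))
      · exact Or.inr ⟨p, q, h⟩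
  · rintro (((⟨a, b, c, d, h1, h2, h3, h4, rfl⟩ | ⟨a, b, c, t, h1, h2, h3, rfl⟩) |
      ⟨a, b, c, h1, h2, h3, rfl⟩) | ⟨a, b, h1, h2, rfl⟩)
    · obtain ⟨T, hT, -, hγ, h⟩ := exists_outerQuad hn h1 h2 h3 h4
      exact ⟨T, _, hT, hγ, h.symm⟩
    · obtain ⟨T, hT, hγ, h⟩ := exists_innerQuad hn t h1 h2 h3
      exact ⟨T, _, hT, hγ, h.symm⟩
    · obtain ⟨T, hT, -, hγ, h⟩ := exists_loopQuad hn h1 h2 h3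
      exact ⟨T, _, hT, hγ, h.symm⟩
    · obtain ⟨T, hT, hR, h3, h4⟩ := exists_digonTriangulation hn h1 h2
      exact ⟨T, _, hT, hR false,
        (hT.quadrilateral_radius_of_digon hn h3 h4 (hR false) (Or.inl (hR true))).symm⟩

/-! ### Tag-symmetric triangulations -/

/-- Two radii with different endpoints have equal tags, so one radius with both tags leaves no room
for radii at other vertices. -/
theorem isSymmTriangulation_of_forall_rad (hn : 2 ≤ n) (hT : IsTriangulation T) {a : ℤ}
    (hR : ∀ t, Rad T a t) : IsSymmTriangulation T := by
  have hact : ∀ x ∈ T, act x ∈ T := by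
    rintro (⟨i, j⟩ | ⟨i, t⟩) hx
    · exact hx
    · obtain ⟨c, rfl, -, -⟩ := exists_int_lift (by omega : 0 < n) i 0
      by_cases h : (a : ZMod n) = c
      · change Rad T c (!t)
        unfold Rad
        rw [← h]
        exact hR _
      · exact (hT.not_rad_of_forall_rad h hR hx).elim
  refine ⟨hT, Set.Subset.antisymm (by rintro _ ⟨x, hx, rfl⟩; exact hact x hx) fun x hx => ?_⟩
  refine ⟨act x, hact x hx, ?_⟩
  cases x
  · rfl
  · simp [act]

theorem IsSymmTriangulation.rad_not (hT : IsSymmTriangulation T) {c : ℤ} {t : Bool}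
    (h : Rad T c t) : Rad T c (!t) := by
  have : act (radius (c : ZMod n) t) ∈ T := hT.2 ▸ Set.mem_image_of_mem act h
  exact this

theorem orbitQuadrilateral_chord (T : Set (TaggedCurve n)) (i j : ZMod n) :
    orbitQuadrilateral T (chord i j) = quadrilateral T (chord i j) := by
  ext x
  constructor
  · rintro ⟨hx, δ, hδ, h⟩
    obtain rfl : δ = chord i j := by
      rcases hδ with rfl | rfl <;> rfl
    exact Or.inl ⟨hx, h⟩
  · rintro (⟨hx, h⟩ | ⟨p, q, -, h, -⟩)
    · exact ⟨hx, _, Or.inl rfl, h⟩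
    · exact (chord_notMem_digonRadii h).elim

theorem IsTriangulation.orbitQuadrilateral_radius (hn : 2 ≤ n) (hT : IsTriangulation T) {i j : ℤ}
    (hr : ∀ t, Rad T i t) (hij : Edge T i j) (hji : Edge T j (i + n)) (t : Bool) :
    orbitQuadrilateral T (radius (i : ZMod n) t) = {chord ↑i ↑j, chord ↑j ↑i} := by
  have hne := intCast_ne_of_lt hij.1 hij.2.1
  obtain ⟨e1, e2⟩ := edge_mems hij hji
  have hd : HasDigon T (i : ZMod n) (j : ZMod n) := ⟨hne, e1, e2⟩
  have hno : ∀ {q : ZMod n} {s : Bool}, (i : ZMod n) ≠ q → radius q s ∉ T := by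
    intro q s hq hqT
    obtain rfl := (hT.eq_of_digon hn hij hji hqT).resolve_left hq.symm
    exact hT.not_rad_of_forall_rad hne hr hqT
  ext x
  constructor
  · rintro ⟨hx, δ, hδ, h⟩
    obtain ⟨s, rfl⟩ : ∃ s, δ = radius (i : ZMod n) s := by
      rcases hδ with rfl | rfl
      · exact ⟨_, rfl⟩
      · exact ⟨_, rfl⟩
    rcases h.radius_cases with ⟨q, hq, -, hqT, -⟩ | ⟨q, hq, -, hqT, -⟩ | ⟨q, hq, -, hx⟩
    · exact (hno hq hqT).elim
    · exact (hno hq.symm hqT).elim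
    · obtain rfl := hT.digon_unique hn hij hji hq
      rcases hx with hx | hx | rfl
      · exact Or.inl hx
      · exact Or.inr hx
      · exact (h.2.2 ⟨_, _, hd, mem_digonRadii_iff.2 (Or.inl rfl),
          mem_digonRadii_iff.2 (Or.inl rfl)⟩).elim
  · have hndig : ∀ p q : ZMod n, ¬ ∃ i' j' : ZMod n, HasDigon T i' j' ∧
        radius (i : ZMod n) t ∈ digonRadii i' j' ∧ chord p q ∈ digonRadii i' j' :=
      fun p q ⟨_, _, _, _, h⟩ => chord_notMem_digonRadii h
    have hit : radius (i : ZMod n) t ∈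
        ({chord ↑i ↑j, chord ↑j ↑i, radius ↑i false, radius ↑i true} : Set (TaggedCurve n)) := by
      cases t <;> simp
    rintro (rfl | rfl)
    · exact ⟨e1, _, Or.inl rfl, by simp, Or.inr ⟨_, _, hd, hr, hit, by simp⟩, hndig _ _⟩
    · exact ⟨e2, _, Or.inl rfl, by simp, Or.inr ⟨_, _, hd, hr, hit, by simp⟩, hndig _ _⟩

theorem orbitQuadrilaterals_eq (hn : 2 ≤ n) :
    orbitQuadrilaterals n = outerQuads n ∪ loopQuads n ∪ bareDigons n := by
  ext q
  constructor
  · rintro ⟨T, ⟨i, j⟩ | ⟨i, t⟩, hT, hγ, rfl⟩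
    · obtain ⟨a, c, -, -, hac, rfl, rfl⟩ := hT.1.exists_edge_of_chord_mem hn (Or.inl hγ) 0
      have hne := (isArc_chord_iff hn hac.1 hac.2.1).1 (hT.1.1.1 _ hγ)
      have h1 := hac.1
      have h2 := hac.2.1
      rw [orbitQuadrilateral_chord]
      rcases hT.1.quadrilateral_chord hn hac (by omega) with ⟨p, q, r, s, h⟩ | ⟨p, q, r, h⟩ |
        ⟨b, t, -, -, ha, hc, -⟩
      · exact Or.inl (Or.inl ⟨p, q, r, s, h⟩)
      · exact Or.inl (Or.inr ⟨p, q, r, h⟩)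
      · -- a symmetric triangulation has no radii at two vertices
        rcases hT.1.rad_compatible ha (hT.rad_not hc) with h | h
        · exact absurd h (intCast_ne_of_lt h1 h2)
        · cases t <;> cases h
    · obtain ⟨c, rfl, -, -⟩ := exists_int_lift (by omega : 0 < n) i 0
      obtain ⟨j, h1, h2⟩ := hT.1.exists_digon hn hγ (hT.rad_not hγ)
      have hr : ∀ s, Rad T c s := by
        intro s
        rcases Bool.eq_or_eq_not s t with rfl | rfl
        · exact hγ
        · exact hT.rad_not hγ
      exact Or.inr ⟨c, j, h1.1, h1.2.1, hT.1.orbitQuadrilateral_radius hn hr h1 h2 t⟩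
  · rintro ((⟨a, b, c, d, h1, h2, h3, h4, rfl⟩ | ⟨a, b, c, h1, h2, h3, rfl⟩) | ⟨a, b, h1, h2, rfl⟩)
    · obtain ⟨T, hT, hR, hγ, h⟩ := exists_outerQuad hn h1 h2 h3 h4
      exact ⟨T, _, isSymmTriangulation_of_forall_rad hn hT hR, hγ,
        by rw [orbitQuadrilateral_chord, h]⟩
    · obtain ⟨T, hT, hR, hγ, h⟩ := exists_loopQuad hn h1 h2 h3
      exact ⟨T, _, isSymmTriangulation_of_forall_rad hn hT hR, hγ,
        by rw [orbitQuadrilateral_chord, h]⟩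
    · obtain ⟨T, hT, hR, h3, h4⟩ := exists_digonTriangulation hn h1 h2
      exact ⟨T, _, isSymmTriangulation_of_forall_rad hn hT hR, hR true,
        (hT.orbitQuadrilateral_radius hn hR h3 h4 true).symm⟩

end PuncturedPolygon

/-! ### Counting quadrilaterals in the once-punctured polygon -/

namespace PuncturedPolygon

open TaggedCurve

variable {n : ℕ}

theorem exists_of_chord_mem_outerQuad {a b c d p q : ℤ} (hab : a < b) (hbc : b < c) (hcd : c < d)
    (hd : d < a + n) (hpq : p < q) (hq : q < p + n)
    (h : chord (p : ZMod n) (q : ZMod n) ∈ outerQuad n a b c d) :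
    ∃ k : ℤ, (a = p + k * n ∧ b = q + k * n) ∨ (b = p + k * n ∧ c = q + k * n) ∨
      (c = p + k * n ∧ d = q + k * n) ∨ (a = p + k * n ∧ d = q + k * n) := by
  rcases h with h | h | h | h
  all_goals
    replace h : chord (p : ZMod n) (q : ZMod n) = chord _ _ := h
    rw [chord_eq_chord_iff hpq hq (by omega) (by omega)] at h
    obtain ⟨k, h1, h2⟩ := h
    exact ⟨k, by omega⟩

theorem radius_notMem_outerQuad {a b c d : ℤ} {i : ZMod n} {t : Bool} :
    radius i t ∉ outerQuad n a b c d := by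
  rintro (h | h | h | h) <;> cases h

theorem outerQuad_injective {a b c d a' b' c' d' : ℤ} (ha : 0 ≤ a) (han : a < n) (hab : a < b)
    (hbc : b < c) (hcd : c < d) (hd : d < a + n) (ha' : 0 ≤ a') (han' : a' < n) (hab' : a' < b')
    (hbc' : b' < c') (hcd' : c' < d') (hd' : d' < a' + n)
    (h : outerQuad n a b c d = outerQuad n a' b' c' d') :
    a = a' ∧ b = b' ∧ c = c' ∧ d = d' := by
  have h4 : ∀ a b c d : ℤ, chord (a : ZMod n) (d : ZMod n) ∈ outerQuad n a b c d :=
    fun _ _ _ _ => Or.inr (Or.inr (Or.inr rfl))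
  have h1 : ∀ a b c d : ℤ, chord (a : ZMod n) (b : ZMod n) ∈ outerQuad n a b c d :=
    fun _ _ _ _ => Or.inl rfl
  have h3 : ∀ a b c d : ℤ, chord (c : ZMod n) (d : ZMod n) ∈ outerQuad n a b c d :=
    fun _ _ _ _ => Or.inr (Or.inr (Or.inl rfl))
  -- the longest sides of both sets coincide
  have h5 : a = a' ∧ d = d' := by
    obtain ⟨k, hk⟩ := exists_of_chord_mem_outerQuad hab' hbc' hcd' hd' (by omega) (by omega)
      (h ▸ h4 a b c d)
    obtain ⟨l, hl⟩ := exists_of_chord_mem_outerQuad hab hbc hcd hd (by omega) (by omega)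
      (h ▸ h4 a' b' c' d')
    rcases mul_modulus_cases (m := n) k with h' | h' | h' | h' | h' <;> omega
  obtain ⟨rfl, rfl⟩ := h5
  have h6 : b = b' := by
    obtain ⟨k, hk⟩ := exists_of_chord_mem_outerQuad hab' hbc' hcd' hd' (by omega) (by omega)
      (h ▸ h1 a b c d)
    rcases mul_modulus_cases (m := n) k with h' | h' | h' | h' | h' <;> omega
  have h7 : c = c' := by
    obtain ⟨k, hk⟩ := exists_of_chord_mem_outerQuad hab' hbc' hcd' hd' (by omega) (by omega)
      (h ▸ h3 a b c d)
    rcases mul_modulus_cases (m := n) k with h' | h' | h' | h' | h' <;> omega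
  exact ⟨rfl, h6, h7, rfl⟩

theorem mem_innerQuad₁ (a b c : ℤ) (t : Bool) :
    chord (a : ZMod n) (b : ZMod n) ∈ innerQuad n a b c t :=
  Or.inl rfl

theorem mem_innerQuad₂ (a b c : ℤ) (t : Bool) :
    chord (b : ZMod n) (c : ZMod n) ∈ innerQuad n a b c t :=
  Or.inr (Or.inl rfl)

theorem mem_innerQuad₃ (a b c : ℤ) (t : Bool) : radius (a : ZMod n) t ∈ innerQuad n a b c t :=
  Or.inr (Or.inr (Or.inl rfl))

theorem exists_of_chord_mem_innerQuad {a b c p q : ℤ} {t : Bool} (hab : a < b) (hbc : b < c)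
    (hc : c < a + n) (hpq : p < q) (hq : q < p + n)
    (h : chord (p : ZMod n) (q : ZMod n) ∈ innerQuad n a b c t) :
    ∃ k : ℤ, (a = p + k * n ∧ b = q + k * n) ∨ (b = p + k * n ∧ c = q + k * n) := by
  rcases h with h | h | h | h
  iterate 2
    replace h : chord (p : ZMod n) (q : ZMod n) = chord _ _ := h
    rw [chord_eq_chord_iff hpq hq (by omega) (by omega)] at h
    obtain ⟨k, h1, h2⟩ := h
    exact ⟨k, by omega⟩
  all_goals cases h

theorem tag_of_radius_mem_innerQuad {a b c : ℤ} {t s : Bool} {i : ZMod n}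
    (h : radius i s ∈ innerQuad n a b c t) : s = t := by
  rcases h with h | h | h | h <;> cases h <;> rfl

theorem innerQuad_injective {a b c a' b' c' : ℤ} {t : Bool} (ha : 0 ≤ a) (han : a < n) (hab : a < b)
    (hbc : b < c) (hc : c < a + n) (ha' : 0 ≤ a') (han' : a' < n) (hab' : a' < b') (hbc' : b' < c')
    (hc' : c' < a' + n) (h : innerQuad n a b c t = innerQuad n a' b' c' t) :
    a = a' ∧ b = b' ∧ c = c' := by
  obtain ⟨k, hk⟩ := exists_of_chord_mem_innerQuad hab' hbc' hc' hab (by omega)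
    (h ▸ mem_innerQuad₁ a b c t)
  obtain ⟨l, hl⟩ := exists_of_chord_mem_innerQuad hab' hbc' hc' hbc (by omega)
    (h ▸ mem_innerQuad₂ a b c t)
  rcases mul_modulus_cases (m := n) k with h1 | h1 | h1 | h1 | h1 <;>
    rcases mul_modulus_cases (m := n) l with h2 | h2 | h2 | h2 | h2 <;> omega

theorem mem_loopQuad₁ (a b c : ℤ) : chord (a : ZMod n) (b : ZMod n) ∈ loopQuad n a b c :=
  Or.inl rfl

theorem mem_loopQuad₂ (a b c : ℤ) : chord (b : ZMod n) (c : ZMod n) ∈ loopQuad n a b c :=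
  Or.inr (Or.inl rfl)

theorem exists_of_chord_mem_loopQuad {a b c p q : ℤ} (hab : a < b) (hbc : b < c)
    (hc : c < a + n) (hpq : p < q) (hq : q < p + n)
    (h : chord (p : ZMod n) (q : ZMod n) ∈ loopQuad n a b c) :
    ∃ k : ℤ, (a = p + k * n ∧ b = q + k * n) ∨ (b = p + k * n ∧ c = q + k * n) ∨
      (c = p + k * n ∧ a + n = q + k * n) := by
  have hca : chord (c : ZMod n) (a : ZMod n) = chord (c : ZMod n) ((a + n : ℤ) : ZMod n) := by
    rw [intCast_add_modulus]
  rcases h with h | h | h | h | h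
  iterate 3
    replace h : chord (p : ZMod n) (q : ZMod n) = chord _ _ := h
    try rw [hca] at h
    rw [chord_eq_chord_iff hpq hq (by omega) (by omega)] at h
    obtain ⟨k, h1, h2⟩ := h
    exact ⟨k, by omega⟩
  all_goals cases h

theorem radius_mem_loopQuad_iff {a b c : ℤ} {i : ZMod n} {t : Bool} :
    radius i t ∈ loopQuad n a b c ↔ i = a := by
  cases t <;> simp [loopQuad]

theorem loopQuad_injective {a b c a' b' c' : ℤ} (ha : 0 ≤ a) (han : a < n) (hab : a < b)
    (hbc : b < c) (hc : c < a + n) (ha' : 0 ≤ a') (han' : a' < n) (hab' : a' < b') (hbc' : b' < c')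
    (hc' : c' < a' + n) (h : loopQuad n a b c = loopQuad n a' b' c') :
    a = a' ∧ b = b' ∧ c = c' := by
  have h1 : radius (a : ZMod n) true ∈ loopQuad n a' b' c' := h ▸ radius_mem_loopQuad_iff.2 rfl
  rw [radius_mem_loopQuad_iff, intCast_zmod_eq_iff] at h1
  obtain ⟨j, h1⟩ := h1
  obtain rfl : a = a' := by
    rcases mul_modulus_cases (m := n) j with h' | h' | h' | h' | h' <;> omega
  obtain ⟨k, hk⟩ := exists_of_chord_mem_loopQuad hab' hbc' hc' hab (by omega)
    (h ▸ mem_loopQuad₁ a b c)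
  obtain ⟨l, hl⟩ := exists_of_chord_mem_loopQuad hab' hbc' hc' hbc (by omega)
    (h ▸ mem_loopQuad₂ a b c)
  rcases mul_modulus_cases (m := n) k with h1 | h1 | h1 | h1 | h1 <;>
    rcases mul_modulus_cases (m := n) l with h2 | h2 | h2 | h2 | h2 <;> omega

theorem radius_mem_digonQuad_iff {a b : ℤ} {i : ZMod n} {t : Bool} :
    radius i t ∈ digonQuad n a b ↔ i = a ∧ t = true ∨ i = b ∧ t = false := by
  simp [digonQuad]

theorem digonQuad_injective {a b a' b' : ℤ} (ha : 0 ≤ a) (han : a < n) (hab : a < b)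
    (hb : b < a + n) (ha' : 0 ≤ a') (han' : a' < n) (hab' : a' < b') (hb' : b' < a' + n)
    (h : digonQuad n a b = digonQuad n a' b') : a = a' ∧ b = b' := by
  have h1 : radius (a : ZMod n) true ∈ digonQuad n a' b' :=
    h ▸ radius_mem_digonQuad_iff.2 (Or.inl ⟨rfl, rfl⟩)
  have h2 : radius (b : ZMod n) false ∈ digonQuad n a' b' :=
    h ▸ radius_mem_digonQuad_iff.2 (Or.inr ⟨rfl, rfl⟩)
  simp only [radius_mem_digonQuad_iff, and_true, reduceCtorEq, and_false, or_false, false_or,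
    intCast_zmod_eq_iff] at h1 h2
  obtain ⟨k, hk⟩ := h1
  obtain ⟨l, hl⟩ := h2
  rcases mul_modulus_cases (m := n) k with h1 | h1 | h1 | h1 | h1 <;>
    rcases mul_modulus_cases (m := n) l with h2 | h2 | h2 | h2 | h2 <;> omega

theorem bareDigon_injective {a b a' b' : ℤ} (ha : 0 ≤ a) (hab : a < b) (hb : b < n) (ha' : 0 ≤ a')
    (hab' : a' < b') (hb' : b' < n)
    (h : ({chord (a : ZMod n) (b : ZMod n), chord (b : ZMod n) (a : ZMod n)} :
      Set (TaggedCurve n)) = {chord (a' : ZMod n) (b' : ZMod n), chord (b' : ZMod n) (a' : ZMod n)}) :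
    a = a' ∧ b = b' := by
  have h1 : chord (a : ZMod n) (b : ZMod n) ∈
      ({chord (a' : ZMod n) (b' : ZMod n), chord (b' : ZMod n) (a' : ZMod n)} :
        Set (TaggedCurve n)) := h ▸ Or.inl rfl
  rw [← intCast_add_modulus a'] at h1
  rcases h1 with h1 | h1
  all_goals
    replace h1 : chord (a : ZMod n) (b : ZMod n) = chord _ _ := h1
    try rw [intCast_add_modulus a'] at h1
  · rw [chord_eq_chord_iff (by omega) (by omega) (by omega) (by omega)] at h1
    obtain ⟨k, h2, h3⟩ := h1
    rcases mul_modulus_cases (m := n) k with h' | h' | h' | h' | h' <;> omega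
  · rw [← intCast_add_modulus a', chord_eq_chord_iff (by omega) (by omega) (by omega) (by omega)] at h1
    obtain ⟨k, h2, h3⟩ := h1
    rcases mul_modulus_cases (m := n) k with h' | h' | h' | h' | h' <;> omega

theorem ncard_outerQuads (hn : 2 ≤ n) : (outerQuads n).ncard = n * (n - 1).choose 3 := by
  rw [← ncard_based_quadruples (m := n) (M := n - 1) (by omega) (outerQuad n)]
  · congr 1
    ext q
    constructor
    · rintro ⟨a, b, c, d, h1, h2, h3, h4, rfl⟩
      exact ⟨a, b, c, d, h1, h2, h3, by omega, rfl⟩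
    · rintro ⟨a, b, c, d, h1, h2, h3, h4, rfl⟩
      exact ⟨a, b, c, d, h1, h2, h3, by omega, rfl⟩
  · intro k a b c d
    simp only [outerQuad, intCast_add_mul_modulus]
  · intro a b c d a' b' c' d' h1 h2 h3 h4 h5 h6 h1' h2' h3' h4' h5' h6' h
    exact outerQuad_injective h1 h2 h3 h4 h5 (by omega) h1' h2' h3' h4' h5' (by omega) h

/-- Both tags contribute the same number of quadrilaterals. -/
theorem ncard_innerQuads (hn : 2 ≤ n) : (innerQuads n).ncard = 2 * (n * (n - 1).choose 2) := by
  have := finite_taggedCurve (n := n) (by omega)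
  have hcount : ∀ t : Bool,
      {q | ∃ a b c : ℤ, a < b ∧ b < c ∧ c ≤ a + (n - 1 : ℕ) ∧ q = innerQuad n a b c t}.ncard =
        n * (n - 1).choose 2 := by
    intro t
    refine ncard_based_triples (by omega) (fun a b c => innerQuad n a b c t) ?_ ?_
    · intro k a b c
      simp only [innerQuad, intCast_add_mul_modulus]
    · intro a b c a' b' c' h1 h2 h3 h4 h5 h1' h2' h3' h4' h5' h
      exact innerQuad_injective h1 h2 h3 h4 (by omega) h1' h2' h3' h4' (by omega) h
  rw [two_mul]
  nth_rewrite 1 [← hcount false]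
  rw [← hcount true, ← Set.ncard_union_eq ?_ (Set.toFinite _) (Set.toFinite _)]
  · congr 1
    ext q
    constructor
    · rintro ⟨a, b, c, t, h1, h2, h3, rfl⟩
      cases t
      · exact Or.inl ⟨a, b, c, h1, h2, by omega, rfl⟩
      · exact Or.inr ⟨a, b, c, h1, h2, by omega, rfl⟩
    · rintro (⟨a, b, c, h1, h2, h3, rfl⟩ | ⟨a, b, c, h1, h2, h3, rfl⟩)
      · exact ⟨a, b, c, false, h1, h2, by omega, rfl⟩
      · exact ⟨a, b, c, true, h1, h2, by omega, rfl⟩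
  · rw [Set.disjoint_left]
    rintro _ ⟨a, b, c, -, -, -, rfl⟩ ⟨a', b', c', -, -, -, h⟩
    cases tag_of_radius_mem_innerQuad (h ▸ mem_innerQuad₃ a b c false)

theorem ncard_loopQuads (hn : 2 ≤ n) : (loopQuads n).ncard = n * (n - 1).choose 2 := by
  rw [← ncard_based_triples (m := n) (M := n - 1) (by omega) (loopQuad n)]
  · congr 1
    ext q
    constructor
    · rintro ⟨a, b, c, h1, h2, h3, rfl⟩
      exact ⟨a, b, c, h1, h2, by omega, rfl⟩
    · rintro ⟨a, b, c, h1, h2, h3, rfl⟩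
      exact ⟨a, b, c, h1, h2, by omega, rfl⟩
  · intro k a b c
    simp only [loopQuad, intCast_add_mul_modulus]
  · intro a b c a' b' c' h1 h2 h3 h4 h5 h1' h2' h3' h4' h5' h
    exact loopQuad_injective h1 h2 h3 h4 (by omega) h1' h2' h3' h4' (by omega) h

theorem ncard_digonQuads (hn : 2 ≤ n) : (digonQuads n).ncard = n * (n - 1) := by
  rw [← ncard_based_pairs (m := n) (M := n - 1) (by omega) (digonQuad n)]
  · congr 1
    ext q
    constructor
    · rintro ⟨a, b, h1, h2, rfl⟩
      exact ⟨a, b, h1, by omega, rfl⟩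
    · rintro ⟨a, b, h1, h2, rfl⟩
      exact ⟨a, b, h1, by omega, rfl⟩
  · intro k a b
    simp only [digonQuad, intCast_add_mul_modulus]
  · intro a b a' b' h1 h2 h3 h4 h1' h2' h3' h4' h
    exact digonQuad_injective h1 h2 h3 (by omega) h1' h2' h3' (by omega) h

theorem ncard_bareDigons : (bareDigons n).ncard = n.choose 2 := by
  refine ncard_cyclic_pairs
    (fun a b => {chord (a : ZMod n) (b : ZMod n), chord (b : ZMod n) (a : ZMod n)}) ?_ ?_
  · intro a b
    simp only [intCast_add_modulus]
    exact Set.pair_comm _ _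
  · intro a b a' b' h1 h2 h3 h1' h2' h3' h
    exact bareDigon_injective h1 h2 h3 h1' h2' h3' h

theorem ncard_quadrilaterals (hn : 2 ≤ n) :
    (quadrilaterals n).ncard =
      n * (n - 1).choose 3 + 3 * (n * (n - 1).choose 2) + n * (n - 1) := by
  have := finite_taggedCurve (n := n) (by omega)
  rw [quadrilaterals_eq hn, Set.ncard_union_eq ?_ (Set.toFinite _) (Set.toFinite _),
    Set.ncard_union_eq ?_ (Set.toFinite _) (Set.toFinite _),
    Set.ncard_union_eq ?_ (Set.toFinite _) (Set.toFinite _), ncard_outerQuads hn,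
    ncard_innerQuads hn, ncard_loopQuads hn, ncard_digonQuads hn]
  · ring
  · rw [Set.disjoint_left]
    rintro _ ⟨a, b, c, d, -, -, -, -, rfl⟩ ⟨a', b', c', t, -, -, -, h⟩
    exact radius_notMem_outerQuad (h ▸ mem_innerQuad₃ a' b' c' t)
  · rw [Set.disjoint_left]
    rintro _ (⟨a, b, c, d, -, -, -, -, rfl⟩ | ⟨a, b, c, t, -, -, -, rfl⟩) ⟨a', b', c', -, -, -, h⟩
    · exact radius_notMem_outerQuad
        (h ▸ radius_mem_loopQuad_iff.2 rfl : radius (a' : ZMod n) true ∈ _)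
    · have h1 := tag_of_radius_mem_innerQuad
        (h ▸ radius_mem_loopQuad_iff.2 rfl : radius (a' : ZMod n) true ∈ innerQuad n a b c t)
      have h2 := tag_of_radius_mem_innerQuad
        (h ▸ radius_mem_loopQuad_iff.2 rfl : radius (a' : ZMod n) false ∈ innerQuad n a b c t)
      rw [← h1] at h2
      cases h2
  · rw [Set.disjoint_left]
    rintro q hq ⟨a', b', h3, h4, rfl⟩
    have h1 : radius (a' : ZMod n) true ∈ digonQuad n a' b' :=
      radius_mem_digonQuad_iff.2 (Or.inl ⟨rfl, rfl⟩)
    have h2 : radius (b' : ZMod n) false ∈ digonQuad n a' b' :=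
      radius_mem_digonQuad_iff.2 (Or.inr ⟨rfl, rfl⟩)
    rcases hq with (⟨a, b, c, d, -, -, -, -, h⟩ | ⟨a, b, c, t, -, -, -, h⟩) |
      ⟨a, b, c, -, -, -, h⟩
    · exact radius_notMem_outerQuad (h ▸ h1)
    · rw [h] at h1 h2
      cases (tag_of_radius_mem_innerQuad h1).trans (tag_of_radius_mem_innerQuad h2).symm
    · have h5 := radius_mem_loopQuad_iff.1 (h ▸ h1)
      exact intCast_ne_of_lt h3 h4 (h5.trans (radius_mem_loopQuad_iff.1 (h ▸ h2)).symm)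

theorem ncard_orbitQuadrilaterals (hn : 2 ≤ n) :
    (orbitQuadrilaterals n).ncard =
      n * (n - 1).choose 3 + n * (n - 1).choose 2 + n.choose 2 := by
  have := finite_taggedCurve (n := n) (by omega)
  rw [orbitQuadrilaterals_eq hn, Set.ncard_union_eq ?_ (Set.toFinite _) (Set.toFinite _),
    Set.ncard_union_eq ?_ (Set.toFinite _) (Set.toFinite _), ncard_outerQuads hn,
    ncard_loopQuads hn, ncard_bareDigons]
  · rw [Set.disjoint_left]
    rintro _ ⟨a, b, c, d, -, -, -, -, rfl⟩ ⟨a', b', c', -, -, -, h⟩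
    exact radius_notMem_outerQuad
      (h ▸ radius_mem_loopQuad_iff.2 rfl : radius (a' : ZMod n) true ∈ _)
  · rw [Set.disjoint_left]
    rintro _ (⟨a, b, c, d, h1, h2, h3, h4, rfl⟩ | ⟨a, b, c, -, -, -, rfl⟩) ⟨a', b', h5, h6, h⟩
    · -- the digon has no two sides with the same first vertex, unlike `ab` and `ad`
      have hab : chord (a : ZMod n) (b : ZMod n) ∈ outerQuad n a b c d := Or.inl rfl
      have had : chord (a : ZMod n) (d : ZMod n) ∈ outerQuad n a b c d :=
        Or.inr (Or.inr (Or.inr rfl))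
      have hbd := intCast_ne_of_lt (n := n) (a := b) (b := d) (by omega) (by omega)
      have hne := intCast_ne_of_lt h5 h6
      rw [h] at hab had
      simp only [Set.mem_insert_iff, Set.mem_singleton_iff, chord.injEq] at hab had
      rcases hab with hab | hab <;> rcases had with had | had
      · exact hbd (hab.2.trans had.2.symm)
      · exact hne (hab.1.symm.trans had.1)
      · exact hne (had.1.symm.trans hab.1)
      · exact hbd (hab.2.trans had.2.symm)
    · have h1 : radius (a : ZMod n) true ∈ loopQuad n a b c := radius_mem_loopQuad_iff.2 rfl
      rw [h] at h1
      rcases h1 with h1 | h1 <;> cases h1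

end PuncturedPolygon

/-! ### Comparison of the counts -/

theorem choose_two_closed_form (n : ℕ) : ((n + 1).choose 2 : ℚ) = 1 / 2 * n * (n + 1) := by
  rw [Nat.cast_choose_two]
  push_cast
  ring

theorem choose_three_closed_form (n : ℕ) :
    ((n + 1).choose 3 : ℚ) = 1 / 6 * (n - 1) * n * (n + 1) := by
  have h : ((n + 1).choose 3 : ℚ) * 3 = (n + 1) * n.choose 2 := by
    exact_mod_cast (Nat.add_one_mul_choose_eq n 2).symm
  rw [Nat.cast_choose_two] at h
  linear_combination h / 3

theorem choose_four_closed_form (n : ℕ) :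
    ((n + 2).choose 4 : ℚ) = 1 / 24 * (n - 1) * n * (n + 1) * (n + 2) := by
  have h : ((n + 2).choose 4 : ℚ) * 4 = (n + 2) * (n + 1).choose 3 := by
    exact_mod_cast (Nat.add_one_mul_choose_eq (n + 1) 3).symm
  rw [choose_three_closed_form] at h
  linear_combination h / 4

theorem mainTheorem5 :
    -- the convex polygon with `n + 3` vertices
    (∀ n : ℕ, (ConvexPolygon.quadrilaterals (n + 3)).ncard = (n + 3).choose 4) ∧
    -- the once-punctured polygon with `n` vertices
    (∀ n : ℕ, 2 ≤ n →
      (PuncturedPolygon.quadrilaterals n).ncard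
          = 4 * n.choose 4 + 9 * n.choose 3 + 2 * n.choose 2 ∧
      ((PuncturedPolygon.quadrilaterals n).ncard : ℚ)
          = 1 / 6 * n * (n - 1) * ((n : ℚ) ^ 2 + 4 * n - 6)) ∧
    -- the once-punctured polygon with `n + 1` vertices and the tag-switching action
    (∀ n : ℕ, 1 ≤ n →
      (PuncturedPolygon.orbitQuadrilaterals (n + 1)).ncard
          = 4 * (n + 1).choose 4 + 3 * (n + 1).choose 3 + (n + 1).choose 2 ∧
      ((PuncturedPolygon.orbitQuadrilaterals (n + 1)).ncard : ℚ)
          = 1 / 6 * n * (n + 1) * ((n : ℚ) ^ 2 + 2)) ∧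
    -- the vertex flip `α : Q₁ → Q₂` for the polygon with `2 * n + 2` vertices
    (∀ n : ℕ, 1 ≤ n →
      ∃ α : SymmetricPolygon.Q₁ n → SymmetricPolygon.Q₂ n, Function.Bijective α ∧
        ∀ (q : SymmetricPolygon.Q₁ n) (a b c d : ZMod (2 * n + 2)),
          SymmetricPolygon.IsHalfDiskList q.1 a b c d →
            ConvexPolygon.vertices (α q).1 = {a, c, d, SymmetricPolygon.opp b}) ∧
    -- the polygon with `2 * n + 2` vertices and its central symmetry
    (∀ n : ℕ, 1 ≤ n →
      ((SymmetricPolygon.orbitQuadrilaterals n).ncard : ℚ)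
          = 1 / 2 * (SymmetricPolygon.Q₁ n).ncard + (n + 1).choose 2 ∧
      ((SymmetricPolygon.orbitQuadrilaterals n).ncard : ℚ)
          = 1 / 6 * n * (n + 1) * ((n : ℚ) ^ 2 + 2)) := by
  refine ⟨fun n => ConvexPolygon.ncard_quadrilaterals (by omega), fun n hn => ?_, fun n hn => ?_,
    fun n _ => SymmetricPolygon.exists_vertex_flip n, fun n hn => ?_⟩
  · obtain ⟨k, rfl⟩ := Nat.exists_eq_add_of_le' hn
    have h : (PuncturedPolygon.quadrilaterals (k + 2)).ncard =
        4 * (k + 2).choose 4 + 9 * (k + 2).choose 3 + 2 * (k + 2).choose 2 := by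
      have h2 : (k + 2) * (k + 1).choose 1 = (k + 2).choose 2 * 2 :=
        Nat.add_one_mul_choose_eq (k + 1) 1
      have h3 : (k + 2) * (k + 1).choose 2 = (k + 2).choose 3 * 3 :=
        Nat.add_one_mul_choose_eq (k + 1) 2
      have h4 : (k + 2) * (k + 1).choose 3 = (k + 2).choose 4 * 4 :=
        Nat.add_one_mul_choose_eq (k + 1) 3
      rw [Nat.choose_one_right] at h2
      rw [PuncturedPolygon.ncard_quadrilaterals (by omega), show k + 2 - 1 = k + 1 from rfl]
      omega
    refine ⟨h, ?_⟩
    have h2 := choose_two_closed_form (k + 1)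
    have h3 := choose_three_closed_form (k + 1)
    have h4 := choose_four_closed_form k
    rw [h]
    push_cast at h2 h3 h4 ⊢
    rw [h2, h3, h4]
    ring
  · have h : (PuncturedPolygon.orbitQuadrilaterals (n + 1)).ncard =
        4 * (n + 1).choose 4 + 3 * (n + 1).choose 3 + (n + 1).choose 2 := by
      have h3 : (n + 1) * n.choose 2 = (n + 1).choose 3 * 3 := Nat.add_one_mul_choose_eq n 2
      have h4 : (n + 1) * n.choose 3 = (n + 1).choose 4 * 4 := Nat.add_one_mul_choose_eq n 3
      rw [PuncturedPolygon.ncard_orbitQuadrilaterals (by omega), Nat.add_sub_cancel]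
      omega
    refine ⟨h, ?_⟩
    obtain ⟨k, rfl⟩ := Nat.exists_eq_add_of_le' hn
    have h2 := choose_two_closed_form (k + 1)
    have h3 := choose_three_closed_form (k + 1)
    have h4 := choose_four_closed_form k
    rw [h]
    push_cast at h2 h3 h4 ⊢
    rw [h2, h3, h4]
    ring
  · have h2 := choose_two_closed_form n
    have h3 := choose_three_closed_form n
    rw [SymmetricPolygon.ncard_Q₁, SymmetricPolygon.ncard_orbitQuadrilaterals hn]
    push_cast
    rw [h2, h3]
    constructor <;> ring
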